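/- Let $\beta_0,\beta_A,\beta_X,\beta_U,\delta_0,\delta_A,\delta_X,\mu_X\in\mathbb R$, $\sigma_X^2,\sigma_\epsilon^2>0$, $\sigma_U^2\ge 0$, and $p_r\in(0,1)$. *Observational study.* The units $(A_i,X_i,U_i,Y_i)$ are i.i.d. with $X_i\sim\mathcal N(\mu_X,\sigma_X^2)$, $A_i\in\{0,1\}$, $P(A_i=1\mid X_i)=e_o(X_i)$, $$U_i=\delta_0+\delta_A A_i+\delta_X X_i+\nu_i,\qquad Y_i=\beta_0+\beta_A A_i+\beta_X X_i+\beta_U U_i+\epsilon_i,$$ where $\nu_i\sim\mathcal N(0,\sigma_U^2)$, $\epsilon_i\sim\mathcal N(0,\sigma_\epsilon^2)$, and $(A_i,X_i),\nu_i,\epsilon_i$ are independent. The propensity score $e_o$ is a measurable function that is either bounded away from $0$ and $1$ or logistic, $e_o(x)=\mathrm{expit}(\gamma_0+\gamma_1x)$. *Randomized trial (RCT).* The units $(A_i,X_i,U_i,Y_i)$ are i.i.d.; $(X_i,U_i)$ has the same joint law as in the observational study; $A_i\in\{0,1\}$ is independent of $(X_i,U_i)$ with $P(A_i=1)=p_r$;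 and $Y_i=\beta_0+\beta_A A_i+\beta_X X_i+\beta_U U_i+\epsilon_i$ with $\epsilon_i\sim\mathcal N(0,\sigma_\epsilon^2)$ independent of $(A_i,X_i,U_i)$. The propensity score is the constant $p_r$. The two datasets are independent. *Estimator.* From a sample of $N$ observed triples $(A_i,X_i,Y_i)$ and a propensity function $\hat e$, the inverse probability weighted (IPW) estimator is $$\hat\omega=\frac{\sum_{i=1}^N A_iY_i/\hat e(X_i)}{\sum_{i=1}^N A_i/\hat e(X_i)}-\frac{\sum_{i=1}^N(1-A_i)Y_i/(1-\hat e(X_i))}{\sum_{i=1}^N(1-A_i)/(1-\hat e(X_i))}\qquad(0/0:=0).$$ In each of the two datasets $\hat e$ is any one of: the true propensity score; the sample proportion of treated units, if the true propensity score is constant; the logistic regression fit $\mathrm{expit}(\hat\gamma_0+\hat\gamma_1x)$, if the true propensity score is logistic (including constant), where $(\hat\gamma_0,\hat\gamma_1)$ is a measurable function of the data that maximizes the likelihood whenever a maximizer exists (and is arbitrary otherwise). Let $\hat\omega^o$ be the IPW estimator from $m$ observational units and $\hat\omega^r$ the one from $n$ RCT units. Then both estimators have finite second moments for all sample sizes,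 and there are constants $V_o,V_r>0$ such that $$\sqrt m\,(\hat\omega^o-\beta_A-\beta_U\delta_A)\xrightarrow{d}\mathcal N(0,V_o),\qquad m\,\mathrm{Var}(\hat\omega^o)\to V_o\qquad(m\to\infty),$$ $$\sqrt n\,(\hat\omega^r-\beta_A)\xrightarrow{d}\mathcal N(0,V_r),\qquad n\,\mathrm{Var}(\hat\omega^r)\to V_r\qquad(n\to\infty).$$ Moreover, under $H_0:\omega^o=\omega^r$, where $\omega^o=\beta_A+\beta_U\delta_A$ and $\omega^r=\beta_A$, as $m,n\to\infty$ (jointly, at arbitrary rates) $$\frac{\hat\omega^o-\hat\omega^r}{\sqrt{V_o/m+V_r/n}}\xrightarrow{d}\mathcal N(0,1),$$ and for all consistent estimators $\hat V_o=\hat V_{o,m}$ of $V_o$ and $\hat V_r=\hat V_{r,n}$ of $V_r$ (random variables converging in probability), $$Z=\frac{\hat\omega^o-\hat\omega^r}{\sqrt{\hat V_o/m+\hat V_r/n}}\xrightarrow{d}\mathcal N(0,1).$$ -/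

import Mathlib

open MeasureTheory ProbabilityTheory Filter Topology
open scoped NNReal

/-- Parameters of the linear Gaussian model: coefficients of the outcome model (`β`),
coefficients of the model of the unmeasured confounder (`δ`), the mean of `X`, and the
variances of `X`, of the noise of `U` and of the noise of `Y`. -/
structure LinParams where
  β₀ : ℝ
  βA : ℝ
  βX : ℝ
  βU : ℝ
  δ₀ : ℝ
  δA : ℝ
  δX : ℝ
  μX : ℝ
  varX : ℝ≥0
  varU : ℝ≥0
  varε : ℝ≥0

/-- The estimable parameter of the observational study. -/
def LinParams.omegaObs (θ : LinParams) : ℝ := θ.βA + θ.βU * θ.δA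

/-- The estimable parameter of the randomized trial, equal to the average causal effect. -/
def LinParams.omegaRCT (θ : LinParams) : ℝ := θ.βA

/-- An infinite i.i.d. sample `(A i, X i, U i, Y i)` from the observational study, where
`e` is the propensity score, `ν` the noise of `U` and `ε` the noise of `Y`. -/
structure IsObsSample {Ω : Type*} [MeasurableSpace Ω] (P : Measure Ω) (θ : LinParams)
    (e : ℝ → ℝ) (A X U Y ν ε : ℕ → Ω → ℝ) : Prop where
  measurable_A : ∀ i, Measurable (A i)
  measurable_X : ∀ i, Measurable (X i)
  measurable_ν : ∀ i, Measurable (ν i)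
  measurable_ε : ∀ i, Measurable (ε i)
  binary : ∀ i ω, A i ω = 0 ∨ A i ω = 1
  law_X : ∀ i, HasLaw (X i) (gaussianReal θ.μX θ.varX) P
  law_ν : ∀ i, HasLaw (ν i) (gaussianReal 0 θ.varU) P
  law_ε : ∀ i, HasLaw (ε i) (gaussianReal 0 θ.varε) P
  /-- Since `A` is binary this reads `P(A = 1 | X) = e(X)`. -/
  propensity : ∀ i, P[A i | MeasurableSpace.comap (X i) inferInstance] =ᵐ[P] fun ω => e (X i ω)
  indep_ν : ∀ i, IndepFun (fun ω => (X i ω, A i ω)) (ν i) P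
  indep_ε : ∀ i, IndepFun (fun ω => (X i ω, A i ω, ν i ω)) (ε i) P
  U_eq : ∀ i ω, U i ω = θ.δ₀ + θ.δA * A i ω + θ.δX * X i ω + ν i ω
  Y_eq : ∀ i ω, Y i ω = θ.β₀ + θ.βA * A i ω + θ.βX * X i ω + θ.βU * U i ω + ε i ω
  indep_units : iIndepFun (fun i ω => (A i ω, X i ω, U i ω, Y i ω)) P

/-- An infinite i.i.d. sample `(A i, X i, U i, Y i)` from the randomized trial: `(X, U)` has
a prescribed joint law `L`, and the treatment is assigned with probability `p`, independently
of `(X, U)`. -/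
structure IsRCTSample {Ω : Type*} [MeasurableSpace Ω] (P : Measure Ω) (θ : LinParams)
    (p : ℝ) (L : Measure (ℝ × ℝ)) (A X U Y ε : ℕ → Ω → ℝ) : Prop where
  measurable_A : ∀ i, Measurable (A i)
  measurable_X : ∀ i, Measurable (X i)
  measurable_U : ∀ i, Measurable (U i)
  measurable_ε : ∀ i, Measurable (ε i)
  binary : ∀ i ω, A i ω = 0 ∨ A i ω = 1
  law_XU : ∀ i, HasLaw (fun ω => (X i ω, U i ω)) L P
  prob_A : ∀ i, P.real {ω | A i ω = 1} = p
  law_ε : ∀ i, HasLaw (ε i) (gaussianReal 0 θ.varε) P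
  indep_A : ∀ i, IndepFun (fun ω => (X i ω, U i ω)) (A i) P
  indep_ε : ∀ i, IndepFun (fun ω => (X i ω, U i ω, A i ω)) (ε i) P
  Y_eq : ∀ i ω, Y i ω = θ.β₀ + θ.βA * A i ω + θ.βX * X i ω + θ.βU * U i ω + ε i ω
  indep_units : iIndepFun (fun i ω => (A i ω, X i ω, U i ω, Y i ω)) P

/-- `e x = expit (γ₀ + γ₁ x)` with `γ = (γ₀, γ₁)`. -/
def IsLogisticWith (e : ℝ → ℝ) (γ : ℝ × ℝ) : Prop :=
  ∀ x, e x = Real.sigmoid (γ.1 + γ.2 * x)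

/-- The propensity score is bounded away from zero and one, or it is logistic. -/
def HasOverlap (e : ℝ → ℝ) : Prop :=
  (∃ c > 0, ∀ x, c ≤ e x ∧ e x ≤ 1 - c) ∨ ∃ γ, IsLogisticWith e γ

/-- A rule that produces, from the treatments `a` and covariates `x` of a sample of size `m`,
the propensity function used in the IPW estimator. -/
abbrev PropensityRule : Type := (m : ℕ) → (Fin m → ℝ) → (Fin m → ℝ) → ℝ → ℝ

/-- Log-likelihood of logistic regression of `a` on `x` (with intercept). -/
noncomputable def logisticLogLik {m : ℕ} (a x : Fin m → ℝ) (γ : ℝ × ℝ) : ℝ :=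
  ∑ i, (a i * Real.log (Real.sigmoid (γ.1 + γ.2 * x i))
    + (1 - a i) * Real.log (1 - Real.sigmoid (γ.1 + γ.2 * x i)))

/-- `g` is a maximum likelihood estimator for logistic regression: a measurable function of the
data which maximizes the likelihood whenever a maximizer exists. -/
def IsLogisticMLE (g : (m : ℕ) → (Fin m → ℝ) → (Fin m → ℝ) → ℝ × ℝ) : Prop :=
  ∀ m, Measurable (fun d : (Fin m → ℝ) × (Fin m → ℝ) => g m d.1 d.2) ∧
    ∀ a x : Fin m → ℝ, (∀ i, a i = 0 ∨ a i = 1) →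
      (∃ γ, IsMaxOn (logisticLogLik a x) Set.univ γ) →
        IsMaxOn (logisticLogLik a x) Set.univ (g m a x)

/-- The propensity rules considered for a population with propensity score `e`. -/
inductive IsPropensityRule (e : ℝ → ℝ) : PropensityRule → Prop
  /-- The true propensity score is used. -/
  | known : IsPropensityRule e (fun _ _ _ => e)
  /-- The propensity score is constant and estimated by the proportion of treated units. -/
  | proportion (p : ℝ) (he : ∀ x, e x = p) :
      IsPropensityRule e (fun m a _ _ => (∑ i, a i) / (m : ℝ))
  /-- The propensity score is logistic and estimated by logistic regression. -/
  | logistic (γ : ℝ × ℝ) (he : IsLogisticWith e γ)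
      (g : (m : ℕ) → (Fin m → ℝ) → (Fin m → ℝ) → ℝ × ℝ) (hg : IsLogisticMLE g) :
      IsPropensityRule e
        (fun m a x t => Real.sigmoid ((g m a x).1 + (g m a x).2 * t))

/-- The (normalized) inverse probability weighted estimate, with propensity function `e`. -/
noncomputable def ipw {m : ℕ} (e : ℝ → ℝ) (a x y : Fin m → ℝ) : ℝ :=
  (∑ i, a i * y i / e (x i)) / (∑ i, a i / e (x i))
    - (∑ i, (1 - a i) * y i / (1 - e (x i))) / (∑ i, (1 - a i) / (1 - e (x i)))

/-- The IPW estimator computed from the first `m` units. -/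
noncomputable def ipwEstimator {Ω : Type*} (r : PropensityRule) (A X Y : ℕ → Ω → ℝ)
    (m : ℕ) (ω : Ω) : ℝ :=
  ipw (r m (fun i => A i ω) (fun i => X i ω))
    (fun i : Fin m => A i ω) (fun i => X i ω) (fun i => Y i ω)

/-! In each dataset `Y = b + τ * A + R`, where `R` is centered and, given `X`, uncorrelated with
`A`. In the observational study the part `δA * A` of `U` joins the treatment effect, so `τ = βA + βU
* δA`. In the trial `U` is independent of `A` and stays in the residual, so `τ = βA`. Because the
weights are normalized, `b` and `τ * A` are reproduced exactly when the denominators are nonzero,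
and the estimator minus `τ` is `N₁ / D₁ - N₀ / D₀`: in each arm `N` is the weighted mean of `R` and
`D` that of `1`. These fluctuate around `0` and `1` at rate `m ^ (-1/2)`, so replacing `D` by `1`
costs only order `1 / m` (`lpOrder_ipwEstimator_sub`).

With the true score, `N₁ - N₀` is a mean of i.i.d. centered terms. With a logistic fit it is
expanded in the deviation `d` of the maximum likelihood estimate; the score equations turn the
linear term in `d` into another i.i.d. mean, up to order `1 / m`. A fitted proportion cancels from
the ratios. So the estimator is always `τ + avg ψ + Δ` (`AsymptoticallyLinear`), with `ψ = w(A, X) R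
+ v(A, X)` and `w ≠ 0`. Its variance is positive because `R` contains the independent noise `ε`.

Convergence of `m * Var` needs control of moments, not only in probability. Remainders are therefore
measured in all `L^k` at once (`LpOrder`). Hölder makes this calculus multiplicative, and even
moments of sums give centered means order `1`. Exceptional events (small denominators, an
ill-behaved likelihood) have probability below every power of `m`, while the estimator is at most `2
* ∑ |Y i|` there, so they are negligible. The central limit theorem and an expansion of the variance
finish each dataset (`asymptotics_of_linearization`).

For the difference, `m` and `n` are unrelated. The coefficients of the two standardized errors lie
on a fixed ellipse, so along a subsequence they converge, and independence gives the same limit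
`N(0, 1)` every time. Slutsky's theorem then inserts the estimated variances. -/

/-! ### Calculus of orders of magnitude in all `L^k` norms. -/

section LpOrder

variable {Ω : Type*} [MeasurableSpace Ω] {P : Measure Ω}

/-- A measurable function with finite absolute moments of all orders. -/
structure AllMoments (P : Measure Ω) (f : Ω → ℝ) : Prop where
  measurable : Measurable f
  bound : ∀ k : ℕ, eLpNorm f k P < ⊤

/-- The sequence `f m` is of order `m ^ (-a / 2)` in `L^k` for every `k`. -/
structure LpOrder (P : Measure Ω) (a : ℕ) (f : ℕ → Ω → ℝ) : Prop where
  measurable : ∀ m, Measurable (f m)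
  bound : ∀ k : ℕ, ∃ C : ℝ≥0, ∀ m : ℕ, eLpNorm (fun ω => √((m : ℝ) + 1) ^ a * f m ω) k P ≤ C

lemma AllMoments.lpOrder {f : Ω → ℝ} (hf : AllMoments P f) : LpOrder P 0 (fun _ => f) := by
  refine ⟨fun _ => hf.measurable, fun k => ⟨(eLpNorm f k P).toNNReal, fun m => ?_⟩⟩
  rw [ENNReal.coe_toNNReal (hf.bound k).ne]
  simp

lemma LpOrder.allMoments {f : ℕ → Ω → ℝ} (hf : LpOrder P 0 f) (m : ℕ) :
    AllMoments P (f m) := by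
  refine ⟨hf.measurable m, fun k => ?_⟩
  obtain ⟨C, hC⟩ := hf.bound k
  have := hC m
  simp only [pow_zero, one_mul] at this
  exact this.trans_lt ENNReal.coe_lt_top

lemma LpOrder.of_abs_le {a : ℕ} {f g : ℕ → Ω → ℝ} (hg : LpOrder P a g)
    (hf : ∀ m, Measurable (f m)) (h : ∀ m ω, |f m ω| ≤ |g m ω|) : LpOrder P a f := by
  refine ⟨hf, fun k => ?_⟩
  obtain ⟨C, hC⟩ := hg.bound k
  refine ⟨C, fun m => (eLpNorm_mono fun ω => ?_).trans (hC m)⟩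
  simp only [norm_mul, Real.norm_eq_abs]
  exact mul_le_mul_of_nonneg_left (h m ω) (abs_nonneg _)

lemma LpOrder.of_le {a : ℕ} {f g : ℕ → Ω → ℝ} (hg : LpOrder P a g)
    (hf : ∀ m, Measurable (f m)) (h : ∀ m ω, |f m ω| ≤ g m ω) : LpOrder P a f :=
  hg.of_abs_le hf fun m ω => (h m ω).trans (le_abs_self _)

lemma LpOrder.abs {a : ℕ} {f : ℕ → Ω → ℝ} (hf : LpOrder P a f) :
    LpOrder P a (fun m ω => |f m ω|) :=
  hf.of_abs_le (fun m => (hf.measurable m).norm) fun _ _ => (abs_abs _).le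

lemma LpOrder.neg {a : ℕ} {f : ℕ → Ω → ℝ} (hf : LpOrder P a f) :
    LpOrder P a (fun m ω => - f m ω) :=
  hf.of_abs_le (fun m => (hf.measurable m).neg) fun _ _ => (abs_neg _).le

lemma LpOrder.add {a : ℕ} {f g : ℕ → Ω → ℝ} (hf : LpOrder P a f) (hg : LpOrder P a g) :
    LpOrder P a (fun m ω => f m ω + g m ω) := by
  refine ⟨fun m => (hf.measurable m).add (hg.measurable m), fun k => ?_⟩
  -- Minkowski needs exponent at least `1`; for exponent `0` the seminorm is `0` by definition.
  rcases Nat.eq_zero_or_pos k with rfl | hk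
  · exact ⟨0, fun m => by simp⟩
  obtain ⟨C, hC⟩ := hf.bound k
  obtain ⟨D, hD⟩ := hg.bound k
  refine ⟨C + D, fun m => ?_⟩
  have : (fun ω => √((m : ℝ) + 1) ^ a * (f m ω + g m ω))
      = (fun ω => √((m : ℝ) + 1) ^ a * f m ω) + (fun ω => √((m : ℝ) + 1) ^ a * g m ω) := by
    ext ω; simp [mul_add]
  rw [this, ENNReal.coe_add]
  refine (eLpNorm_add_le ((hf.measurable m).const_mul _).aestronglyMeasurable
    ((hg.measurable m).const_mul _).aestronglyMeasurable (by exact_mod_cast hk)).trans ?_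
  gcongr
  · exact hC m
  · exact hD m

lemma LpOrder.sub {a : ℕ} {f g : ℕ → Ω → ℝ} (hf : LpOrder P a f) (hg : LpOrder P a g) :
    LpOrder P a (fun m ω => f m ω - g m ω) := by
  simpa only [sub_eq_add_neg] using hf.add hg.neg

/-- Hölder with `1/(2k) + 1/(2k) = 1/k`. The passage from `k` to `2k` is why bounds are required for
every `k` simultaneously. -/
lemma LpOrder.mul {a b : ℕ} {f g : ℕ → Ω → ℝ} (hf : LpOrder P a f) (hg : LpOrder P b g) :
    LpOrder P (a + b) (fun m ω => f m ω * g m ω) := by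
  refine ⟨fun m => (hf.measurable m).mul (hg.measurable m), fun k => ?_⟩
  rcases Nat.eq_zero_or_pos k with rfl | hk
  · exact ⟨0, fun m => by simp⟩
  obtain ⟨C, hC⟩ := hf.bound (2 * k)
  obtain ⟨D, hD⟩ := hg.bound (2 * k)
  refine ⟨C * D, fun m => ?_⟩
  have : (fun ω => √((m : ℝ) + 1) ^ (a + b) * (f m ω * g m ω))
      = (fun ω => √((m : ℝ) + 1) ^ a * f m ω) • (fun ω => √((m : ℝ) + 1) ^ b * g m ω) := by
    ext ω; simp; ring
  rw [this, ENNReal.coe_mul]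
  have : ENNReal.HolderTriple ((2 * k : ℕ) : ENNReal) ((2 * k : ℕ) : ENNReal) (k : ENNReal) := by
    constructor
    push_cast
    rw [ENNReal.mul_inv (by simp) (by simp), ← add_mul, ENNReal.inv_two_add_inv_two, one_mul]
  refine (eLpNorm_smul_le_mul_eLpNorm (p := ((2 * k : ℕ) : ENNReal)) (q := ((2 * k : ℕ) : ENNReal))
    ((hg.measurable m).const_mul _).aestronglyMeasurable
    ((hf.measurable m).const_mul _).aestronglyMeasurable).trans ?_
  gcongr
  · exact hC m
  · exact hD m

lemma one_le_sqrt_natCast_add_one (m : ℕ) : 1 ≤ √((m : ℝ) + 1) := by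
  rw [Real.one_le_sqrt]
  linarith [Nat.cast_nonneg (α := ℝ) m]

lemma LpOrder.mono {a b : ℕ} {f : ℕ → Ω → ℝ} (hf : LpOrder P a f) (hab : b ≤ a) :
    LpOrder P b f := by
  refine ⟨hf.measurable, fun k => ?_⟩
  obtain ⟨C, hC⟩ := hf.bound k
  refine ⟨C, fun m => (eLpNorm_mono fun ω => ?_).trans (hC m)⟩
  simp only [norm_mul, Real.norm_eq_abs, norm_pow]
  gcongr
  rw [abs_of_nonneg (Real.sqrt_nonneg _)]
  exact one_le_sqrt_natCast_add_one m

lemma allMoments_const [IsProbabilityMeasure P] (c : ℝ) : AllMoments P (fun _ => c) :=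
  ⟨measurable_const, fun _ => (memLp_const c).2⟩

lemma lpOrder_const [IsProbabilityMeasure P] (c : ℝ) : LpOrder P 0 (fun _ _ => c) :=
  (allMoments_const c).lpOrder

lemma LpOrder.const_mul [IsProbabilityMeasure P] {a : ℕ} {f : ℕ → Ω → ℝ} (c : ℝ)
    (hf : LpOrder P a f) : LpOrder P a (fun m ω => c * f m ω) := by
  simpa using (lpOrder_const c).mul hf

/-- Multiplication by the sample size lowers the order by two. -/
lemma LpOrder.natCast_mul {a : ℕ} {f : ℕ → Ω → ℝ} (hf : LpOrder P (a + 2) f) :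
    LpOrder P a (fun m ω => (m : ℝ) * f m ω) := by
  refine ⟨fun m => (hf.measurable m).const_mul _, fun k => ?_⟩
  obtain ⟨C, hC⟩ := hf.bound k
  refine ⟨C, fun m => (eLpNorm_mono fun ω => ?_).trans (hC m)⟩
  have : (0 : ℝ) ≤ m := Nat.cast_nonneg m
  rw [pow_add, Real.sq_sqrt (by positivity), mul_assoc]
  simp only [norm_mul, Real.norm_eq_abs]
  rw [abs_of_nonneg this, abs_of_nonneg (by positivity : (0 : ℝ) ≤ √((m : ℝ) + 1) ^ a),
    abs_of_nonneg (by positivity : (0 : ℝ) ≤ (m : ℝ) + 1)]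
  gcongr
  linarith

section AllMoments

variable {f g : Ω → ℝ}

lemma AllMoments.memLp (hf : AllMoments P f) (k : ℕ) : MemLp f k P :=
  ⟨hf.measurable.aestronglyMeasurable, hf.bound k⟩

lemma AllMoments.integrable (hf : AllMoments P f) : Integrable f P :=
  memLp_one_iff_integrable.1 (by simpa using hf.memLp 1)

lemma AllMoments.add (hf : AllMoments P f) (hg : AllMoments P g) :
    AllMoments P (fun ω => f ω + g ω) := (hf.lpOrder.add hg.lpOrder).allMoments 0

lemma AllMoments.sub (hf : AllMoments P f) (hg : AllMoments P g) :
    AllMoments P (fun ω => f ω - g ω) := (hf.lpOrder.sub hg.lpOrder).allMoments 0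

lemma AllMoments.mul (hf : AllMoments P f) (hg : AllMoments P g) :
    AllMoments P (fun ω => f ω * g ω) := (hf.lpOrder.mul hg.lpOrder).allMoments 0

lemma AllMoments.abs (hf : AllMoments P f) : AllMoments P (fun ω => |f ω|) :=
  hf.lpOrder.abs.allMoments 0

lemma AllMoments.const_mul [IsProbabilityMeasure P] (c : ℝ) (hf : AllMoments P f) :
    AllMoments P (fun ω => c * f ω) := (hf.lpOrder.const_mul c).allMoments 0

lemma AllMoments.pow [IsProbabilityMeasure P] (hf : AllMoments P f) (n : ℕ) :
    AllMoments P (fun ω => f ω ^ n) := by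
  induction n with
  | zero => simpa using allMoments_const 1
  | succ n ih => simpa only [pow_succ] using ih.mul hf

lemma AllMoments.of_abs_le (hg : AllMoments P g) (hf : Measurable f)
    (h : ∀ ω, |f ω| ≤ |g ω|) : AllMoments P f :=
  (hg.lpOrder.of_abs_le (f := fun _ => f) (fun _ => hf) fun _ => h).allMoments 0

lemma AllMoments.of_bound [IsProbabilityMeasure P] (hf : Measurable f) (c : ℝ)
    (h : ∀ ω, |f ω| ≤ c) : AllMoments P f :=
  (allMoments_const c).of_abs_le hf fun ω => (h ω).trans (le_abs_self _)

lemma AllMoments.identDistrib {Ω' : Type*} [MeasurableSpace Ω'] {P' : Measure Ω'} {h : Ω' → ℝ}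
    (hf : AllMoments P f) (hh : Measurable h) (hfh : IdentDistrib h f P' P) : AllMoments P' h :=
  ⟨hh, fun k => by rw [hfh.eLpNorm_eq]; exact hf.bound k⟩

end AllMoments

/-- Large deviations of a sequence of positive order have probability of every order. -/
lemma LpOrder.indicator [IsProbabilityMeasure P] {f : ℕ → Ω → ℝ} (hf : LpOrder P 1 f)
    {δ : ℝ} (hδ : 0 < δ) {B : ℕ → Set Ω} (hB : ∀ m, MeasurableSet (B m))
    (h : ∀ m, ∀ ω ∈ B m, δ ≤ |f m ω|) (a : ℕ) :
    LpOrder P a (fun m => (B m).indicator 1) := by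
  -- Markov's inequality in pointwise form: the indicator is at most `|f / δ| ^ n` for every `n`,
  -- and this power has order `n`.
  have key : ∀ n : ℕ, LpOrder P n (fun m ω => (δ⁻¹ * f m ω) ^ n) := by
    intro n
    induction n with
    | zero => simpa using lpOrder_const 1
    | succ n ih => simpa only [pow_succ] using ih.mul (hf.const_mul δ⁻¹)
  refine (key a).of_abs_le (fun m => measurable_one.indicator (hB m)) fun m ω => ?_
  by_cases hω : ω ∈ B m
  · simp only [Set.indicator_of_mem hω, Pi.one_apply, abs_one, abs_pow, abs_mul, abs_inv,
      abs_of_pos hδ]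
    refine one_le_pow₀ ?_
    rw [inv_mul_eq_div, one_le_div hδ]
    exact h m ω hω
  · simp only [Set.indicator_of_notMem hω, abs_zero]
    positivity

end LpOrder

/-! ### Moments of sample means. -/

section Averages

variable {Ω : Type*}

/-- The sample mean of the first `m` terms. -/
noncomputable def avg (f : ℕ → Ω → ℝ) (m : ℕ) (ω : Ω) : ℝ :=
  (∑ i ∈ Finset.range m, f i ω) / m

lemma avg_add (f g : ℕ → Ω → ℝ) (m : ℕ) (ω : Ω) :
    avg (fun i ω => f i ω + g i ω) m ω = avg f m ω + avg g m ω := by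
  simp [avg, Finset.sum_add_distrib, add_div]

lemma avg_sub (f g : ℕ → Ω → ℝ) (m : ℕ) (ω : Ω) :
    avg (fun i ω => f i ω - g i ω) m ω = avg f m ω - avg g m ω := by
  simp [avg, Finset.sum_sub_distrib, sub_div]

lemma avg_const_mul (c : ℝ) (f : ℕ → Ω → ℝ) (m : ℕ) (ω : Ω) :
    avg (fun i ω => c * f i ω) m ω = c * avg f m ω := by
  simp [avg, ← Finset.mul_sum, mul_div_assoc]

variable [MeasurableSpace Ω] {P : Measure Ω}

lemma measurable_avg {f : ℕ → Ω → ℝ} (hf : ∀ i, Measurable (f i)) (m : ℕ) :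
    Measurable (avg f m) :=
  (Finset.measurable_fun_sum _ fun i _ => hf i).div_const _

lemma lpOrder_avg [IsProbabilityMeasure P] {f : ℕ → Ω → ℝ} (hf : AllMoments P (f 0))
    (hm : ∀ i, Measurable (f i)) (hid : ∀ i, IdentDistrib (f i) (f 0) P P) :
    LpOrder P 0 (avg f) := by
  refine ⟨measurable_avg hm, fun k => ?_⟩
  refine ⟨(eLpNorm (f 0) k P).toNNReal, fun m => ?_⟩
  rw [ENNReal.coe_toNNReal (hf.bound k).ne]
  simp only [pow_zero, one_mul]
  rcases Nat.eq_zero_or_pos k with rfl | hk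
  · simp
  have h1 : (fun ω => avg f m ω) = (m : ℝ)⁻¹ • ∑ i ∈ Finset.range m, f i := by
    ext ω
    simp [avg, div_eq_inv_mul]
  rw [h1, eLpNorm_const_smul]
  have h2 := eLpNorm_sum_le (p := k) (μ := P) (f := f) (s := Finset.range m)
    (fun i _ => (hm i).aestronglyMeasurable) (by exact_mod_cast hk)
  simp only [fun i => (hid i).eLpNorm_eq (p := k), Finset.sum_const, Finset.card_range,
    nsmul_eq_mul] at h2
  rcases Nat.eq_zero_or_pos m with rfl | hm0
  · simp
  calc ‖(m : ℝ)⁻¹‖ₑ * eLpNorm (∑ i ∈ Finset.range m, f i) k P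
      ≤ ‖(m : ℝ)⁻¹‖ₑ * ((m : ENNReal) * eLpNorm (f 0) k P) := by gcongr
    _ = eLpNorm (f 0) k P := by
      rw [← mul_assoc]
      have : ‖(m : ℝ)⁻¹‖ₑ * (m : ENNReal) = 1 := by
        rw [enorm_inv (by positivity), Real.enorm_natCast]
        exact ENNReal.inv_mul_cancel (by exact_mod_cast hm0.ne') (by simp)
      rw [this, one_mul]

/-- A Taylor remainder, by induction: the remainder of the next power is `s + x` times the previous
one plus `(j + 2) * s ^ (j + 1) * x ^ 2`. It isolates the linear term, which vanishes in expectation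
when `x` is centered and independent of `s`. -/
lemma exists_abs_add_pow_sub_le (j : ℕ) : ∃ c : ℝ, 0 ≤ c ∧ ∀ s x : ℝ,
    |(s + x) ^ (j + 2) - s ^ (j + 2) - (j + 2) * s ^ (j + 1) * x|
      ≤ c * x ^ 2 * (|s| + |x|) ^ j := by
  induction j with
  | zero =>
    refine ⟨1, zero_le_one, fun s x => le_of_eq ?_⟩
    have : (s + x) ^ 2 - s ^ 2 - 2 * s * x = x ^ 2 := by ring
    simp [this]
  | succ j ih =>
    obtain ⟨c, hc, h⟩ := ih
    refine ⟨c + (j + 2), by positivity, fun s x => ?_⟩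
    have e : (s + x) ^ (j + 1 + 2) - s ^ (j + 1 + 2)
          - (((j + 1 : ℕ) : ℝ) + 2) * s ^ (j + 1 + 1) * x
        = (s + x) * ((s + x) ^ (j + 2) - s ^ (j + 2) - (j + 2) * s ^ (j + 1) * x)
          + (j + 2) * s ^ (j + 1) * x ^ 2 := by push_cast; ring
    rw [e]
    have hj : (0 : ℝ) ≤ (j : ℝ) + 2 := by positivity
    calc _ ≤ |s + x| * |(s + x) ^ (j + 2) - s ^ (j + 2) - (j + 2) * s ^ (j + 1) * x|
          + (j + 2) * |s| ^ (j + 1) * x ^ 2 := by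
          refine (abs_add_le _ _).trans (le_of_eq ?_)
          rw [abs_mul, abs_mul, abs_mul, abs_pow, abs_of_nonneg hj, abs_of_nonneg (sq_nonneg x)]
      _ ≤ (|s| + |x|) * (c * x ^ 2 * (|s| + |x|) ^ j)
          + (j + 2) * (|s| + |x|) ^ (j + 1) * x ^ 2 := by
          gcongr
          · exact abs_add_le _ _
          · exact h s x
          · exact le_add_of_nonneg_right (abs_nonneg x)
      _ = _ := by ring

lemma AllMoments.sum {f : ℕ → Ω → ℝ} [IsProbabilityMeasure P] (hf : ∀ i, AllMoments P (f i))
    (m : ℕ) : AllMoments P (fun ω => ∑ i ∈ Finset.range m, f i ω) := by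
  induction m with
  | zero => simpa using allMoments_const (P := P) 0
  | succ m ih => simpa only [Finset.sum_range_succ] using ih.add (hf m)

/-- Even moments of sums of centered i.i.d. random variables. -/
lemma exists_integral_sum_pow_le [IsProbabilityMeasure P] {f : ℕ → Ω → ℝ}
    (hf : AllMoments P (f 0)) (hm : ∀ i, Measurable (f i))
    (hid : ∀ i, IdentDistrib (f i) (f 0) P P)
    (hindep : iIndepFun f P) (h0 : ∫ ω, f 0 ω ∂P = 0) (k : ℕ) :
    ∃ C : ℝ, 0 ≤ C ∧ ∀ m : ℕ, ∫ ω, (∑ i ∈ Finset.range m, f i ω) ^ (2 * k) ∂P ≤ C * m ^ k := by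
  have hfi : ∀ i, AllMoments P (f i) := fun i => hf.identDistrib (hm i) (hid i)
  have hsum := AllMoments.sum hfi
  induction k with
  | zero => exact ⟨1, zero_le_one, fun m => by simp⟩
  | succ k ih =>
    obtain ⟨C, hC, ih⟩ := ih
    obtain ⟨c, hc, hrem⟩ := exists_abs_add_pow_sub_le (2 * k)
    set M₂ := ∫ ω, f 0 ω ^ 2 ∂P with hM₂
    set M := ∫ ω, f 0 ω ^ (2 * k + 2) ∂P with hM
    have hM₂0 : 0 ≤ M₂ := integral_nonneg fun ω => sq_nonneg _
    have hM0 : 0 ≤ M := integral_nonneg fun ω => by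
      rw [← Nat.mul_succ, pow_mul]; positivity
    -- Adding one summand raises the moment of order `2k + 2` by at most `c * 2 ^ (2k) * (M₂ * E[S ^
    -- (2k)] + M)`, and the outer induction bounds `E[S ^ (2k)]` by `C * m ^ k`. Adding up `m` such
    -- increments yields `m ^ (k + 1)`.
    refine ⟨c * 2 ^ (2 * k) * (M₂ * C + M), by positivity, fun m => ?_⟩
    induction m with
    | zero => simp [Nat.mul_succ]
    | succ m ihm =>
      set S : Ω → ℝ := fun ω => ∑ i ∈ Finset.range m, f i ω with hS
      have hSm : AllMoments P S := hsum m
      have hind : IndepFun S (f m) P := by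
        convert hindep.indepFun_sum_range_succ hm m
        ext ω
        simp [hS]
      have hpt : ∀ ω, (S ω + f m ω) ^ (2 * k + 2) ≤ S ω ^ (2 * k + 2)
          + (2 * k + 2) * (S ω ^ (2 * k + 1) * f m ω)
          + c * 2 ^ (2 * k) * (S ω ^ (2 * k) * f m ω ^ 2 + f m ω ^ (2 * k + 2)) := by
        intro ω
        have h1 := (abs_le.1 (hrem (S ω) (f m ω))).2
        have h2 : (|S ω| + |f m ω|) ^ (2 * k) ≤ 2 ^ (2 * k) * (S ω ^ (2 * k) + f m ω ^ (2 * k)) := by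
          refine (add_pow_le (abs_nonneg _) (abs_nonneg _) _).trans ?_
          rw [Even.pow_abs ⟨k, two_mul k⟩, Even.pow_abs ⟨k, two_mul k⟩]
          have e1 : 0 ≤ S ω ^ (2 * k) := by rw [pow_mul]; positivity
          have e2 : 0 ≤ f m ω ^ (2 * k) := by rw [pow_mul]; positivity
          gcongr
          · norm_num
          · omega
        have h3 : c * f m ω ^ 2 * (|S ω| + |f m ω|) ^ (2 * k)
            ≤ c * f m ω ^ 2 * (2 ^ (2 * k) * (S ω ^ (2 * k) + f m ω ^ (2 * k))) := by gcongr
        push_cast at h1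
        have h4 : c * f m ω ^ 2 * (2 ^ (2 * k) * (S ω ^ (2 * k) + f m ω ^ (2 * k)))
          = c * 2 ^ (2 * k) * (S ω ^ (2 * k) * f m ω ^ 2 + f m ω ^ (2 * k + 2)) := by ring
        linarith
      have i1 := (hSm.pow (2 * k + 2)).integrable
      have i2 := (((hSm.pow (2 * k + 1)).mul (hfi m)).const_mul (2 * k + 2)).integrable
      have i3 := ((hSm.pow (2 * k)).mul ((hfi m).pow 2)).integrable
      have i4 := ((hfi m).pow (2 * k + 2)).integrable
      have i5 := (i3.add i4).const_mul (c * 2 ^ (2 * k))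
      have e2 : ∫ ω, S ω ^ (2 * k + 1) * f m ω ∂P = 0 := by
        have := (hind.comp (measurable_id.pow_const (2 * k + 1))
          measurable_id).integral_fun_mul_eq_mul_integral
          (by exact (hSm.measurable.pow_const _).aestronglyMeasurable)
          (by exact (hm m).aestronglyMeasurable)
        simp only [Function.comp_apply, id] at this
        rw [this, (hid m).integral_eq, h0, mul_zero]
      have e3 : ∫ ω, S ω ^ (2 * k) * f m ω ^ 2 ∂P = (∫ ω, S ω ^ (2 * k) ∂P) * M₂ := by
        have := (hind.comp (measurable_id.pow_const (2 * k))
          (measurable_id.pow_const 2)).integral_fun_mul_eq_mul_integral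
          (by exact (hSm.measurable.pow_const _).aestronglyMeasurable)
          (by exact ((hm m).pow_const _).aestronglyMeasurable)
        simp only [Function.comp_apply, id] at this
        rw [this]
        congr 1
        exact ((hid m).comp (measurable_id.pow_const 2)).integral_eq
      have e4 : ∫ ω, f m ω ^ (2 * k + 2) ∂P = M :=
        ((hid m).comp (measurable_id.pow_const (2 * k + 2))).integral_eq
      have hint := integral_mono (((hSm.add (hfi m)).pow (2 * k + 2)).integrable)
        ((i1.add i2).add i5) hpt
      have hcalc : ∫ ω, ((fun ω => S ω ^ (2 * k + 2)) + fun ω =>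
          ((2 : ℝ) * k + 2) * (S ω ^ (2 * k + 1) * f m ω)) ω + (fun ω => c * 2 ^ (2 * k) *
            ((fun ω => S ω ^ (2 * k) * f m ω ^ 2) + fun ω => f m ω ^ (2 * k + 2)) ω) ω ∂P
          = ∫ ω, S ω ^ (2 * k + 2) ∂P
            + c * 2 ^ (2 * k) * ((∫ ω, S ω ^ (2 * k) ∂P) * M₂ + M) := by
        rw [integral_add (i1.add i2) i5]
        simp only [Pi.add_apply]
        rw [integral_add i1 i2, integral_const_mul, integral_const_mul, e2,
          integral_add i3 i4, e3, e4]
        ring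
      have hle : ∫ ω, (S ω + f m ω) ^ (2 * k + 2) ∂P ≤ ∫ ω, S ω ^ (2 * k + 2) ∂P
            + c * 2 ^ (2 * k) * ((∫ ω, S ω ^ (2 * k) ∂P) * M₂ + M) := hint.trans_eq hcalc
      simp only [Finset.sum_range_succ, Nat.mul_succ]
      refine hle.trans ?_
      have a1 : ∫ ω, S ω ^ (2 * k + 2) ∂P ≤ c * 2 ^ (2 * k) * (M₂ * C + M) * m ^ (k + 1) := ihm
      have a2 : ∫ ω, S ω ^ (2 * k) ∂P ≤ C * ((m + 1 : ℕ) : ℝ) ^ k := by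
        refine (ih m).trans ?_
        gcongr
        omega
      have a3 : (1 : ℝ) ≤ ((m + 1 : ℕ) : ℝ) ^ k :=
        one_le_pow₀ (by push_cast; linarith [Nat.cast_nonneg (α := ℝ) m])
      calc _ ≤ c * 2 ^ (2 * k) * (M₂ * C + M) * m ^ (k + 1)
            + c * 2 ^ (2 * k) * ((C * ((m + 1 : ℕ) : ℝ) ^ k) * M₂ + M * ((m + 1 : ℕ) : ℝ) ^ k) := by
            gcongr
            exact le_mul_of_one_le_right hM0 a3
        _ = c * 2 ^ (2 * k) * (M₂ * C + M) * ((m : ℝ) ^ k * m + ((m + 1 : ℕ) : ℝ) ^ k) := by ring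
        _ ≤ c * 2 ^ (2 * k) * (M₂ * C + M) * (((m + 1 : ℕ) : ℝ) ^ k * m + ((m + 1 : ℕ) : ℝ) ^ k) := by
            gcongr
            omega
        _ = _ := by push_cast; ring

/-- Sample means of centered i.i.d. random variables with all moments are of order `1`. -/
lemma lpOrder_avg_of_integral_eq_zero [IsProbabilityMeasure P] {f : ℕ → Ω → ℝ}
    (hf : AllMoments P (f 0)) (hm : ∀ i, Measurable (f i))
    (hid : ∀ i, IdentDistrib (f i) (f 0) P P)
    (hindep : iIndepFun f P) (h0 : ∫ ω, f 0 ω ∂P = 0) : LpOrder P 1 (avg f) := by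
  refine ⟨measurable_avg hm, fun k => ?_⟩
  rcases Nat.eq_zero_or_pos k with rfl | hk
  · exact ⟨0, fun m => by simp⟩
  obtain ⟨C, hC, h⟩ := exists_integral_sum_pow_le hf hm hid hindep h0 k
  have hfi : ∀ i, AllMoments P (f i) := fun i => hf.identDistrib (hm i) (hid i)
  -- The `L^k` norm is bounded by the `L^(2k)` norm, an even moment. The factor `2 ^ k` comes from
  -- `m + 1 ≤ 2 * m` for `m ≥ 1`.
  refine ⟨((2 ^ k * C) ^ ((2 * k : ℕ) : ℝ)⁻¹).toNNReal, fun m => ?_⟩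
  have hmeas : Measurable fun ω => √((m : ℝ) + 1) ^ 1 * avg f m ω :=
    (measurable_avg hm m).const_mul _
  have hall : AllMoments P fun ω => √((m : ℝ) + 1) ^ 1 * avg f m ω := by
    have := (AllMoments.sum hfi m).const_mul (√((m : ℝ) + 1) ^ 1 / m)
    refine this.of_abs_le hmeas fun ω => le_of_eq ?_
    simp only [avg]
    congr 1
    ring
  refine (eLpNorm_le_eLpNorm_of_exponent_le (q := ((2 * k : ℕ) : ENNReal))
    (by exact_mod_cast (by omega : k ≤ 2 * k)) hmeas.aestronglyMeasurable).trans ?_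
  rw [(hall.memLp (2 * k)).eLpNorm_eq_integral_rpow_norm (by simp; omega)
    (ENNReal.natCast_ne_top _)]
  rw [ENNReal.ofReal]
  simp only [ENNReal.coe_le_coe]
  apply Real.toNNReal_mono
  simp only [ENNReal.toReal_natCast, Real.rpow_natCast, Real.norm_eq_abs,
    Even.pow_abs ⟨k, two_mul k⟩]
  gcongr
  · exact integral_nonneg fun ω => by rw [pow_mul]; positivity
  rcases Nat.eq_zero_or_pos m with rfl | hm0
  · simp [avg, hk.ne']
    positivity
  have e : ∀ ω, (√((m : ℝ) + 1) ^ 1 * avg f m ω) ^ (2 * k)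
      = (((m : ℝ) + 1) ^ k / m ^ (2 * k)) * (∑ i ∈ Finset.range m, f i ω) ^ (2 * k) := by
    intro ω
    rw [pow_one, mul_pow, pow_mul √_, Real.sq_sqrt (by positivity), avg, div_pow]
    ring
  simp only [e, integral_const_mul]
  have hm1 : (1 : ℝ) ≤ m := by exact_mod_cast hm0
  calc _ ≤ (((m : ℝ) + 1) ^ k / m ^ (2 * k)) * (C * m ^ k) := by gcongr; exact h m
    _ ≤ ((2 * (m : ℝ)) ^ k / m ^ (2 * k)) * (C * m ^ k) := by gcongr; linarith
    _ = 2 ^ k * C := by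
      have : (m : ℝ) ≠ 0 := by positivity
      rw [mul_pow, two_mul k, pow_add]
      field_simp

/-- Sample means converge to the expectation at the parametric rate. -/
lemma lpOrder_avg_sub_integral [IsProbabilityMeasure P] {f : ℕ → Ω → ℝ}
    (hf : AllMoments P (f 0)) (hm : ∀ i, Measurable (f i))
    (hid : ∀ i, IdentDistrib (f i) (f 0) P P)
    (hindep : iIndepFun f P) : LpOrder P 1 (fun m ω => avg f m ω - ∫ ω, f 0 ω ∂P) := by
  set μ := ∫ ω, f 0 ω ∂P with hμ
  have h1 := lpOrder_avg_of_integral_eq_zero (P := P) (f := fun i ω => f i ω - μ)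
    (hf.sub (allMoments_const μ)) (fun i => (hm i).sub_const μ)
    (fun i => (hid i).comp (measurable_id.sub_const μ))
    (hindep.comp (fun _ x => x - μ) fun _ => measurable_id.sub_const μ)
    (by rw [integral_sub hf.integrable (integrable_const μ)]; simp [hμ])
  -- An empty mean is `0`, so at `m = 0` centering the terms and centering the mean differ by the
  -- expectation; this sequence corrects that single index.
  have h2 : LpOrder P 1 (fun m ω => (if m = 0 then -μ else 0 : ℝ)) := by
    refine ⟨fun m => measurable_const, fun k => ⟨‖μ‖₊, fun m => ?_⟩⟩
    rcases Nat.eq_zero_or_pos m with rfl | hm0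
    · rcases Nat.eq_zero_or_pos k with rfl | hk
      · simp
      · simp only [CharP.cast_eq_zero, zero_add, Real.sqrt_one, pow_one, if_true, one_mul]
        rw [eLpNorm_const _ (by simp; omega) (NeZero.ne P)]
        simp [enorm_eq_nnnorm]
    · simp [hm0.ne']
  convert h1.add h2 using 3 with m ω
  rw [avg_sub]
  rcases Nat.eq_zero_or_pos m with rfl | hm0
  · simp [avg]
  · simp [avg, hm0.ne']

end Averages

/-! ### From an i.i.d. expansion to normality and variance. -/

section Linearization

variable {Ω : Type*} [MeasurableSpace Ω] {P : Measure Ω}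

lemma LpOrder.tendsto_eLpNorm {f : ℕ → Ω → ℝ} (hf : LpOrder P 1 f) (k : ℕ) :
    Tendsto (fun m => eLpNorm (f m) k P) atTop (𝓝 0) := by
  obtain ⟨C, hC⟩ := hf.bound k
  have hle : ∀ m, eLpNorm (f m) k P ≤ ENNReal.ofReal ((√((m : ℝ) + 1))⁻¹ * C) := by
    intro m
    have h0 : 0 < √((m : ℝ) + 1) := zero_lt_one.trans_le (one_le_sqrt_natCast_add_one m)
    have e : f m = (√((m : ℝ) + 1))⁻¹ • (fun ω => √((m : ℝ) + 1) ^ 1 * f m ω) := by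
      ext ω
      simp [h0.ne']
    rw [e, eLpNorm_const_smul, ENNReal.ofReal_mul (by positivity), ENNReal.ofReal_coe_nnreal,
      Real.enorm_of_nonneg (by positivity)]
    gcongr
    exact hC m
  refine tendsto_of_tendsto_of_tendsto_of_le_of_le tendsto_const_nhds ?_ (fun _ => zero_le) hle
  rw [← ENNReal.ofReal_zero]
  refine ENNReal.tendsto_ofReal ?_
  have : Tendsto (fun m : ℕ => (√((m : ℝ) + 1))⁻¹ * C) atTop (𝓝 (0 * C)) := by
    refine Tendsto.mul_const _ (tendsto_inv_atTop_zero.comp ?_)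
    exact Real.tendsto_sqrt_atTop.comp
      (tendsto_atTop_add_const_right _ _ tendsto_natCast_atTop_atTop)
  simpa using this

lemma LpOrder.tendsto_integral {f : ℕ → Ω → ℝ} (hf : LpOrder P 1 f) :
    Tendsto (fun m => ∫ ω, f m ω ∂P) atTop (𝓝 0) := by
  have h := hf.tendsto_eLpNorm 1
  simp only [Nat.cast_one] at h
  have := tendsto_integral_of_L1' (μ := P) (fun _ => (0 : ℝ)) aestronglyMeasurable_const
    (F := f) (l := atTop)
    (Eventually.of_forall fun m => (hf.mono (Nat.zero_le _)).allMoments m |>.integrable)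
    (by simpa [Pi.sub_def] using h)
  simpa using this

lemma LpOrder.tendsto_natCast_mul_integral {f : ℕ → Ω → ℝ} (hf : LpOrder P 3 f) :
    Tendsto (fun m : ℕ => (m : ℝ) * ∫ ω, f m ω ∂P) atTop (𝓝 0) := by
  simpa only [integral_const_mul] using (LpOrder.natCast_mul (a := 1) hf).tendsto_integral

/-- Multiplication by the square root of the sample size lowers the order by one. -/
lemma LpOrder.sqrt_mul {a : ℕ} {f : ℕ → Ω → ℝ} (hf : LpOrder P (a + 1) f) :
    LpOrder P a (fun m ω => √(m : ℝ) * f m ω) := by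
  refine ⟨fun m => (hf.measurable m).const_mul _, fun k => ?_⟩
  obtain ⟨C, hC⟩ := hf.bound k
  refine ⟨C, fun m => (eLpNorm_mono fun ω => ?_).trans (hC m)⟩
  rw [pow_succ, mul_assoc]
  simp only [norm_mul, Real.norm_eq_abs, abs_of_nonneg (Real.sqrt_nonneg _)]
  gcongr
  linarith

/-- An estimator which equals a sample mean of i.i.d. centered random variables up to an error of
order `2` is asymptotically normal, and its variance converges at the corresponding rate. -/
theorem asymptotics_of_linearization [IsProbabilityMeasure P]
    {T : ℕ → Ω → ℝ} {τ : ℝ} {ψ Δ : ℕ → Ω → ℝ}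
    (hψ : AllMoments P (ψ 0)) (hm : ∀ i, Measurable (ψ i))
    (hid : ∀ i, IdentDistrib (ψ i) (ψ 0) P P) (hindep : iIndepFun ψ P)
    (h0 : ∫ ω, ψ 0 ω ∂P = 0) (hΔ : LpOrder P 2 Δ)
    (hT : ∀ m ω, T m ω = τ + avg ψ m ω + Δ m ω) :
    TendstoInDistribution (fun (m : ℕ) ω => √(m : ℝ) * (T m ω - τ)) atTop (id : ℝ → ℝ)
      (fun _ => P) (gaussianReal 0 Var[ψ 0; P].toNNReal) ∧
    Tendsto (fun m : ℕ => (m : ℝ) * Var[T m; P]) atTop (𝓝 Var[ψ 0; P]) := by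
  have havg : LpOrder P 1 (avg ψ) := lpOrder_avg_of_integral_eq_zero hψ hm hid hindep h0
  have hψi : ∀ i, AllMoments P (ψ i) := fun i => hψ.identDistrib (hm i) (hid i)
  have havg' := fun m => (havg.mono (Nat.zero_le _)).allMoments m
  have hΔ' := fun m => (hΔ.mono (Nat.zero_le _)).allMoments m
  have hTm : ∀ m, Measurable (T m) := fun m => by
    have : T m = fun ω => τ + avg ψ m ω + Δ m ω := funext (hT m)
    rw [this]
    exact ((havg.measurable m).const_add τ).add (hΔ.measurable m)
  constructor
  -- Slutsky: the estimator differs from the normalized sum by `√m * Δ`, which has order `1` and so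
  -- vanishes in `L^1`.
  · have hclt := tendstoInDistribution_inv_sqrt_mul_sum_sub (P := P) (X := ψ)
      (Y := (id : ℝ → ℝ)) (P' := gaussianReal 0 Var[ψ 0; P].toNNReal) HasLaw.id
      (by simpa using hψ.memLp 2) hindep hid
    refine tendstoInDistribution_of_tendstoInMeasure_sub _ _ hclt ?_
      fun m => (((hTm m).sub_const τ).const_mul _).aemeasurable
    refine tendstoInMeasure_of_tendsto_eLpNorm (p := ((1 : ℕ) : ENNReal)) (by simp) ?_
      aestronglyMeasurable_zero ?_
    · intro m
      exact ((((hTm m).sub_const τ).const_mul _).sub (((Finset.measurable_fun_sum _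
        fun i _ => hm i).sub_const _).const_mul _)).aestronglyMeasurable
    · convert (LpOrder.sqrt_mul (a := 1) hΔ).tendsto_eLpNorm 1 using 3 with m
      ext ω
      simp only [Pi.sub_apply, Pi.zero_apply, sub_zero, h0, mul_zero, hT, avg]
      rcases Nat.eq_zero_or_pos m with rfl | hm0
      · simp
      · have h1 : √(m : ℝ) ≠ 0 := by positivity
        have h2 : (m : ℝ) = √(m : ℝ) * √(m : ℝ) := (Real.mul_self_sqrt (by positivity)).symm
        rw [show (∑ i ∈ Finset.range m, ψ i ω) / (m : ℝ)
          = (∑ i ∈ Finset.range m, ψ i ω) / (√(m : ℝ) * √(m : ℝ)) by rw [← h2]]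
        field_simp
        ring
  · have l1 : LpOrder P 3 (fun m ω => avg ψ m ω * Δ m ω) := havg.mul hΔ
    have l2 : LpOrder P 4 (fun m ω => Δ m ω * Δ m ω) := hΔ.mul hΔ
    have t1 := l1.tendsto_natCast_mul_integral
    have t2 := (l2.mono (b := 3) (by norm_num)).tendsto_natCast_mul_integral
    have t3 : Tendsto (fun m : ℕ => (m : ℝ) * (∫ ω, Δ m ω ∂P) ^ 2) atTop (𝓝 0) := by
      refine tendsto_of_tendsto_of_tendsto_of_le_of_le tendsto_const_nhds t2
        (fun m => by positivity) fun m => ?_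
      have := variance_eq_sub (by simpa using (hΔ' m).memLp 2)
      have h' := variance_nonneg (Δ m) P
      simp only [Pi.pow_apply, sq (Δ m _)] at this
      show (m : ℝ) * _ ≤ (m : ℝ) * _
      gcongr
      linarith
    have hzero : ∀ m, ∫ ω, avg ψ m ω ∂P = 0 := by
      intro m
      simp only [avg]
      rw [integral_div, integral_finsetSum _ fun i _ => (hψi i).integrable]
      simp [fun i => (hid i).integral_eq, h0]
    have hvaravg : ∀ m : ℕ, 0 < m → (m : ℝ) * ∫ ω, avg ψ m ω ^ 2 ∂P = Var[ψ 0; P] := by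
      intro m hm0
      have h1 := variance_eq_sub (by simpa using (havg' m).memLp 2)
      rw [hzero m] at h1
      simp only [Pi.pow_apply] at h1
      have h2 : Var[avg ψ m; P] = ((m : ℝ)⁻¹) ^ 2 * (m * Var[ψ 0; P]) := by
        have : avg ψ m = fun ω => (m : ℝ)⁻¹ * (∑ i ∈ Finset.range m, ψ i) ω := by
          ext ω; simp [avg, div_eq_inv_mul]
        rw [this, variance_const_mul, IndepFun.variance_sum]
        · simp [fun i => (hid i).variance_eq]
        · exact fun i _ => by simpa using (hψi i).memLp 2
        · exact fun i _ j _ hij => hindep.indepFun hij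
      have h3 : ∫ ω, avg ψ m ω ^ 2 ∂P = ((m : ℝ)⁻¹) ^ 2 * (m * Var[ψ 0; P]) := by
        rw [← h2, h1]; ring
      rw [h3]
      field_simp
    have hvar : ∀ m : ℕ, 0 < m → (m : ℝ) * Var[T m; P] = Var[ψ 0; P]
        + 2 * ((m : ℝ) * ∫ ω, avg ψ m ω * Δ m ω ∂P) + (m : ℝ) * ∫ ω, Δ m ω * Δ m ω ∂P
        - (m : ℝ) * (∫ ω, Δ m ω ∂P) ^ 2 := by
      intro m hm0
      have e : T m = fun ω => τ + (avg ψ m ω + Δ m ω) := by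
        ext ω; rw [hT, add_assoc]
      have hs := (havg' m).add (hΔ' m)
      have hss : MemLp (fun ω => avg ψ m ω + Δ m ω) 2 P := by simpa using hs.memLp 2
      rw [e, variance_const_add hs.measurable.aestronglyMeasurable, variance_eq_sub hss,
        integral_add (havg' m).integrable (hΔ' m).integrable, hzero m, ← hvaravg m hm0]
      have e2 : ∫ ω, ((fun ω => avg ψ m ω + Δ m ω) ^ 2) ω ∂P = ∫ ω, avg ψ m ω ^ 2 ∂P
          + 2 * ∫ ω, avg ψ m ω * Δ m ω ∂P + ∫ ω, Δ m ω * Δ m ω ∂P := by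
        rw [← integral_const_mul, ← integral_add, ← integral_add]
        · congr 1; ext ω; simp; ring
        · exact (((havg' m).pow 2).add (((havg' m).mul (hΔ' m)).const_mul 2)).integrable
        · exact ((hΔ' m).mul (hΔ' m)).integrable
        · exact ((havg' m).pow 2).integrable
        · exact (((havg' m).mul (hΔ' m)).const_mul 2).integrable
      rw [e2]
      ring
    have hlim := (((t1.const_mul 2).const_add Var[ψ 0; P]).add t2).sub t3
    simp only [mul_zero, add_zero, sub_zero] at hlim
    refine hlim.congr' ?_
    filter_upwards [eventually_gt_atTop 0] with m hm0 using (hvar m hm0).symm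

end Linearization

/-! ### The studentized difference of two independent estimators. -/

section Difference

variable {Ω : Type*} [MeasurableSpace Ω] {P : Measure Ω}

/-- The relative error of `VHat / m + WHat / n` is a weighted mean of the relative errors of `VHat`
and `WHat`, so it is small uniformly in the ratio of `m` to `n`; then `1 / √q` is continuous at `q =
1`. -/
lemma tendstoInMeasure_ratio {V W : ℝ≥0} (hV : 0 < V) (hW : 0 < W) {VHat WHat : ℕ → Ω → ℝ}
    (hVlim : TendstoInMeasure P VHat atTop (fun _ => (V : ℝ)))
    (hWlim : TendstoInMeasure P WHat atTop (fun _ => (W : ℝ))) :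
    TendstoInMeasure P (fun (k : ℕ × ℕ) ω => √((V : ℝ) / (k.1 : ℝ) + (W : ℝ) / (k.2 : ℝ)) /
      √(VHat k.1 ω / (k.1 : ℝ) + WHat k.2 ω / (k.2 : ℝ))) (atTop ×ˢ atTop) (fun _ => (1 : ℝ)) := by
  have hV' : (0 : ℝ) < V := hV
  have hW' : (0 : ℝ) < W := hW
  rw [tendstoInMeasure_iff_norm] at hVlim hWlim ⊢
  intro ε hε
  have hcont : ContinuousAt (fun q : ℝ => 1 / √q) 1 := by
    refine ContinuousAt.div continuousAt_const Real.continuous_sqrt.continuousAt (by simp)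
  obtain ⟨δ, hδ, hball⟩ := Metric.continuousAt_iff.1 hcont ε hε
  -- Relative errors below `δ / 2` in both variances keep `|q - 1|` below `δ`.
  have l1 := (hVlim (V * δ / 2) (by positivity)).comp
    (tendsto_fst (f := atTop) (g := (atTop : Filter ℕ)))
  have l2 := (hWlim (W * δ / 2) (by positivity)).comp
    (tendsto_snd (f := (atTop : Filter ℕ)) (g := atTop))
  have l := l1.add l2
  simp only [add_zero] at l
  refine tendsto_of_tendsto_of_tendsto_of_le_of_le' tendsto_const_nhds l
    (Eventually.of_forall fun _ => zero_le) ?_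
  filter_upwards [tendsto_fst.eventually (eventually_gt_atTop 0),
    tendsto_snd.eventually (eventually_gt_atTop 0)] with k hk1 hk2
  have hk1' : (0 : ℝ) < k.1 := by exact_mod_cast hk1
  have hk2' : (0 : ℝ) < k.2 := by exact_mod_cast hk2
  refine (measure_mono fun ω hω => ?_).trans (measure_union_le _ _)
  by_contra hnot
  simp only [Set.mem_union, Set.mem_ofPred_eq, not_or, not_le, Real.norm_eq_abs] at hnot hω
  obtain ⟨n1, n2⟩ := hnot
  set D : ℝ := (V : ℝ) / (k.1 : ℝ) + (W : ℝ) / (k.2 : ℝ) with hD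
  have hD0 : 0 < D := by positivity
  set q : ℝ := (VHat k.1 ω / (k.1 : ℝ) + WHat k.2 ω / (k.2 : ℝ)) / D with hq
  have hq1 : |q - 1| < δ := by
    have e : q - 1 = ((VHat k.1 ω - V) / k.1 + (WHat k.2 ω - W) / k.2) / D := by
      rw [hq, hD]; field_simp; ring
    rw [e, abs_div, abs_of_pos hD0, div_lt_iff₀ hD0]
    calc _ ≤ |VHat k.1 ω - V| / k.1 + |WHat k.2 ω - W| / k.2 := by
          refine (abs_add_le _ _).trans (le_of_eq ?_)
          rw [abs_div, abs_div, abs_of_pos hk1', abs_of_pos hk2']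
      _ < (V * δ / 2) / k.1 + (W * δ / 2) / k.2 := by gcongr
      _ = δ * D / 2 := by rw [hD]; field_simp
      _ ≤ δ * D := by have := mul_pos hδ hD0; linarith
  have hb := hball (x := q) (by rwa [Real.dist_eq])
  have e : √D / √(VHat k.1 ω / (k.1 : ℝ) + WHat k.2 ω / (k.2 : ℝ)) = 1 / √q := by
    have : VHat k.1 ω / (k.1 : ℝ) + WHat k.2 ω / (k.2 : ℝ) = D * q := by
      rw [hq]; field_simp
    rw [this, Real.sqrt_mul hD0.le]
    have : √D ≠ 0 := (Real.sqrt_pos.2 hD0).ne'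
    rw [div_mul_eq_div_div, div_self this]
  rw [e] at hω
  simp only [Real.sqrt_one, div_one, Real.dist_eq] at hb
  exact absurd hb (not_lt.2 hω)

variable [IsProbabilityMeasure P]

lemma MeasureTheory.TendstoInDistribution.comp_tendsto {ι κ E Ω' : Type*} [MeasurableSpace Ω']
    {P' : Measure Ω'} [IsProbabilityMeasure P'] [MeasurableSpace E] [TopologicalSpace E]
    [OpensMeasurableSpace E] {X : ι → Ω → E} {Z : Ω' → E} {l : Filter ι} {l' : Filter κ}
    (h : TendstoInDistribution X l Z (fun _ => P) P') {u : κ → ι} (hu : Tendsto u l' l) :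
    TendstoInDistribution (fun k => X (u k)) l' Z (fun _ => P) P' :=
  ⟨fun k => h.forall_aemeasurable (u k), h.aemeasurable_limit, h.tendsto.comp hu⟩

/-- Characteristic functions of `a k * X k`, where `X k` is asymptotically normal. -/
lemma tendsto_charFun_mul_of_tendstoInDistribution {X : ℕ → Ω → ℝ} {V : ℝ≥0}
    (hX : TendstoInDistribution X atTop (id : ℝ → ℝ) (fun _ => P) (gaussianReal 0 V))
    {a : ℕ → ℝ} {a₀ : ℝ} (ha : Tendsto a atTop (𝓝 a₀)) (t : ℝ) :
    Tendsto (fun k => charFun (P.map (fun ω => a k * X k ω)) t) atTop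
      (𝓝 (Complex.exp (-((a₀ ^ 2 * V * t ^ 2 / 2 : ℝ) : ℂ)))) := by
  have h := hX.continuous_comp_prodMk_of_tendstoInMeasure_const
    (g := fun x : ℝ × ℝ => x.2 * x.1) (by fun_prop) (Y := fun k _ => a k) (c := a₀)
    (by
      refine tendstoInMeasure_of_tendsto_ae (fun _ => aestronglyMeasurable_const) ?_
      exact Eventually.of_forall fun _ => ha)
    (fun _ => aemeasurable_const)
  have h2 := (ProbabilityMeasure.tendsto_iff_tendsto_charFun.1 h.tendsto) t
  have h3 : Tendsto (fun k => charFun (P.map (fun ω => a k * X k ω)) t) atTop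
      (𝓝 (charFun ((gaussianReal 0 V).map (fun ω => a₀ * ω)) t)) := h2
  convert h3 using 2
  rw [gaussianReal_map_const_mul, charFun_gaussianReal]
  congr 1
  push_cast
  simp

/-- With no relation between `m` and `n`, the weights of the two errors need not converge, but they
are bounded. By compactness every sequence has a subsequence along which they do, and by
independence the characteristic functions multiply to that of a Gaussian whose variance is `1` by
the normalization. -/
lemma tendstoInDistribution_studentized_difference {S T : ℕ → Ω → ℝ} {τ : ℝ} {V W : ℝ≥0}
    (hV : 0 < V) (hW : 0 < W)
    (hS : TendstoInDistribution (fun (m : ℕ) ω => √(m : ℝ) * (S m ω - τ)) atTop (id : ℝ → ℝ)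
      (fun _ => P) (gaussianReal 0 V))
    (hT : TendstoInDistribution (fun (n : ℕ) ω => √(n : ℝ) * (T n ω - τ)) atTop (id : ℝ → ℝ)
      (fun _ => P) (gaussianReal 0 W))
    (hSm : ∀ m, Measurable (S m)) (hTm : ∀ n, Measurable (T n))
    (hindep : ∀ m n, IndepFun (S m) (T n) P) :
    TendstoInDistribution (fun (k : ℕ × ℕ) ω => (S k.1 ω - T k.2 ω) /
      √((V : ℝ) / (k.1 : ℝ) + (W : ℝ) / (k.2 : ℝ))) (atTop ×ˢ atTop) (id : ℝ → ℝ)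
      (fun _ => P) (gaussianReal 0 1) := by
  refine ⟨fun k => (((hSm _).sub (hTm _)).div_const _).aemeasurable, aemeasurable_id, ?_⟩
  refine tendsto_of_subseq_tendsto fun ns hns => ?_
  have hV' : (0 : ℝ) < V := hV
  have hW' : (0 : ℝ) < W := hW
  have h1 : Tendsto (fun k => (ns k).1) atTop atTop := tendsto_fst.comp hns
  have h2 : Tendsto (fun k => (ns k).2) atTop atTop := tendsto_snd.comp hns
  set s : ℕ → ℝ := fun k => √((V : ℝ) / ((ns k).1 : ℝ) + (W : ℝ) / ((ns k).2 : ℝ)) with hs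
  -- The coefficients with `(S - T) / s = p.1 * √m (S - τ) + p.2 * √n (T - τ)` once `m` and `n` are
  -- positive. They lie on the ellipse `V x² + W y² = 1`.
  set p : ℕ → ℝ × ℝ := fun k => ((√((ns k).1 : ℝ) * s k)⁻¹, -(√((ns k).2 : ℝ) * s k)⁻¹) with hp
  have hpeq : ∀ᶠ k in atTop, (V : ℝ) * (p k).1 ^ 2 + W * (p k).2 ^ 2 = 1 := by
    filter_upwards [h1.eventually_gt_atTop 0, h2.eventually_gt_atTop 0] with k hk1 hk2
    have hk1' : (0 : ℝ) < (ns k).1 := by exact_mod_cast hk1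
    have hk2' : (0 : ℝ) < (ns k).2 := by exact_mod_cast hk2
    simp only [hp, neg_sq, inv_pow, mul_pow, hs]
    rw [Real.sq_sqrt hk1'.le, Real.sq_sqrt hk2'.le, Real.sq_sqrt (by positivity)]
    field_simp
  have hpmem : ∀ᶠ k in atTop, p k ∈ Set.Icc (-√(1 / (V : ℝ))) (√(1 / (V : ℝ)))
      ×ˢ Set.Icc (-√(1 / (W : ℝ))) (√(1 / (W : ℝ))) := by
    filter_upwards [hpeq] with k hk
    refine ⟨abs_le.1 (Real.abs_le_sqrt ?_), abs_le.1 (Real.abs_le_sqrt ?_)⟩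
    · rw [le_div_iff₀ hV']
      nlinarith [mul_nonneg hW'.le (sq_nonneg (p k).2)]
    · rw [le_div_iff₀ hW']
      nlinarith [mul_nonneg hV'.le (sq_nonneg (p k).1)]
  obtain ⟨p₀, -, φ, hφ, hlim⟩ := (isCompact_Icc.prod isCompact_Icc).tendsto_subseq'
    hpmem.frequently
  have hlim1 : Tendsto (fun k => (p (φ k)).1) atTop (𝓝 p₀.1) :=
    (continuous_fst.tendsto _).comp hlim
  have hlim2 : Tendsto (fun k => (p (φ k)).2) atTop (𝓝 p₀.2) :=
    (continuous_snd.tendsto _).comp hlim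
  have heq : (V : ℝ) * p₀.1 ^ 2 + W * p₀.2 ^ 2 = 1 := by
    refine tendsto_nhds_unique (((hlim1.pow 2).const_mul _).add ((hlim2.pow 2).const_mul _)) ?_
    -- The ellipse is closed, so the limit weights again give total variance `1`, whichever
    -- subsequence was chosen; a coordinate of `p₀` may be zero.
    exact tendsto_const_nhds.congr' ((hφ.tendsto_atTop.eventually hpeq).mono fun k hk => hk.symm)
  refine ⟨φ, ?_⟩
  refine ProbabilityMeasure.tendsto_iff_tendsto_charFun.2 fun t => ?_
  change Tendsto (fun k => charFun (P.map (fun ω => (S (ns (φ k)).1 ω - T (ns (φ k)).2 ω) /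
    s (φ k))) t) atTop (𝓝 (charFun ((gaussianReal 0 1).map id) t))
  have c1 := tendsto_charFun_mul_of_tendstoInDistribution
    (hS.comp_tendsto (h1.comp hφ.tendsto_atTop)) hlim1 t
  have c2 := tendsto_charFun_mul_of_tendstoInDistribution
    (hT.comp_tendsto (h2.comp hφ.tendsto_atTop)) hlim2 t
  have c := c1.mul c2
  have hl : Complex.exp (-((p₀.1 ^ 2 * V * t ^ 2 / 2 : ℝ) : ℂ))
      * Complex.exp (-((p₀.2 ^ 2 * W * t ^ 2 / 2 : ℝ) : ℂ))
      = charFun ((gaussianReal 0 1).map id) t := by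
    rw [Measure.map_id, charFun_gaussianReal, ← Complex.exp_add]
    congr 1
    have : p₀.1 ^ 2 * V * t ^ 2 / 2 + p₀.2 ^ 2 * W * t ^ 2 / 2 = t ^ 2 / 2 := by
      linear_combination t ^ 2 / 2 * heq
    rw [← neg_add, ← Complex.ofReal_add, this]
    simp
  rw [hl] at c
  refine c.congr' ?_
  filter_upwards [(h1.comp hφ.tendsto_atTop).eventually_gt_atTop 0,
    (h2.comp hφ.tendsto_atTop).eventually_gt_atTop 0] with k hk1 hk2
  have hk1' : (0 : ℝ) < (ns (φ k)).1 := by exact_mod_cast hk1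
  have hk2' : (0 : ℝ) < (ns (φ k)).2 := by exact_mod_cast hk2
  have hs0 : 0 < s (φ k) := Real.sqrt_pos.2 (by positivity)
  simp only [Function.comp_apply]
  have hind : IndepFun (fun ω => (p (φ k)).1 * (√((ns (φ k)).1 : ℝ) * (S (ns (φ k)).1 ω - τ)))
      (fun ω => (p (φ k)).2 * (√((ns (φ k)).2 : ℝ) * (T (ns (φ k)).2 ω - τ))) P :=
    (hindep _ _).comp
      (φ := fun x => (p (φ k)).1 * (√((ns (φ k)).1 : ℝ) * (x - τ)))
      (ψ := fun x => (p (φ k)).2 * (√((ns (φ k)).2 : ℝ) * (x - τ))) (by fun_prop) (by fun_prop)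
  have hmul := hind.charFun_map_add_eq_mul
    ((((hSm _).sub_const τ).const_mul _).const_mul _).aemeasurable
    ((((hTm _).sub_const τ).const_mul _).const_mul _).aemeasurable
  have := congrFun hmul t
  rw [Pi.mul_apply] at this
  rw [← this]
  congr 2
  ext ω
  simp only [Pi.add_apply, hp]
  have e1 : √((ns (φ k)).1 : ℝ) ≠ 0 := by positivity
  have e2 : √((ns (φ k)).2 : ℝ) ≠ 0 := by positivity
  have e3 := hs0.ne'
  field_simp
  ring

lemma tendstoInDistribution_estimated_studentized_difference {S T : ℕ → Ω → ℝ} {V W : ℝ≥0}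
    (hV : 0 < V) (hW : 0 < W)
    (h : TendstoInDistribution (fun (k : ℕ × ℕ) ω => (S k.1 ω - T k.2 ω) /
      √((V : ℝ) / (k.1 : ℝ) + (W : ℝ) / (k.2 : ℝ))) (atTop ×ˢ atTop) (id : ℝ → ℝ)
      (fun _ => P) (gaussianReal 0 1))
    (hSm : ∀ m, Measurable (S m)) (hTm : ∀ n, Measurable (T n)) {VHat WHat : ℕ → Ω → ℝ}
    (hVm : ∀ m, AEMeasurable (VHat m) P) (hWm : ∀ m, AEMeasurable (WHat m) P)
    (hVlim : TendstoInMeasure P VHat atTop (fun _ => (V : ℝ)))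
    (hWlim : TendstoInMeasure P WHat atTop (fun _ => (W : ℝ))) :
    TendstoInDistribution (fun (k : ℕ × ℕ) ω => (S k.1 ω - T k.2 ω) /
      √(VHat k.1 ω / (k.1 : ℝ) + WHat k.2 ω / (k.2 : ℝ))) (atTop ×ˢ atTop) (id : ℝ → ℝ)
      (fun _ => P) (gaussianReal 0 1) := by
  have hVW : ∀ k : ℕ × ℕ, AEMeasurable (fun ω =>
      √(VHat k.1 ω / (k.1 : ℝ) + WHat k.2 ω / (k.2 : ℝ))) P := fun k =>
    (((hVm _).div_const _).add ((hWm _).div_const _)).sqrt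
  -- Slutsky: multiply by the ratio of true to estimated standard error, which tends to `1` in
  -- probability.
  have hlim := h.continuous_comp_prodMk_of_tendstoInMeasure_const
    (g := fun x : ℝ × ℝ => x.1 * x.2) (by fun_prop) (tendstoInMeasure_ratio hV hW hVlim hWlim)
    (fun k => (hVW k).const_div _)
  simp only [id, mul_one] at hlim
  refine ⟨fun k => ((hSm _).sub (hTm _)).aemeasurable.div (hVW k), aemeasurable_id, ?_⟩
  refine hlim.tendsto.congr' ?_
  filter_upwards [tendsto_fst.eventually (eventually_gt_atTop 0)] with k hk1
  have hk1' : (0 : ℝ) < k.1 := by exact_mod_cast hk1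
  have hV' : (0 : ℝ) < V := hV
  have hD : √((V : ℝ) / (k.1 : ℝ) + (W : ℝ) / (k.2 : ℝ)) ≠ 0 := (Real.sqrt_pos.2 (by positivity)).ne'
  congr 2
  ext ω
  field_simp

end Difference

/-! ### Concavity and Taylor bounds for the logistic function. -/

section Sigmoid

lemma Real.hasDerivAt_log_sigmoid (t : ℝ) :
    HasDerivAt (fun t => Real.log (Real.sigmoid t)) (1 - Real.sigmoid t) t := by
  convert (Real.hasDerivAt_sigmoid t).log (Real.sigmoid_pos t).ne' using 1
  rw [mul_div_assoc, mul_comm, div_mul_cancel₀ _ (Real.sigmoid_pos t).ne']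

lemma Real.inv_sigmoid (t : ℝ) : (Real.sigmoid t)⁻¹ = 1 + Real.exp (-t) := by
  rw [Real.sigmoid_def, inv_inv]

/-- With `E = exp (-t)` and `r = exp (-(t + u))` everything reduces to `r * (1 + u) ≤ E`, that is `1
+ u ≤ exp u`. The factor `u / (1 + u)` saturates because the sigmoid is bounded. -/
lemma Real.sigmoid_add_sub_sigmoid_ge {t u : ℝ} (hu : 0 ≤ u) :
    Real.sigmoid t * (1 - Real.sigmoid t) * (u / (1 + u))
      ≤ Real.sigmoid (t + u) - Real.sigmoid t := by
  have hr := Real.exp_pos (-(t + u))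
  have hE := Real.exp_pos (-t)
  have hrE : Real.exp (-(t + u)) * (1 + u) ≤ Real.exp (-t) := by
    have : Real.exp (-t) = Real.exp (-(t + u)) * Real.exp u := by
      rw [← Real.exp_add]; congr 1; ring
    rw [this]
    gcongr
    linarith [Real.add_one_le_exp u]
  rw [Real.sigmoid_def, Real.sigmoid_def]
  set r := Real.exp (-(t + u))
  set E := Real.exp (-t)
  have h1 : (1 + E)⁻¹ * (1 - (1 + E)⁻¹) * (u / (1 + u)) = E * u / ((1 + E) ^ 2 * (1 + u)) := by
    field_simp; ring
  have h2 : (1 + r)⁻¹ - (1 + E)⁻¹ = (E - r) / ((1 + r) * (1 + E)) := by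
    field_simp; ring
  rw [h1, h2, div_le_div_iff₀ (by positivity) (by positivity)]
  have h3 : E * u ≤ (E - r) * (1 + u) := by nlinarith
  have h4 : r ≤ E := by nlinarith
  calc E * u * ((1 + r) * (1 + E)) ≤ ((E - r) * (1 + u)) * ((1 + E) * (1 + E)) := by
        gcongr
    _ = _ := by ring

/-- Both sides agree at `u = 0`, and their difference is monotone: its derivative is handled by
`Real.sigmoid_add_sub_sigmoid_ge`, since `v ^ 2 / (2 * (1 + v))` has derivative at most `v / (1 +
v)`. -/
lemma Real.log_sigmoid_add_le_of_nonneg {t u : ℝ} (hu : 0 ≤ u) :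
    Real.log (Real.sigmoid (t + u)) ≤ Real.log (Real.sigmoid t) + (1 - Real.sigmoid t) * u
      - Real.sigmoid t * (1 - Real.sigmoid t) * (u ^ 2 / (2 * (1 + u))) := by
  set s := Real.sigmoid t with hs
  have hd : ∀ v : ℝ, 0 ≤ v → HasDerivAt (fun v => Real.log s + (1 - s) * v
      - s * (1 - s) * (v ^ 2 / (2 * (1 + v))) - Real.log (Real.sigmoid (t + v)))
      ((1 - s) - s * (1 - s) * ((2 * v * (2 * (1 + v)) - v ^ 2 * 2) / (2 * (1 + v)) ^ 2)
        - (1 - Real.sigmoid (t + v))) v := by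
    intro v hv
    refine HasDerivAt.sub (HasDerivAt.sub ?_ (HasDerivAt.const_mul _ ?_)) ?_
    · simpa using ((hasDerivAt_id v).const_mul (1 - s)).const_add (Real.log s)
    · have e1 : HasDerivAt (fun v : ℝ => v ^ 2) (2 * v) v := by simpa using hasDerivAt_pow 2 v
      have e2 : HasDerivAt (fun v : ℝ => 2 * (1 + v)) 2 v := by
        simpa using ((hasDerivAt_id v).const_add 1).const_mul 2
      exact e1.div e2 (by positivity)
    · simpa using (Real.hasDerivAt_log_sigmoid (t + v)).comp_const_add t v
  have hmono : MonotoneOn (fun v => Real.log s + (1 - s) * v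
      - s * (1 - s) * (v ^ 2 / (2 * (1 + v))) - Real.log (Real.sigmoid (t + v))) (Set.Ici 0) := by
    refine monotoneOn_of_deriv_nonneg (convex_Ici 0)
      (fun v hv => (hd v hv).continuousAt.continuousWithinAt) ?_ ?_
    · intro v hv
      rw [interior_Ici] at hv
      exact (hd v (le_of_lt hv)).differentiableAt.differentiableWithinAt
    · intro v hv
      rw [interior_Ici] at hv
      have hv0 : 0 < v := hv
      rw [(hd v hv0.le).deriv]
      have h1 := Real.sigmoid_add_sub_sigmoid_ge (t := t) hv0.le
      have h2 : (2 * v * (2 * (1 + v)) - v ^ 2 * 2) / (2 * (1 + v)) ^ 2 ≤ v / (1 + v) := by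
        rw [div_le_div_iff₀ (by positivity) (by positivity)]
        nlinarith [mul_pos hv0 hv0, mul_pos (mul_pos hv0 hv0) hv0]
      have h3 : 0 ≤ s * (1 - s) := mul_nonneg (Real.sigmoid_nonneg t)
        (by linarith [Real.sigmoid_le_one t])
      have h4 := mul_le_mul_of_nonneg_left h2 h3
      linarith
  have := hmono (Set.mem_Ici.2 le_rfl) (Set.mem_Ici.2 hu) hu
  simp only [mul_zero, add_zero, ne_eq, OfNat.ofNat_ne_zero, not_false_eq_true, zero_pow,
    zero_div, sub_zero] at this
  rw [← hs, sub_self] at this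
  linarith

lemma Real.log_sigmoid_eq (t : ℝ) :
    Real.log (Real.sigmoid t) = t + Real.log (Real.sigmoid (-t)) := by
  rw [← Real.sigmoid_mul_rexp_neg, Real.log_mul (Real.sigmoid_pos t).ne' (Real.exp_pos _).ne',
    Real.log_exp]
  ring

/-- Quadratic upper bound for the strictly concave function `log ∘ sigmoid`. -/
lemma Real.log_sigmoid_add_le (t u : ℝ) :
    Real.log (Real.sigmoid (t + u)) ≤ Real.log (Real.sigmoid t) + (1 - Real.sigmoid t) * u
      - Real.sigmoid t * (1 - Real.sigmoid t) * (u ^ 2 / (2 * (1 + |u|))) := by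
  rcases le_total 0 u with hu | hu
  · rw [abs_of_nonneg hu]
    exact Real.log_sigmoid_add_le_of_nonneg hu
  -- Negative increments follow by the reflection `t ↦ -t`, under which `log ∘ sigmoid` changes only
  -- by a linear function.
  · have h := Real.log_sigmoid_add_le_of_nonneg (t := -t) (u := -u) (by linarith)
    rw [abs_of_nonpos hu, Real.log_sigmoid_eq (t + u), Real.log_sigmoid_eq t]
    rw [Real.sigmoid_neg] at h ⊢
    rw [← neg_add, neg_sq, Real.sigmoid_neg (t + u)] at h
    rw [Real.sigmoid_neg t]
    linarith

lemma Real.abs_sigmoid_add_sub_le (t u : ℝ) : |Real.sigmoid (t + u) - Real.sigmoid t| ≤ |u| := by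
  have := Convex.norm_image_sub_le_of_norm_deriv_le (f := Real.sigmoid) (C := 1) (s := Set.univ)
    (x := t) (y := t + u) (fun x _ => differentiable_sigmoid x) (fun x _ => by
      rw [Real.deriv_sigmoid, Real.norm_eq_abs, abs_mul, abs_of_pos (Real.sigmoid_pos x),
        abs_of_pos (by linarith [Real.sigmoid_lt_one x])]
      nlinarith [Real.sigmoid_pos x, Real.sigmoid_lt_one x]) convex_univ trivial trivial
  simpa using this

lemma Real.abs_sigmoid_add_sub_sub_le (t u : ℝ) :
    |Real.sigmoid (t + u) - Real.sigmoid t - Real.sigmoid t * (1 - Real.sigmoid t) * u|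
      ≤ u ^ 2 := by
  set s := Real.sigmoid t with hs
  have hd : ∀ v : ℝ, HasDerivAt (fun v => Real.sigmoid (t + v) - s * (1 - s) * v)
      (Real.sigmoid (t + v) * (1 - Real.sigmoid (t + v)) - s * (1 - s)) v := by
    intro v
    refine HasDerivAt.sub ?_ ?_
    · simpa using (Real.hasDerivAt_sigmoid (t + v)).comp_const_add t v
    · simpa using (hasDerivAt_id v).const_mul (s * (1 - s))
  have := Convex.norm_image_sub_le_of_norm_hasDerivWithin_le (C := |u|) (s := Set.uIcc 0 u)
    (x := 0) (y := u) (fun v _ => (hd v).hasDerivWithinAt) (fun v hv => by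
      have h1 := Real.abs_sigmoid_add_sub_le t v
      have h2 : |v| ≤ |u| := by
        rcases Set.mem_uIcc.1 hv with h | h
        · rw [abs_of_nonneg h.1, abs_of_nonneg (h.1.trans h.2)]; exact h.2
        · rw [abs_of_nonpos h.2, abs_of_nonpos (h.1.trans h.2)]; linarith [h.1]
      -- The derivative of the sigmoid is `1`-Lipschitz: in this factorization the first factor is
      -- at most `|v|` and the second lies in `[-1, 1]`.
      have e : Real.sigmoid (t + v) * (1 - Real.sigmoid (t + v)) - s * (1 - s)
          = (Real.sigmoid (t + v) - s) * (1 - Real.sigmoid (t + v) - s) := by ring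
      have h3 : |1 - Real.sigmoid (t + v) - s| ≤ 1 := by
        rw [abs_le]
        constructor <;> linarith [Real.sigmoid_pos t, Real.sigmoid_lt_one t,
          Real.sigmoid_pos (t + v), Real.sigmoid_lt_one (t + v)]
      rw [e, Real.norm_eq_abs, abs_mul]
      calc _ ≤ |v| * 1 := by gcongr
        _ ≤ |u| := by simpa using h2)
    (convex_uIcc 0 u) Set.left_mem_uIcc Set.right_mem_uIcc
  simp only [add_zero, mul_zero, sub_zero, Real.norm_eq_abs, ← hs] at this
  rw [← sq, sq_abs] at this
  convert this using 2
  ring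

end Sigmoid

/-! ### Deterministic analysis of the logistic likelihood. -/

section LogisticRegression

variable {m : ℕ} {a x : Fin m → ℝ}

/-- The derivative of the logistic log-likelihood in the intercept and in the slope. -/
noncomputable def logisticScore (a x : Fin m → ℝ) (γ : ℝ × ℝ) : ℝ × ℝ :=
  (∑ i, (a i - Real.sigmoid (γ.1 + γ.2 * x i)),
    ∑ i, (a i - Real.sigmoid (γ.1 + γ.2 * x i)) * x i)

lemma abs_add_mul_le (d : ℝ × ℝ) (y : ℝ) : |d.1 + d.2 * y| ≤ ‖d‖ * (1 + |y|) := by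
  have h1 : |d.1| ≤ ‖d‖ := norm_fst_le d
  have h2 : |d.2| ≤ ‖d‖ := norm_snd_le d
  calc |d.1 + d.2 * y| ≤ |d.1| + |d.2| * |y| := by
        rw [← abs_mul]; exact abs_add_le _ _
    _ ≤ ‖d‖ + ‖d‖ * |y| := by gcongr
    _ = _ := by ring

lemma logisticLogLik_term_le {a : ℝ} (ha : a = 0 ∨ a = 1) (t u : ℝ) :
    a * Real.log (Real.sigmoid (t + u)) + (1 - a) * Real.log (1 - Real.sigmoid (t + u))
      ≤ a * Real.log (Real.sigmoid t) + (1 - a) * Real.log (1 - Real.sigmoid t)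
        + (a - Real.sigmoid t) * u
        - Real.sigmoid t * (1 - Real.sigmoid t) * (u ^ 2 / (2 * (1 + |u|))) := by
  rcases ha with rfl | rfl
  · have := Real.log_sigmoid_add_le (-t) (-u)
    rw [← neg_add, Real.sigmoid_neg, Real.sigmoid_neg, neg_sq, abs_neg] at this
    linarith
  · have := Real.log_sigmoid_add_le t u
    linarith

/-- Each summand loses curvature through `1 + |d.1 + d.2 * x i|`, which is at most `(1 + ‖d‖) * (1 +
|x i|)`. This separates the data from the displacement and explains the weight `1 / (2 * (1 + |x
i|))` in `hK`. -/
lemma logisticLogLik_add_le (ha : ∀ i, a i = 0 ∨ a i = 1) (γ : ℝ × ℝ) {κ : ℝ}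
    (hK : ∀ d : ℝ × ℝ, κ * ‖d‖ ^ 2 ≤ ∑ i, Real.sigmoid (γ.1 + γ.2 * x i)
      * (1 - Real.sigmoid (γ.1 + γ.2 * x i)) / (2 * (1 + |x i|)) * (d.1 + d.2 * x i) ^ 2)
    (d : ℝ × ℝ) :
    logisticLogLik a x (γ + d) ≤ logisticLogLik a x γ
      + (|(logisticScore a x γ).1| + |(logisticScore a x γ).2|) * ‖d‖
      - κ * ‖d‖ ^ 2 / (1 + ‖d‖) := by
  have h0 : 0 ≤ ‖d‖ := norm_nonneg d
  have hS : (logisticScore a x γ).1 * d.1 + (logisticScore a x γ).2 * d.2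
      ≤ (|(logisticScore a x γ).1| + |(logisticScore a x γ).2|) * ‖d‖ := by
    have h1 : |d.1| ≤ ‖d‖ := norm_fst_le d
    have h2 : |d.2| ≤ ‖d‖ := norm_snd_le d
    calc _ ≤ |(logisticScore a x γ).1 * d.1| + |(logisticScore a x γ).2 * d.2| :=
          add_le_add (le_abs_self _) (le_abs_self _)
      _ ≤ |(logisticScore a x γ).1| * ‖d‖ + |(logisticScore a x γ).2| * ‖d‖ := by
          rw [abs_mul, abs_mul]; gcongr
      _ = _ := by ring
  have hterm : ∀ i, a i * Real.log (Real.sigmoid ((γ + d).1 + (γ + d).2 * x i))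
        + (1 - a i) * Real.log (1 - Real.sigmoid ((γ + d).1 + (γ + d).2 * x i))
      ≤ (a i * Real.log (Real.sigmoid (γ.1 + γ.2 * x i))
        + (1 - a i) * Real.log (1 - Real.sigmoid (γ.1 + γ.2 * x i)))
        + ((a i - Real.sigmoid (γ.1 + γ.2 * x i)) * d.1
          + (a i - Real.sigmoid (γ.1 + γ.2 * x i)) * x i * d.2)
        - (1 + ‖d‖)⁻¹ * (Real.sigmoid (γ.1 + γ.2 * x i) * (1 - Real.sigmoid (γ.1 + γ.2 * x i))
            / (2 * (1 + |x i|)) * (d.1 + d.2 * x i) ^ 2) := by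
    intro i
    have h := logisticLogLik_term_le (ha i) (γ.1 + γ.2 * x i) (d.1 + d.2 * x i)
    have e : (γ + d).1 + (γ + d).2 * x i = γ.1 + γ.2 * x i + (d.1 + d.2 * x i) := by
      simp only [Prod.fst_add, Prod.snd_add]; ring
    rw [e]
    have hu : 1 + |d.1 + d.2 * x i| ≤ (1 + ‖d‖) * (1 + |x i|) := by
      have := abs_add_mul_le d (x i)
      nlinarith [abs_nonneg (x i)]
    have hs : 0 ≤ Real.sigmoid (γ.1 + γ.2 * x i) * (1 - Real.sigmoid (γ.1 + γ.2 * x i)) :=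
      mul_nonneg (Real.sigmoid_nonneg _) (by linarith [Real.sigmoid_le_one (γ.1 + γ.2 * x i)])
    have hq : (1 + ‖d‖)⁻¹ * (Real.sigmoid (γ.1 + γ.2 * x i) * (1 - Real.sigmoid (γ.1 + γ.2 * x i))
            / (2 * (1 + |x i|)) * (d.1 + d.2 * x i) ^ 2)
        ≤ Real.sigmoid (γ.1 + γ.2 * x i) * (1 - Real.sigmoid (γ.1 + γ.2 * x i))
          * ((d.1 + d.2 * x i) ^ 2 / (2 * (1 + |d.1 + d.2 * x i|))) := by
      calc _ = Real.sigmoid (γ.1 + γ.2 * x i) * (1 - Real.sigmoid (γ.1 + γ.2 * x i))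
          * ((d.1 + d.2 * x i) ^ 2 / (2 * ((1 + ‖d‖) * (1 + |x i|)))) := by
            field_simp
        _ ≤ _ := by gcongr
    linarith
  have hsum : logisticLogLik a x (γ + d) ≤ logisticLogLik a x γ
      + ((logisticScore a x γ).1 * d.1 + (logisticScore a x γ).2 * d.2)
      - (1 + ‖d‖)⁻¹ * ∑ i, (Real.sigmoid (γ.1 + γ.2 * x i) * (1 - Real.sigmoid (γ.1 + γ.2 * x i))
        / (2 * (1 + |x i|)) * (d.1 + d.2 * x i) ^ 2) := by
    simp only [logisticLogLik, logisticScore, Finset.sum_mul, Finset.mul_sum,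
      ← Finset.sum_add_distrib, ← Finset.sum_sub_distrib]
    exact Finset.sum_le_sum fun i _ => hterm i
  have hK' : κ * ‖d‖ ^ 2 / (1 + ‖d‖) ≤ (1 + ‖d‖)⁻¹ * ∑ i, (Real.sigmoid (γ.1 + γ.2 * x i)
      * (1 - Real.sigmoid (γ.1 + γ.2 * x i)) / (2 * (1 + |x i|)) * (d.1 + d.2 * x i) ^ 2) := by
    rw [div_eq_inv_mul]
    exact mul_le_mul_of_nonneg_left (hK d) (by positivity)
  linarith

lemma continuous_logisticLogLik (a x : Fin m → ℝ) : Continuous (logisticLogLik a x) := by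
  unfold logisticLogLik
  refine continuous_finsetSum _ fun i _ => ?_
  have h1 : Continuous fun γ : ℝ × ℝ => Real.sigmoid (γ.1 + γ.2 * x i) :=
    continuous_sigmoid.comp (by fun_prop)
  refine (continuous_const.mul (h1.log fun γ => (Real.sigmoid_pos _).ne')).add
    (continuous_const.mul (Continuous.log (f := fun γ : ℝ × ℝ => 1 - Real.sigmoid (γ.1 + γ.2 * x i))
      (continuous_const.sub h1) fun γ => ?_))
  linarith [Real.sigmoid_lt_one (γ.1 + γ.2 * x i)]

lemma logisticScore_eq_zero_of_isMaxOn {γ : ℝ × ℝ}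
    (h : IsMaxOn (logisticLogLik a x) Set.univ γ) : logisticScore a x γ = 0 := by
  have key : ∀ d : ℝ × ℝ, ∑ i, (a i - Real.sigmoid (γ.1 + γ.2 * x i)) * (d.1 + d.2 * x i) = 0 := by
    intro d
    have hmax : IsLocalMax (fun s : ℝ => logisticLogLik a x (γ + s • d)) 0 :=
      Eventually.of_forall fun s => by simpa using h (Set.mem_univ (γ + s • d))
    refine hmax.hasDerivAt_eq_zero ?_
    simp only [logisticLogLik]
    refine HasDerivAt.fun_sum fun i _ => ?_
    have hlin : HasDerivAt (fun s : ℝ => (γ + s • d).1 + (γ + s • d).2 * x i)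
        (d.1 + d.2 * x i) 0 := by
      have e : (fun s : ℝ => (γ + s • d).1 + (γ + s • d).2 * x i)
          = fun s : ℝ => (γ.1 + γ.2 * x i) + s * (d.1 + d.2 * x i) := by
        ext s; simp; ring
      rw [e]
      simpa using ((hasDerivAt_id (0 : ℝ)).mul_const (d.1 + d.2 * x i)).const_add
        (γ.1 + γ.2 * x i)
    have hv : (γ + (0 : ℝ) • d).1 + (γ + (0 : ℝ) • d).2 * x i = γ.1 + γ.2 * x i := by simp
    have h1 := HasDerivAt.comp (0 : ℝ) (Real.hasDerivAt_log_sigmoid _) hlin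
    have h2 := HasDerivAt.comp (0 : ℝ) (Real.hasDerivAt_log_sigmoid _) hlin.neg
    rw [hv] at h1
    simp only [Pi.neg_apply] at h2
    rw [hv, Real.sigmoid_neg] at h2
    have h3 := (h1.const_mul (a i)).add (h2.const_mul (1 - a i))
    convert h3 using 1
    · ext s
      simp only [Pi.add_apply, Function.comp_apply, Pi.neg_apply, Real.sigmoid_neg]
    · ring
  refine Prod.ext ?_ ?_
  · simpa [logisticScore] using key (1, 0)
  · simpa [logisticScore] using key (0, 1)

/-- If the log-likelihood is curved enough at `γ` compared to the size of its score, then a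
maximum likelihood estimate exists, and all of them are close to `γ`. -/
theorem logistic_mle_near (ha : ∀ i, a i = 0 ∨ a i = 1) (γ : ℝ × ℝ) {κ : ℝ}
    (hK : ∀ d : ℝ × ℝ, κ * ‖d‖ ^ 2 ≤ ∑ i, Real.sigmoid (γ.1 + γ.2 * x i)
      * (1 - Real.sigmoid (γ.1 + γ.2 * x i)) / (2 * (1 + |x i|)) * (d.1 + d.2 * x i) ^ 2)
    (hS : |(logisticScore a x γ).1| + |(logisticScore a x γ).2| < κ / 2) :
    (∃ γ', IsMaxOn (logisticLogLik a x) Set.univ γ') ∧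
    ∀ γ', IsMaxOn (logisticLogLik a x) Set.univ γ' → ‖γ' - γ‖ ≤ 1 ∧
      κ * ‖γ' - γ‖ ≤ 2 * (|(logisticScore a x γ).1| + |(logisticScore a x γ).2|) := by
  set S := |(logisticScore a x γ).1| + |(logisticScore a x γ).2| with hSdef
  have hS0 : 0 ≤ S := by positivity
  have hκ : 0 < κ := by linarith
  have hle := logisticLogLik_add_le ha γ hK
  -- Beyond distance `1` the curvature term is at least `κ / 2 * ‖γ' - γ‖`, which beats the linear
  -- term. Hence a maximizer over the closed unit ball is global.
  have hfar : ∀ γ' : ℝ × ℝ, 1 < ‖γ' - γ‖ → logisticLogLik a x γ' < logisticLogLik a x γ := by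
    intro γ' hγ'
    have h := hle (γ' - γ)
    rw [add_sub_cancel] at h
    have h2 : κ / 2 * ‖γ' - γ‖ ≤ κ * ‖γ' - γ‖ ^ 2 / (1 + ‖γ' - γ‖) := by
      rw [le_div_iff₀ (by positivity)]
      nlinarith [mul_pos hκ (zero_lt_one.trans hγ')]
    have h3 : S * ‖γ' - γ‖ < κ / 2 * ‖γ' - γ‖ := by gcongr
    linarith
  constructor
  · obtain ⟨γ', -, hmax⟩ := (isCompact_closedBall γ 1).exists_isMaxOn
      ⟨γ, Metric.mem_closedBall_self zero_le_one⟩ (continuous_logisticLogLik a x).continuousOn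
    refine ⟨γ', fun γ'' _ => ?_⟩
    by_cases h : γ'' ∈ Metric.closedBall γ 1
    · exact hmax h
    · rw [Metric.mem_closedBall, dist_eq_norm, not_le] at h
      exact (hfar γ'' h).le.trans (hmax (Metric.mem_closedBall_self zero_le_one))
  · intro γ' hmax
    have h1 : ‖γ' - γ‖ ≤ 1 := by
      by_contra h
      exact absurd (hmax (Set.mem_univ γ)) (not_le.2 (hfar γ' (not_le.1 h)))
    refine ⟨h1, ?_⟩
    rcases (norm_nonneg (γ' - γ)).eq_or_lt with h0 | h0
    · rw [← h0]; linarith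
    have h := hle (γ' - γ)
    rw [add_sub_cancel] at h
    have hm : logisticLogLik a x γ ≤ logisticLogLik a x γ' := hmax (Set.mem_univ γ)
    have h2 : κ * ‖γ' - γ‖ ^ 2 / (1 + ‖γ' - γ‖) ≤ S * ‖γ' - γ‖ := by linarith
    rw [div_le_iff₀ (by positivity)] at h2
    -- Cancelling one factor of the distance leaves `S * (1 + ‖γ' - γ‖)`, at most `2 * S` inside the
    -- unit ball.
    have h3 : κ * ‖γ' - γ‖ ≤ S * (1 + ‖γ' - γ‖) := by
      have : (κ * ‖γ' - γ‖) * ‖γ' - γ‖ ≤ (S * (1 + ‖γ' - γ‖)) * ‖γ' - γ‖ := by nlinarith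
      exact le_of_mul_le_mul_right this h0
    nlinarith

end LogisticRegression

/-! ### Reduction of the ratio estimator to its numerators. -/

section Hajek

/-- A weighted mean cannot exceed the largest value in modulus, and a vanishing total weight gives
`0`. The bound is crude but indifferent to the weights, so it survives an arbitrary fitted
propensity. -/
lemma abs_sum_mul_div_sum_le {m : ℕ} {w : Fin m → ℝ} (hw : ∀ i, 0 ≤ w i) (y : Fin m → ℝ) :
    |(∑ i, w i * y i) / ∑ i, w i| ≤ ∑ i, |y i| := by
  have hW : 0 ≤ ∑ i, w i := Finset.sum_nonneg fun i _ => hw i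
  rcases hW.eq_or_lt with h | h
  · rw [← h, div_zero, abs_zero]
    positivity
  · rw [abs_div, abs_of_pos h, div_le_iff₀ h]
    refine (Finset.abs_sum_le_sum_abs _ _).trans ?_
    rw [Finset.sum_mul]
    refine Finset.sum_le_sum fun i _ => ?_
    rw [abs_mul, abs_of_nonneg (hw i), mul_comm]
    gcongr
    exact Finset.single_le_sum (fun i _ => hw i) (Finset.mem_univ i)

lemma abs_ipw_le {m : ℕ} {e : ℝ → ℝ} (he : ∀ x, 0 ≤ e x ∧ e x ≤ 1) {a : Fin m → ℝ}
    (ha : ∀ i, a i = 0 ∨ a i = 1) (x y : Fin m → ℝ) :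
    |ipw e a x y| ≤ 2 * ∑ i, |y i| := by
  have h1 := abs_sum_mul_div_sum_le (w := fun i => a i / e (x i)) (fun i => by
    have := (he (x i)).1
    rcases ha i with h | h <;> rw [h] <;> positivity) y
  have h2 := abs_sum_mul_div_sum_le (w := fun i => (1 - a i) / (1 - e (x i))) (fun i => by
    have : 0 ≤ 1 - e (x i) := by linarith [(he (x i)).2]
    rcases ha i with h | h <;> rw [h] <;> simp [this]) y
  simp only [div_mul_eq_mul_div] at h1 h2
  unfold ipw
  refine (abs_sub _ _).trans ?_
  linarith

/-- The treated have outcome `b + τ + r` and the untreated `b + r`; normalized weights reproduce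
constants, whatever the propensity function. -/
lemma ipw_eq_of_ne_zero {m : ℕ} {e : ℝ → ℝ} {a x y r : Fin m → ℝ} {b τ : ℝ}
    (ha : ∀ i, a i = 0 ∨ a i = 1) (hy : ∀ i, y i = b + τ * a i + r i)
    (h1 : ∑ i, a i / e (x i) ≠ 0) (h0 : ∑ i, (1 - a i) / (1 - e (x i)) ≠ 0) :
    ipw e a x y = τ + (∑ i, a i * r i / e (x i)) / (∑ i, a i / e (x i))
      - (∑ i, (1 - a i) * r i / (1 - e (x i))) / (∑ i, (1 - a i) / (1 - e (x i))) := by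
  have e1 : ∑ i, a i * y i / e (x i)
      = (b + τ) * ∑ i, a i / e (x i) + ∑ i, a i * r i / e (x i) := by
    rw [Finset.mul_sum, ← Finset.sum_add_distrib]
    refine Finset.sum_congr rfl fun i _ => ?_
    rcases ha i with h | h <;> rw [hy, h] <;> ring
  have e0 : ∑ i, (1 - a i) * y i / (1 - e (x i))
      = b * ∑ i, (1 - a i) / (1 - e (x i)) + ∑ i, (1 - a i) * r i / (1 - e (x i)) := by
    rw [Finset.mul_sum, ← Finset.sum_add_distrib]
    refine Finset.sum_congr rfl fun i _ => ?_
    rcases ha i with h | h <;> rw [hy, h] <;> ring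
  rw [ipw, e1, e0, add_div, add_div, mul_div_cancel_right₀ _ h1, mul_div_cancel_right₀ _ h0]
  ring

lemma abs_div_sub_self_le {n d : ℝ} (hd : |d - 1| < 1 / 2) : |n / d - n| ≤ 2 * (|n| * |d - 1|) := by
  have hd' : 1 / 2 ≤ d := by linarith [(abs_lt.1 hd).1]
  have hd0 : 0 < d := by linarith
  have e : n / d - n = -(n * (d - 1) / d) := by field_simp; ring
  rw [e, abs_neg, abs_div, abs_mul, abs_of_pos hd0, div_le_iff₀ hd0]
  nlinarith [mul_nonneg (abs_nonneg n) (abs_nonneg (d - 1))]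

variable {Ω : Type*} [MeasurableSpace Ω] {P : Measure Ω} [IsProbabilityMeasure P]

/-- The ratio estimator differs from the difference of the two numerators by a term of order `2`,
if the fitted propensity function is replaced by another one `eHat` on events whose complements have
probabilities of every order. -/
lemma lpOrder_ipwEstimator_sub {r : PropensityRule} {A X Y R : ℕ → Ω → ℝ} {b τ : ℝ}
    {eHat : ℕ → Ω → ℝ → ℝ} {B : ℕ → Set Ω}
    (hT : ∀ m, Measurable (ipwEstimator r A X Y m))
    (hA : ∀ i ω, A i ω = 0 ∨ A i ω = 1) (hY : ∀ i ω, Y i ω = b + τ * A i ω + R i ω)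
    (hYO : LpOrder P 0 (avg fun i ω => |Y i ω|))
    (hr : ∀ m ω x, 0 ≤ r m (fun i => A i ω) (fun i => X i ω) x ∧
      r m (fun i => A i ω) (fun i => X i ω) x ≤ 1)
    (hBO : ∀ a, LpOrder P a fun m => (B m).indicator 1)
    (heHat : ∀ m, ∀ ω ∉ B m, r m (fun i => A i ω) (fun i => X i ω) = eHat m ω)
    {N₁ D₁ N₀ D₀ : ℕ → Ω → ℝ}
    (hN₁ : ∀ m ω, N₁ m ω = (∑ i ∈ Finset.range m, A i ω * R i ω / eHat m ω (X i ω)) / m)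
    (hD₁ : ∀ m ω, D₁ m ω = (∑ i ∈ Finset.range m, A i ω / eHat m ω (X i ω)) / m)
    (hN₀ : ∀ m ω, N₀ m ω =
      (∑ i ∈ Finset.range m, (1 - A i ω) * R i ω / (1 - eHat m ω (X i ω))) / m)
    (hD₀ : ∀ m ω, D₀ m ω = (∑ i ∈ Finset.range m, (1 - A i ω) / (1 - eHat m ω (X i ω))) / m)
    (hN₁O : LpOrder P 1 N₁) (hN₀O : LpOrder P 1 N₀)
    (hD₁O : LpOrder P 1 fun m ω => D₁ m ω - 1) (hD₀O : LpOrder P 1 fun m ω => D₀ m ω - 1) :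
    LpOrder P 2 (fun m ω => ipwEstimator r A X Y m ω - τ - (N₁ m ω - N₀ m ω)) := by
  set B₁ : ℕ → Set Ω := fun m => {ω | 1 / 2 ≤ |D₁ m ω - 1|} with hB₁
  set B₀ : ℕ → Set Ω := fun m => {ω | 1 / 2 ≤ |D₀ m ω - 1|} with hB₀
  have hB₁m : ∀ m, MeasurableSet (B₁ m) := fun m =>
    measurableSet_le measurable_const (hD₁O.measurable m).norm
  have hB₀m : ∀ m, MeasurableSet (B₀ m) := fun m =>
    measurableSet_le measurable_const (hD₀O.measurable m).norm
  have hB₁O : ∀ a, LpOrder P a fun m => (B₁ m).indicator 1 :=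
    hD₁O.indicator (by norm_num) hB₁m fun m ω h => h
  have hB₀O : ∀ a, LpOrder P a fun m => (B₀ m).indicator 1 :=
    hD₀O.indicator (by norm_num) hB₀m fun m ω h => h
  have hind : ∀ a, LpOrder P a fun m ω => (B m).indicator 1 ω + (B₁ m).indicator 1 ω
      + (B₀ m).indicator (1 : Ω → ℝ) ω := fun a => ((hBO a).add (hB₁O a)).add (hB₀O a)
  -- On exceptional events the estimator is at most `2 * m` times the mean of `|Y|`. The factor `m`
  -- costs two orders, so the indicator is taken of order `4`.
  have hbadO : LpOrder P 2 (fun m ω => ((B m).indicator 1 ω + (B₁ m).indicator 1 ω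
      + (B₀ m).indicator (1 : Ω → ℝ) ω) * (|τ| + |N₁ m ω| + |N₀ m ω|)
      + 2 * ((m : ℝ) * (((B m).indicator 1 ω + (B₁ m).indicator 1 ω
      + (B₀ m).indicator (1 : Ω → ℝ) ω) * avg (fun i ω => |Y i ω|) m ω))) := by
    refine LpOrder.add ?_ (LpOrder.const_mul 2 (LpOrder.natCast_mul ((hind 4).mul hYO)))
    exact (hind 2).mul (((lpOrder_const |τ|).add
      (hN₁O.abs.mono (Nat.zero_le _))).add (hN₀O.abs.mono (Nat.zero_le _)))
  -- Elsewhere `N / D - N` is at most `2 * |N| * |D - 1|`, a product of two factors of order `1`.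
  have hgoodO : LpOrder P 2 (fun m ω => 2 * (|N₁ m ω| * |D₁ m ω - 1|)
      + 2 * (|N₀ m ω| * |D₀ m ω - 1|)) :=
    ((hN₁O.abs.mul hD₁O.abs).const_mul 2).add ((hN₀O.abs.mul hD₀O.abs).const_mul 2)
  refine (hgoodO.add hbadO).of_le (fun m => ((hT m).sub_const τ).sub
    ((hN₁O.measurable m).sub (hN₀O.measurable m))) fun m ω => ?_
  have hI : ∀ s : Set Ω, 0 ≤ s.indicator (1 : Ω → ℝ) ω :=
    fun s => Set.indicator_nonneg (fun _ _ => zero_le_one) _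
  have havg0 : 0 ≤ avg (fun i ω => |Y i ω|) m ω :=
    div_nonneg (Finset.sum_nonneg fun i _ => abs_nonneg _) (Nat.cast_nonneg m)
  by_cases hbad : ω ∈ B m ∪ B₁ m ∪ B₀ m
  · have hone : 1 ≤ (B m).indicator 1 ω + (B₁ m).indicator 1 ω
        + (B₀ m).indicator (1 : Ω → ℝ) ω := by
      rcases hbad with (h | h) | h
      · rw [Set.indicator_of_mem h]
        simp only [Pi.one_apply]
        linarith [hI (B₁ m), hI (B₀ m)]
      · rw [Set.indicator_of_mem h]
        simp only [Pi.one_apply]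
        linarith [hI (B m), hI (B₀ m)]
      · rw [Set.indicator_of_mem h]
        simp only [Pi.one_apply]
        linarith [hI (B₁ m), hI (B m)]
    set I := (B m).indicator 1 ω + (B₁ m).indicator 1 ω + (B₀ m).indicator (1 : Ω → ℝ) ω
    have h1 : |ipwEstimator r A X Y m ω| ≤ 2 * (m * avg (fun i ω => |Y i ω|) m ω) := by
      refine (abs_ipw_le (hr m ω) (fun i => hA i ω) _ _).trans (le_of_eq ?_)
      rw [Fin.sum_univ_eq_sum_range (fun i => |Y i ω|) m, avg]
      rcases Nat.eq_zero_or_pos m with rfl | hm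
      · simp
      · field_simp
    have h2 : |ipwEstimator r A X Y m ω - τ - (N₁ m ω - N₀ m ω)|
        ≤ |ipwEstimator r A X Y m ω| + (|τ| + |N₁ m ω| + |N₀ m ω|) := by
      calc _ ≤ |ipwEstimator r A X Y m ω| + |τ| + (|N₁ m ω| + |N₀ m ω|) :=
            (abs_sub _ _).trans (add_le_add (abs_sub _ _) (abs_sub _ _))
        _ = _ := by ring
    have h3 : |τ| + |N₁ m ω| + |N₀ m ω| ≤ I * (|τ| + |N₁ m ω| + |N₀ m ω|) :=
      le_mul_of_one_le_left (by positivity) hone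
    have h4 : (m : ℝ) * avg (fun i ω => |Y i ω|) m ω
        ≤ m * (I * avg (fun i ω => |Y i ω|) m ω) := by
      gcongr
      exact le_mul_of_one_le_left havg0 hone
    have h5 : 0 ≤ 2 * (|N₁ m ω| * |D₁ m ω - 1|) + 2 * (|N₀ m ω| * |D₀ m ω - 1|) := by positivity
    linarith
  · simp only [Set.mem_union, not_or] at hbad
    obtain ⟨⟨g, g₁⟩, g₀⟩ := hbad
    have g₁' : |D₁ m ω - 1| < 1 / 2 := not_le.1 g₁
    have g₀' : |D₀ m ω - 1| < 1 / 2 := not_le.1 g₀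
    have d₁ : D₁ m ω ≠ 0 := by
      intro h; rw [h] at g₁'; norm_num at g₁'
    have d₀ : D₀ m ω ≠ 0 := by
      intro h; rw [h] at g₀'; norm_num at g₀'
    have hm : (m : ℝ) ≠ 0 := by
      intro h; rw [hD₁, h, div_zero] at d₁; exact d₁ rfl
    have s₁ : ∑ i : Fin m, A i ω / eHat m ω (X i ω) = m * D₁ m ω := by
      rw [Fin.sum_univ_eq_sum_range (fun i => A i ω / eHat m ω (X i ω)) m, hD₁]; field_simp
    have s₀ : ∑ i : Fin m, (1 - A i ω) / (1 - eHat m ω (X i ω)) = m * D₀ m ω := by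
      rw [Fin.sum_univ_eq_sum_range (fun i => (1 - A i ω) / (1 - eHat m ω (X i ω))) m, hD₀]
      field_simp
    have n₁ : ∑ i : Fin m, A i ω * R i ω / eHat m ω (X i ω) = m * N₁ m ω := by
      rw [Fin.sum_univ_eq_sum_range (fun i => A i ω * R i ω / eHat m ω (X i ω)) m, hN₁]; field_simp
    have n₀ : ∑ i : Fin m, (1 - A i ω) * R i ω / (1 - eHat m ω (X i ω)) = m * N₀ m ω := by
      rw [Fin.sum_univ_eq_sum_range
        (fun i => (1 - A i ω) * R i ω / (1 - eHat m ω (X i ω))) m, hN₀]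
      field_simp
    have hval : ipwEstimator r A X Y m ω = τ + N₁ m ω / D₁ m ω - N₀ m ω / D₀ m ω := by
      rw [ipwEstimator, heHat m ω g, ipw_eq_of_ne_zero (r := fun i : Fin m => R i ω)
        (fun i => hA i ω) (fun i => hY i ω) (by rw [s₁]; exact mul_ne_zero hm d₁)
        (by rw [s₀]; exact mul_ne_zero hm d₀), s₁, s₀, n₁, n₀,
        mul_div_mul_left _ _ hm, mul_div_mul_left _ _ hm]
    have e : ipwEstimator r A X Y m ω - τ - (N₁ m ω - N₀ m ω)
        = (N₁ m ω / D₁ m ω - N₁ m ω) - (N₀ m ω / D₀ m ω - N₀ m ω) := by rw [hval]; ring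
    rw [e]
    refine (abs_sub _ _).trans ?_
    have b₁ := abs_div_sub_self_le (n := N₁ m ω) g₁'
    have b₀ := abs_div_sub_self_le (n := N₀ m ω) g₀'
    have hnn : 0 ≤ (B m).indicator 1 ω + (B₁ m).indicator 1 ω
        + (B₀ m).indicator (1 : Ω → ℝ) ω := add_nonneg (add_nonneg (hI _) (hI _)) (hI _)
    have p1 := mul_nonneg hnn (by positivity : 0 ≤ |τ| + |N₁ m ω| + |N₀ m ω|)
    have p2 := mul_nonneg (Nat.cast_nonneg (α := ℝ) m) (mul_nonneg hnn havg0)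
    linarith

end Hajek

/-! ### Abstract samples, and the estimator with known propensity. -/

section PropensitySample

variable {Ω : Type*} [MeasurableSpace Ω] {P : Measure Ω}

/-- An i.i.d. sample of a binary treatment `A`, a covariate `X` and a centered residual `R`, such
that `A` and `R` are conditionally uncorrelated given `X`, with conditional treatment
probability `e X`. -/
structure PropensitySample (P : Measure Ω) (e : ℝ → ℝ) (A X R : ℕ → Ω → ℝ) : Prop where
  measurable_A : ∀ i, Measurable (A i)
  measurable_X : ∀ i, Measurable (X i)
  measurable_R : ∀ i, Measurable (R i)
  binary : ∀ i ω, A i ω = 0 ∨ A i ω = 1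
  indep : iIndepFun (fun i ω => (A i ω, X i ω, R i ω)) P
  ident : ∀ i, IdentDistrib (fun ω => (A i ω, X i ω, R i ω))
    (fun ω => (A 0 ω, X 0 ω, R 0 ω)) P P
  exp_X : ∀ t, AllMoments P fun ω => Real.exp (t * X 0 ω)
  X_ne : ∀ c, ∀ᵐ ω ∂P, X 0 ω ≠ c
  moments_R : AllMoments P (R 0)
  integral_R : ∫ ω, R 0 ω ∂P = 0
  propensity : ∀ g : ℝ → ℝ, Measurable g → AllMoments P (fun ω => g (X 0 ω)) →
    ∫ ω, A 0 ω * g (X 0 ω) ∂P = ∫ ω, e (X 0 ω) * g (X 0 ω) ∂P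
  propensity_R : ∀ g : ℝ → ℝ, Measurable g → AllMoments P (fun ω => g (X 0 ω)) →
    ∫ ω, A 0 ω * (g (X 0 ω) * R 0 ω) ∂P = ∫ ω, e (X 0 ω) * (g (X 0 ω) * R 0 ω) ∂P
  not_function : ∀ f : ℝ × ℝ → ℝ, Measurable f → ¬ R 0 =ᵐ[P] fun ω => f (A 0 ω, X 0 ω)

variable {e : ℝ → ℝ} {A X R : ℕ → Ω → ℝ}

namespace PropensitySample

lemma measurable_triple (S : PropensitySample P e A X R) (i : ℕ) :
    Measurable fun ω => (A i ω, X i ω, R i ω) :=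
  (S.measurable_A i).prodMk ((S.measurable_X i).prodMk (S.measurable_R i))

lemma identDistrib_comp (S : PropensitySample P e A X R) {φ : ℝ × ℝ × ℝ → ℝ} (hφ : Measurable φ)
    (i : ℕ) : IdentDistrib (fun ω => φ (A i ω, X i ω, R i ω))
      (fun ω => φ (A 0 ω, X 0 ω, R 0 ω)) P P :=
  (S.ident i).comp hφ

lemma iIndepFun_comp (S : PropensitySample P e A X R) {φ : ℝ × ℝ × ℝ → ℝ} (hφ : Measurable φ) :
    iIndepFun (fun i ω => φ (A i ω, X i ω, R i ω)) P :=
  S.indep.comp (fun _ => φ) fun _ => hφ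

lemma exp_abs_X (S : PropensitySample P e A X R) (t : ℝ) :
    AllMoments P fun ω => Real.exp (t * |X 0 ω|) := by
  refine ((S.exp_X t).add (S.exp_X (-t))).of_abs_le (by have := S.measurable_X 0; fun_prop)
    fun ω => ?_
  rw [abs_of_pos (Real.exp_pos _), abs_of_pos (add_pos (Real.exp_pos _) (Real.exp_pos _))]
  rcases abs_choice (X 0 ω) with h | h <;> rw [h]
  · linarith [Real.exp_pos (-t * X 0 ω)]
  · rw [mul_neg, ← neg_mul]
    linarith [Real.exp_pos (t * X 0 ω)]

lemma integral_treated_residual (S : PropensitySample P e A X R) (he : Measurable e)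
    (he0 : ∀ x, 0 < e x ∧ e x < 1) (hmom : AllMoments P fun ω => (e (X 0 ω))⁻¹) :
    ∫ ω, A 0 ω * ((e (X 0 ω))⁻¹ * R 0 ω) ∂P = 0 := by
  rw [S.propensity_R (fun x => (e x)⁻¹) he.inv hmom]
  simp only [← mul_assoc, mul_inv_cancel₀ (he0 _).1.ne', one_mul, S.integral_R]

lemma one_add_abs_X (S : PropensitySample P e A X R) : AllMoments P fun ω => 1 + |X 0 ω| := by
  refine (S.exp_abs_X 1).of_abs_le ((S.measurable_X 0).norm.const_add 1) fun ω => ?_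
  rw [abs_of_pos (by positivity), abs_of_pos (Real.exp_pos _), one_mul, add_comm]
  exact Real.add_one_le_exp _

lemma moments_X (S : PropensitySample P e A X R) : AllMoments P (X 0) := by
  refine S.one_add_abs_X.of_abs_le (S.measurable_X 0) fun ω => ?_
  rw [abs_of_pos (by positivity : 0 < 1 + |X 0 ω|)]
  linarith

variable [IsProbabilityMeasure P]

lemma lpOrder_avg (S : PropensitySample P e A X R) (φ : ℝ × ℝ × ℝ → ℝ) (hφ : Measurable φ)
    (h : AllMoments P fun ω => φ (A 0 ω, X 0 ω, R 0 ω)) :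
    LpOrder P 0 (avg fun i ω => φ (A i ω, X i ω, R i ω)) :=
  _root_.lpOrder_avg h (fun i => hφ.comp (S.measurable_triple i)) (S.identDistrib_comp hφ)

lemma lpOrder_avg_sub (S : PropensitySample P e A X R) (φ : ℝ × ℝ × ℝ → ℝ) (hφ : Measurable φ)
    (h : AllMoments P fun ω => φ (A 0 ω, X 0 ω, R 0 ω)) :
    LpOrder P 1 fun m ω => avg (fun i ω => φ (A i ω, X i ω, R i ω)) m ω
      - ∫ ω, φ (A 0 ω, X 0 ω, R 0 ω) ∂P :=
  lpOrder_avg_sub_integral h (fun i => hφ.comp (S.measurable_triple i)) (S.identDistrib_comp hφ)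
    (S.iIndepFun_comp hφ)

lemma moments_A (S : PropensitySample P e A X R) : AllMoments P (A 0) :=
  AllMoments.of_bound (S.measurable_A 0) 1 fun ω => by rcases S.binary 0 ω with h | h <;> simp [h]

/-- An influence function of the form `w(A, X) R + v(A, X)` with `w ≠ 0` is nondegenerate. -/
lemma variance_pos (S : PropensitySample P e A X R) {w v : ℝ × ℝ → ℝ} (hw : Measurable w)
    (hv : Measurable v) (hw0 : ∀ ω, w (A 0 ω, X 0 ω) ≠ 0)
    (hmom : AllMoments P fun ω => w (A 0 ω, X 0 ω) * R 0 ω + v (A 0 ω, X 0 ω))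
    (h0 : ∫ ω, (w (A 0 ω, X 0 ω) * R 0 ω + v (A 0 ω, X 0 ω)) ∂P = 0) :
    0 < Var[fun ω => w (A 0 ω, X 0 ω) * R 0 ω + v (A 0 ω, X 0 ω); P] := by
  refine (variance_nonneg _ _).lt_of_ne fun h => ?_
  have h1 := ae_eq_integral_of_variance_eq_zero (by simpa using hmom.memLp 2) h.symm
  rw [h0] at h1
  -- Zero variance would force `R = -v / w` almost surely, a function of `(A, X)`.
  refine S.not_function (fun z => - v z / w z) (hv.neg.div hw) ?_
  filter_upwards [h1] with ω hω
  have := hw0 ω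
  field_simp
  linarith

end PropensitySample

/-- The conclusion for one data set, on which the estimator `T` of `τ` is computed. -/
def AsymptoticallyLinear (P : Measure Ω) (T : ℕ → Ω → ℝ) (τ : ℝ) : Prop :=
  ∃ ψ Δ : ℕ → Ω → ℝ, AllMoments P (ψ 0) ∧ (∀ i, Measurable (ψ i)) ∧
    (∀ i, IdentDistrib (ψ i) (ψ 0) P P) ∧ iIndepFun ψ P ∧ ∫ ω, ψ 0 ω ∂P = 0 ∧
    0 < Var[ψ 0; P] ∧ LpOrder P 2 Δ ∧ ∀ m ω, T m ω = τ + avg ψ m ω + Δ m ω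

variable [IsProbabilityMeasure P]

/-- An estimator is asymptotically linear if it has the expansion given by an influence function
of the form `w(A, X) R + v(A, X)`. -/
lemma PropensitySample.asymptoticallyLinear (S : PropensitySample P e A X R) {w v : ℝ × ℝ → ℝ}
    (hw : Measurable w) (hv : Measurable v) (hw0 : ∀ ω, w (A 0 ω, X 0 ω) ≠ 0)
    (hmom : AllMoments P fun ω => w (A 0 ω, X 0 ω) * R 0 ω + v (A 0 ω, X 0 ω))
    (h0 : ∫ ω, (w (A 0 ω, X 0 ω) * R 0 ω + v (A 0 ω, X 0 ω)) ∂P = 0)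
    {T : ℕ → Ω → ℝ} {τ : ℝ}
    (hT : LpOrder P 2 fun m ω => T m ω - τ
      - avg (fun i ω => w (A i ω, X i ω) * R i ω + v (A i ω, X i ω)) m ω) :
    AsymptoticallyLinear P T τ := by
  have hφ : Measurable fun z : ℝ × ℝ × ℝ => w (z.1, z.2.1) * z.2.2 + v (z.1, z.2.1) := by
    fun_prop
  exact ⟨fun i ω => w (A i ω, X i ω) * R i ω + v (A i ω, X i ω), _, hmom,
    fun i => hφ.comp (S.measurable_triple i), S.identDistrib_comp hφ, S.iIndepFun_comp hφ, h0,
    S.variance_pos hw hv hw0 hmom h0, hT, fun m ω => by ring⟩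

namespace PropensitySample

lemma integral_treated (S : PropensitySample P e A X R) (he : Measurable e)
    (he0 : ∀ x, 0 < e x ∧ e x < 1) (hmom : AllMoments P fun ω => (e (X 0 ω))⁻¹) :
    ∫ ω, A 0 ω * (e (X 0 ω))⁻¹ ∂P = 1 := by
  rw [S.propensity (fun x => (e x)⁻¹) he.inv hmom]
  simp [mul_inv_cancel₀ (he0 _).1.ne']

/-- Exchanging the two treatment arms. -/
lemma flip (S : PropensitySample P e A X R) (he : Measurable e) (he0 : ∀ x, 0 < e x ∧ e x < 1) :
    PropensitySample P (fun x => 1 - e x) (fun i ω => 1 - A i ω) X R where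
  measurable_A i := (S.measurable_A i).const_sub 1
  measurable_X := S.measurable_X
  measurable_R := S.measurable_R
  binary i ω := by rcases S.binary i ω with h | h <;> simp [h]
  indep := S.indep.comp (fun _ z => (1 - z.1, z.2)) fun _ => by fun_prop
  ident i := (S.ident i).comp (u := fun z => (1 - z.1, z.2)) (by fun_prop)
  exp_X := S.exp_X
  X_ne := S.X_ne
  moments_R := S.moments_R
  integral_R := S.integral_R
  propensity g hg hmom := by
    have mX := S.measurable_X 0
    have me : AllMoments P fun ω => e (X 0 ω) := AllMoments.of_bound (by fun_prop) 1 fun ω => by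
      rw [abs_of_pos (he0 _).1]; exact (he0 _).2.le
    simp only [sub_mul, one_mul]
    rw [integral_sub hmom.integrable (S.moments_A.mul hmom).integrable, S.propensity g hg hmom,
      integral_sub hmom.integrable (me.mul hmom).integrable]
  propensity_R g hg hmom := by
    have mX := S.measurable_X 0
    have me : AllMoments P fun ω => e (X 0 ω) := AllMoments.of_bound (by fun_prop) 1 fun ω => by
      rw [abs_of_pos (he0 _).1]; exact (he0 _).2.le
    have hmom' := hmom.mul S.moments_R
    simp only [sub_mul, one_mul]
    rw [integral_sub hmom'.integrable (S.moments_A.mul hmom').integrable,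
      S.propensity_R g hg hmom, integral_sub hmom'.integrable (me.mul hmom').integrable]
  not_function f hf h := S.not_function (fun z => f (1 - z.1, z.2)) (by fun_prop) h

end PropensitySample

/-- The estimator with the true propensity score. -/
theorem PropensitySample.asymptoticallyLinear_known (S : PropensitySample P e A X R)
    (he : Measurable e) (he0 : ∀ x, 0 < e x ∧ e x < 1)
    (hmom₁ : AllMoments P fun ω => (e (X 0 ω))⁻¹)
    (hmom₀ : AllMoments P fun ω => (1 - e (X 0 ω))⁻¹)
    {Y : ℕ → Ω → ℝ} {b τ : ℝ} (hY : ∀ i ω, Y i ω = b + τ * A i ω + R i ω)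
    (hT : ∀ m, Measurable (ipwEstimator (fun _ _ _ => e) A X Y m)) :
    AsymptoticallyLinear P (ipwEstimator (fun _ _ _ => e) A X Y) τ := by
  have mX := S.measurable_X 0
  have e0 : ∀ x, e x ≠ 0 := fun x => (he0 x).1.ne'
  have e1 : ∀ x, 1 - e x ≠ 0 := fun x => by linarith [(he0 x).2]
  have mA' : AllMoments P fun ω => 1 - A 0 ω := (allMoments_const 1).sub S.moments_A
  have M1 : AllMoments P fun ω => A 0 ω * ((e (X 0 ω))⁻¹ * R 0 ω) :=
    S.moments_A.mul (hmom₁.mul S.moments_R)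
  have M0 : AllMoments P fun ω => (1 - A 0 ω) * ((1 - e (X 0 ω))⁻¹ * R 0 ω) :=
    mA'.mul (hmom₀.mul S.moments_R)
  have F := S.flip he he0
  have he0' : ∀ x, 0 < 1 - e x ∧ 1 - e x < 1 := fun x =>
    ⟨by linarith [(he0 x).2], by linarith [(he0 x).1]⟩
  have I1 := S.integral_treated_residual he he0 hmom₁
  have I0 := F.integral_treated_residual (he.const_sub 1) he0' hmom₀
  have J1 := S.integral_treated he he0 hmom₁
  have J0 := F.integral_treated (he.const_sub 1) he0' hmom₀
  have ON1 := S.lpOrder_avg_sub (fun z => z.1 * ((e z.2.1)⁻¹ * z.2.2)) (by fun_prop) M1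
  have ON0 := S.lpOrder_avg_sub (fun z => (1 - z.1) * ((1 - e z.2.1)⁻¹ * z.2.2)) (by fun_prop) M0
  have OD1 := S.lpOrder_avg_sub (fun z => z.1 * (e z.2.1)⁻¹) (by fun_prop) (S.moments_A.mul hmom₁)
  have OD0 := S.lpOrder_avg_sub (fun z => (1 - z.1) * (1 - e z.2.1)⁻¹) (by fun_prop)
    (mA'.mul hmom₀)
  simp only [I1, I0, J1, J0, sub_zero] at ON1 ON0 OD1 OD0
  have hYO : LpOrder P 0 (avg fun i ω => |Y i ω|) := by
    have := S.lpOrder_avg (fun z => |b + τ * z.1 + z.2.2|) (by fun_prop)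
      (((allMoments_const b).add (S.moments_A.const_mul τ)).add S.moments_R).abs
    simpa only [← hY] using this
  -- Nothing is fitted, so there is no exceptional event besides those of the denominators.
  have key := lpOrder_ipwEstimator_sub (r := fun _ _ _ => e) (B := fun _ => ∅)
    (eHat := fun _ _ => e) hT S.binary hY hYO (fun _ _ x => ⟨(he0 x).1.le, (he0 x).2.le⟩)
    (fun a => by
      simp only [Set.indicator_empty]
      exact ⟨fun _ => measurable_const, fun k => ⟨0, fun m => by simp⟩⟩)
    (fun _ _ _ => rfl)
    (fun m ω => by rw [avg]; congr 2; ext i; ring)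
    (fun m ω => by rw [avg]; congr 2)
    (fun m ω => by rw [avg]; congr 2; ext i; ring)
    (fun m ω => by rw [avg]; congr 2) ON1 ON0 OD1 OD0
  -- `w` is nonzero because exactly one of `A` and `1 - A` is nonzero.
  refine S.asymptoticallyLinear (w := fun z => z.1 * (e z.2)⁻¹ - (1 - z.1) * (1 - e z.2)⁻¹)
    (v := fun _ => 0) (by fun_prop) measurable_const ?_ ?_ ?_ ?_
  · intro ω
    rcases S.binary 0 ω with h | h
    · simpa [h] using e1 _
    · simpa [h] using e0 _
  · convert M1.sub M0 using 2 with ω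
    ring
  · calc _ = ∫ ω, (A 0 ω * ((e (X 0 ω))⁻¹ * R 0 ω)
          - (1 - A 0 ω) * ((1 - e (X 0 ω))⁻¹ * R 0 ω)) ∂P := by congr 1; ext ω; ring
      _ = 0 := by rw [integral_sub M1.integrable M0.integrable, I1, I0, sub_zero]
  · have h : ∀ m ω, avg (fun i ω => (A i ω * (e (X i ω))⁻¹
          - (1 - A i ω) * (1 - e (X i ω))⁻¹) * R i ω + 0) m ω
        = avg (fun i ω => A i ω * ((e (X i ω))⁻¹ * R i ω)) m ω
          - avg (fun i ω => (1 - A i ω) * ((1 - e (X i ω))⁻¹ * R i ω)) m ω := fun m ω => by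
      rw [← avg_sub]
      refine congrArg (fun f => avg f m ω) ?_
      ext i ω
      ring
    simpa only [h] using key

end PropensitySample

/-! ### Expansions in the fitted logistic parameter. -/

section LogisticSample

lemma Real.abs_exp_sub_one_sub_le (v : ℝ) :
    |Real.exp v - 1 - v| ≤ v ^ 2 * Real.exp |v| := by
  have h := Complex.norm_exp_sub_sum_le_norm_mul_exp (v : ℂ) 2
  simp only [Finset.sum_range_succ, Finset.sum_range_zero, pow_zero, Nat.factorial_zero,
    Nat.cast_one, div_one, zero_add, pow_one, Nat.factorial_one, Complex.norm_real,
    Real.norm_eq_abs, sq_abs] at h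
  rw [← Complex.ofReal_exp, ← Complex.ofReal_one, ← Complex.ofReal_add, ← Complex.ofReal_sub,
    Complex.norm_real, Real.norm_eq_abs] at h
  rwa [sub_sub]

/-- The inverse sigmoid is `1 + exp (-t)`, so only `exp` has to be expanded. The bound separates
`h`, later the norm of the parameter error, from a function of `y = 1 + |x|` whose moments are
finite. -/
lemma Real.abs_inv_sigmoid_add_sub_le {t u h y : ℝ} (hu : |u| ≤ h * y) (hh1 : h ≤ 1)
    (hy : 0 ≤ y) : |(Real.sigmoid (t + u))⁻¹ - (Real.sigmoid t)⁻¹ + Real.exp (-t) * u|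
      ≤ h ^ 2 * (Real.exp (-t) * y ^ 2 * Real.exp y) := by
  have e : (Real.sigmoid (t + u))⁻¹ - (Real.sigmoid t)⁻¹ + Real.exp (-t) * u
      = Real.exp (-t) * (Real.exp (-u) - 1 - -u) := by
    rw [Real.inv_sigmoid, Real.inv_sigmoid, neg_add, Real.exp_add]; ring
  have h1 : |u| ≤ y := hu.trans (mul_le_of_le_one_left hy hh1)
  have h2 : u ^ 2 ≤ h ^ 2 * y ^ 2 := by
    rw [← sq_abs, ← mul_pow]; gcongr
  rw [e, abs_mul, abs_of_pos (Real.exp_pos _)]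
  calc _ ≤ Real.exp (-t) * ((-u) ^ 2 * Real.exp |-u|) := by
        gcongr; exact Real.abs_exp_sub_one_sub_le _
    _ = Real.exp (-t) * (u ^ 2 * Real.exp |u|) := by rw [neg_sq, abs_neg]
    _ ≤ Real.exp (-t) * ((h ^ 2 * y ^ 2) * Real.exp y) := by gcongr
    _ = _ := by ring

variable {Ω : Type*} [MeasurableSpace Ω] {P : Measure Ω}
  {e : ℝ → ℝ} {A X R : ℕ → Ω → ℝ} {γ : ℝ × ℝ} {d : ℕ → Ω → ℝ × ℝ}

lemma IsLogisticWith.measurable (he : IsLogisticWith e γ) : Measurable e := by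
  have : e = fun x => Real.sigmoid (γ.1 + γ.2 * x) := funext he
  rw [this]
  exact (continuous_sigmoid.comp (by fun_prop)).measurable

lemma IsLogisticWith.pos_and_lt_one (he : IsLogisticWith e γ) (x : ℝ) : 0 < e x ∧ e x < 1 := by
  rw [he]; exact ⟨Real.sigmoid_pos _, Real.sigmoid_lt_one _⟩

lemma IsLogisticWith.flip (he : IsLogisticWith e γ) : IsLogisticWith (fun x => 1 - e x) (-γ) := by
  intro x
  simp only
  rw [he, ← Real.sigmoid_neg]
  congr 1
  simp only [Prod.fst_neg, Prod.snd_neg]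
  ring

lemma LpOrder.fst_of_norm (hd : ∀ m, Measurable (d m)) (hdO : LpOrder P 1 fun m ω => ‖d m ω‖) :
    LpOrder P 1 fun m ω => (d m ω).1 :=
  hdO.of_le (fun m => (hd m).fst) fun m ω => norm_fst_le (d m ω)

lemma LpOrder.snd_of_norm (hd : ∀ m, Measurable (d m)) (hdO : LpOrder P 1 fun m ω => ‖d m ω‖) :
    LpOrder P 1 fun m ω => (d m ω).2 :=
  hdO.of_le (fun m => (hd m).snd) fun m ω => norm_snd_le (d m ω)

variable [IsProbabilityMeasure P]

namespace PropensitySample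

lemma moments_exp_linear (S : PropensitySample P e A X R) (γ : ℝ × ℝ) :
    AllMoments P fun ω => Real.exp (-(γ.1 + γ.2 * X 0 ω)) := by
  convert (S.exp_X (-γ.2)).const_mul (Real.exp (-γ.1)) using 2 with ω
  rw [← Real.exp_add]; congr 1; ring

lemma moments_inv (S : PropensitySample P e A X R) (he : IsLogisticWith e γ) :
    AllMoments P fun ω => (e (X 0 ω))⁻¹ := by
  simp only [he _, Real.inv_sigmoid]
  exact (allMoments_const 1).add (S.moments_exp_linear γ)

/-- First order expansion of inverse probability weighted means in the logistic parameter. -/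
lemma lpOrder_weighted_expansion (S : PropensitySample P e A X R) (he : IsLogisticWith e γ)
    (hd : ∀ m, Measurable (d m)) (hdO : LpOrder P 1 fun m ω => ‖d m ω‖) (hd1 : ∀ m ω, ‖d m ω‖ ≤ 1)
    (q : ℝ × ℝ × ℝ → ℝ) (hq : Measurable q)
    (hqm : AllMoments P fun ω => q (A 0 ω, X 0 ω, R 0 ω)) :
    LpOrder P 2 fun m ω =>
      (∑ i ∈ Finset.range m, q (A i ω, X i ω, R i ω) /
        Real.sigmoid ((γ + d m ω).1 + (γ + d m ω).2 * X i ω)) / m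
      - avg (fun i ω => q (A i ω, X i ω, R i ω) * (e (X i ω))⁻¹) m ω
      + ((∫ ω, q (A 0 ω, X 0 ω, R 0 ω) * Real.exp (-(γ.1 + γ.2 * X 0 ω)) ∂P) * (d m ω).1
      + (∫ ω, q (A 0 ω, X 0 ω, R 0 ω) * Real.exp (-(γ.1 + γ.2 * X 0 ω)) * X 0 ω ∂P)
        * (d m ω).2) := by
  have mexp := S.moments_exp_linear γ
  have O1 := S.lpOrder_avg_sub (fun z => q z * Real.exp (-(γ.1 + γ.2 * z.2.1))) (by fun_prop)
    (hqm.mul mexp)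
  have O2 := S.lpOrder_avg_sub (fun z => q z * Real.exp (-(γ.1 + γ.2 * z.2.1)) * z.2.1)
    (by fun_prop) ((hqm.mul mexp).mul S.moments_X)
  simp only at O1 O2
  set E₁ := ∫ ω, q (A 0 ω, X 0 ω, R 0 ω) * Real.exp (-(γ.1 + γ.2 * X 0 ω)) ∂P
  set E₂ := ∫ ω, q (A 0 ω, X 0 ω, R 0 ω) * Real.exp (-(γ.1 + γ.2 * X 0 ω)) * X 0 ω ∂P
  -- An envelope of the Taylor remainder that does not involve `d`, thanks to `‖d‖ ≤ 1`; its moments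
  -- are finite because `X` has exponential moments.
  have OG := S.lpOrder_avg (fun z => |q z| * (Real.exp (-(γ.1 + γ.2 * z.2.1)) * (1 + |z.2.1|) ^ 2
    * Real.exp (1 + |z.2.1|))) (by fun_prop) (by
      refine hqm.abs.mul ((mexp.mul (S.one_add_abs_X.pow 2)).mul ?_)
      convert (S.exp_abs_X 1).const_mul (Real.exp 1) using 2 with ω
      rw [Real.exp_add, one_mul])
  have hbound : LpOrder P 2 fun m ω => ‖d m ω‖ * ‖d m ω‖ * avg (fun i ω =>
      |q (A i ω, X i ω, R i ω)| * (Real.exp (-(γ.1 + γ.2 * X i ω)) * (1 + |X i ω|) ^ 2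
        * Real.exp (1 + |X i ω|))) m ω
      + ‖d m ω‖ * |avg (fun i ω => q (A i ω, X i ω, R i ω)
        * Real.exp (-(γ.1 + γ.2 * X i ω))) m ω - E₁|
      + ‖d m ω‖ * |avg (fun i ω => q (A i ω, X i ω, R i ω)
        * Real.exp (-(γ.1 + γ.2 * X i ω)) * X i ω) m ω - E₂| :=
    (((hdO.mul hdO).mul OG).add (hdO.mul O1.abs)).add (hdO.mul O2.abs)
  refine hbound.of_le (fun m => ?_) fun m ω => ?_
  · have mX := S.measurable_X
    have mt := S.measurable_triple
    have me := he.measurable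
    have md := hd m
    have msig : Measurable Real.sigmoid := continuous_sigmoid.measurable
    refine ((Measurable.div_const (Finset.measurable_fun_sum _ fun i _ =>
      (hq.comp (mt i)).div (msig.comp (by have := mX i; fun_prop))) _).sub
      (measurable_avg (fun i => (hq.comp (mt i)).mul (me.comp (mX i)).inv) m)).add (by fun_prop)
  · set D := d m ω
    -- A quadratic Taylor remainder, and the errors from replacing empirical coefficients of `d` by
    -- expectations; the latter are products of two terms of order `1`.
    have hsplit : (∑ i ∈ Finset.range m, q (A i ω, X i ω, R i ω) /
          Real.sigmoid ((γ + D).1 + (γ + D).2 * X i ω)) / m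
        - avg (fun i ω => q (A i ω, X i ω, R i ω) * (e (X i ω))⁻¹) m ω + (E₁ * D.1 + E₂ * D.2)
        = (∑ i ∈ Finset.range m, q (A i ω, X i ω, R i ω) *
            ((Real.sigmoid (γ.1 + γ.2 * X i ω + (D.1 + D.2 * X i ω)))⁻¹
            - (Real.sigmoid (γ.1 + γ.2 * X i ω))⁻¹
            + Real.exp (-(γ.1 + γ.2 * X i ω)) * (D.1 + D.2 * X i ω))) / m
          - D.1 * (avg (fun i ω => q (A i ω, X i ω, R i ω)
              * Real.exp (-(γ.1 + γ.2 * X i ω))) m ω - E₁)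
          - D.2 * (avg (fun i ω => q (A i ω, X i ω, R i ω)
              * Real.exp (-(γ.1 + γ.2 * X i ω)) * X i ω) m ω - E₂) := by
      have : ∀ i, q (A i ω, X i ω, R i ω) *
            ((Real.sigmoid (γ.1 + γ.2 * X i ω + (D.1 + D.2 * X i ω)))⁻¹
            - (Real.sigmoid (γ.1 + γ.2 * X i ω))⁻¹
            + Real.exp (-(γ.1 + γ.2 * X i ω)) * (D.1 + D.2 * X i ω))
          = q (A i ω, X i ω, R i ω) / Real.sigmoid ((γ + D).1 + (γ + D).2 * X i ω)
            - q (A i ω, X i ω, R i ω) * (e (X i ω))⁻¹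
            + (D.1 * (q (A i ω, X i ω, R i ω) * Real.exp (-(γ.1 + γ.2 * X i ω)))
            + D.2 * (q (A i ω, X i ω, R i ω) * Real.exp (-(γ.1 + γ.2 * X i ω)) * X i ω)) := by
        intro i
        have : (γ + D).1 + (γ + D).2 * X i ω = γ.1 + γ.2 * X i ω + (D.1 + D.2 * X i ω) := by
          simp only [Prod.fst_add, Prod.snd_add]; ring
        rw [this, he]
        ring
      simp only [this, Finset.sum_add_distrib, Finset.sum_sub_distrib, ← Finset.mul_sum, avg]
      ring
    rw [hsplit]
    refine (abs_sub _ _).trans (add_le_add ((abs_sub _ _).trans (add_le_add ?_ ?_)) ?_)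
    · rw [avg, ← mul_div_assoc, abs_div, Nat.abs_cast, Finset.mul_sum]
      gcongr
      refine (Finset.abs_sum_le_sum_abs _ _).trans (Finset.sum_le_sum fun i _ => ?_)
      rw [abs_mul, mul_left_comm, ← sq]
      gcongr
      exact Real.abs_inv_sigmoid_add_sub_le (abs_add_mul_le _ _) (hd1 m ω)
        (by positivity)
    · rw [abs_mul]
      gcongr
      exact norm_fst_le D
    · rw [abs_mul]
      gcongr
      exact norm_snd_le D

/-- First order expansion of the score equation of logistic regression. -/
lemma lpOrder_score_expansion (S : PropensitySample P e A X R) (he : IsLogisticWith e γ)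
    (hd : ∀ m, Measurable (d m)) (hdO : LpOrder P 1 fun m ω => ‖d m ω‖)
    {B : ℕ → Set Ω} (hB : LpOrder P 2 fun m => (B m).indicator 1) (hdB : ∀ m, ∀ ω ∈ B m, d m ω = 0)
    {z : ℝ → ℝ} (hz : Measurable z) (hz1 : ∀ x, |z x| ≤ 1 + |x|)
    (hscore : ∀ m, ∀ ω ∉ B m, ∑ i ∈ Finset.range m,
      (A i ω - Real.sigmoid ((γ + d m ω).1 + (γ + d m ω).2 * X i ω)) * z (X i ω) = 0) :
    LpOrder P 2 fun m ω => avg (fun i ω => (A i ω - e (X i ω)) * z (X i ω)) m ω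
      - ((∫ ω, e (X 0 ω) * (1 - e (X 0 ω)) * z (X 0 ω) ∂P) * (d m ω).1
      + (∫ ω, e (X 0 ω) * (1 - e (X 0 ω)) * z (X 0 ω) * X 0 ω ∂P) * (d m ω).2) := by
  have me := he.measurable
  have mX := S.measurable_X
  have mA := S.measurable_A
  have Mz : AllMoments P fun ω => z (X 0 ω) := S.one_add_abs_X.of_abs_le (hz.comp (mX 0))
    fun ω => (hz1 _).trans (le_abs_self _)
  have Me : AllMoments P fun ω => e (X 0 ω) := AllMoments.of_bound (me.comp (mX 0)) 1 fun ω => by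
    rw [abs_of_pos (he.pos_and_lt_one _).1]; exact (he.pos_and_lt_one _).2.le
  have Mw : AllMoments P fun ω => e (X 0 ω) * (1 - e (X 0 ω)) :=
    Me.mul ((allMoments_const 1).sub Me)
  have O1 := S.lpOrder_avg_sub (fun y => e y.2.1 * (1 - e y.2.1) * z y.2.1) (by fun_prop)
    (Mw.mul Mz)
  have O2 := S.lpOrder_avg_sub (fun y => e y.2.1 * (1 - e y.2.1) * z y.2.1 * y.2.1) (by fun_prop)
    ((Mw.mul Mz).mul S.moments_X)
  have OS := S.lpOrder_avg (fun y => (y.1 - e y.2.1) * z y.2.1) (by fun_prop)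
    ((S.moments_A.sub Me).mul Mz)
  have OG := S.lpOrder_avg (fun y => (1 + |y.2.1|) ^ 3) (by fun_prop) (S.one_add_abs_X.pow 3)
  simp only at O1 O2 OS OG
  set E₁ := ∫ ω, e (X 0 ω) * (1 - e (X 0 ω)) * z (X 0 ω) ∂P
  set E₂ := ∫ ω, e (X 0 ω) * (1 - e (X 0 ω)) * z (X 0 ω) * X 0 ω ∂P
  have hbound : LpOrder P 2 fun m ω => ((‖d m ω‖ * ‖d m ω‖ * avg (fun i ω => (1 + |X i ω|) ^ 3) m ω
      + ‖d m ω‖ * |avg (fun i ω => e (X i ω) * (1 - e (X i ω)) * z (X i ω)) m ω - E₁|)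
      + ‖d m ω‖ * |avg (fun i ω => e (X i ω) * (1 - e (X i ω)) * z (X i ω) * X i ω) m ω - E₂|)
      + (B m).indicator (1 : Ω → ℝ) ω
        * |avg (fun i ω => (A i ω - e (X i ω)) * z (X i ω)) m ω| :=
    ((((hdO.mul hdO).mul OG).add (hdO.mul O1.abs)).add (hdO.mul O2.abs)).add (hB.mul OS.abs)
  refine hbound.of_le (fun m => ?_) fun m ω => ?_
  · have md := hd m
    exact (measurable_avg (fun i => ((mA i).sub (me.comp (mX i))).mul (hz.comp (mX i))) m).sub
      (by fun_prop)
  by_cases hω : ω ∈ B m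
  · rw [hdB m ω hω, Set.indicator_of_mem hω]
    simp
  rw [Set.indicator_of_notMem hω, zero_mul, add_zero]
  have hs := hscore m ω hω
  set D := d m ω
  -- Off the exceptional event the fitted score is zero and may be subtracted, so the score at `γ`
  -- is minus an increment of the score, expanded in `D`.
  have hsplit : avg (fun i ω => (A i ω - e (X i ω)) * z (X i ω)) m ω - (E₁ * D.1 + E₂ * D.2)
      = (∑ i ∈ Finset.range m, (Real.sigmoid (γ.1 + γ.2 * X i ω + (D.1 + D.2 * X i ω))
          - Real.sigmoid (γ.1 + γ.2 * X i ω) - Real.sigmoid (γ.1 + γ.2 * X i ω)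
            * (1 - Real.sigmoid (γ.1 + γ.2 * X i ω)) * (D.1 + D.2 * X i ω)) * z (X i ω)) / m
        + D.1 * (avg (fun i ω => e (X i ω) * (1 - e (X i ω)) * z (X i ω)) m ω - E₁)
        + D.2 * (avg (fun i ω => e (X i ω) * (1 - e (X i ω)) * z (X i ω) * X i ω) m ω - E₂) := by
    have : ∀ i, (Real.sigmoid (γ.1 + γ.2 * X i ω + (D.1 + D.2 * X i ω))
          - Real.sigmoid (γ.1 + γ.2 * X i ω) - Real.sigmoid (γ.1 + γ.2 * X i ω)
            * (1 - Real.sigmoid (γ.1 + γ.2 * X i ω)) * (D.1 + D.2 * X i ω)) * z (X i ω)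
        = (A i ω - e (X i ω)) * z (X i ω)
          - (A i ω - Real.sigmoid ((γ + D).1 + (γ + D).2 * X i ω)) * z (X i ω)
          - (D.1 * (e (X i ω) * (1 - e (X i ω)) * z (X i ω))
          + D.2 * (e (X i ω) * (1 - e (X i ω)) * z (X i ω) * X i ω)) := by
      intro i
      have : (γ + D).1 + (γ + D).2 * X i ω = γ.1 + γ.2 * X i ω + (D.1 + D.2 * X i ω) := by
        simp only [Prod.fst_add, Prod.snd_add]; ring
      rw [this, he]
      ring
    simp only [this, Finset.sum_add_distrib, Finset.sum_sub_distrib, ← Finset.mul_sum, avg, hs]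
    ring
  rw [hsplit]
  refine (abs_add_le _ _).trans (add_le_add ((abs_add_le _ _).trans (add_le_add ?_ ?_)) ?_)
  · rw [avg, ← mul_div_assoc, abs_div, Nat.abs_cast, Finset.mul_sum]
    gcongr
    refine (Finset.abs_sum_le_sum_abs _ _).trans (Finset.sum_le_sum fun i _ => ?_)
    rw [abs_mul]
    calc _ ≤ (D.1 + D.2 * X i ω) ^ 2 * (1 + |X i ω|) := by
          gcongr
          · exact Real.abs_sigmoid_add_sub_sub_le _ _
          · exact hz1 _
      _ ≤ (‖D‖ * (1 + |X i ω|)) ^ 2 * (1 + |X i ω|) := by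
          rw [← sq_abs (D.1 + D.2 * X i ω)]
          gcongr
          exact abs_add_mul_le _ _
      _ = _ := by ring
  · rw [abs_mul]
    gcongr
    exact norm_fst_le D
  · rw [abs_mul]
    gcongr
    exact norm_snd_le D

end PropensitySample

end LogisticSample

/-! ### Existence and rate of the maximum likelihood estimate. -/

section LogisticEstimator

/-- The least eigenvalue of a positive definite `2 × 2` matrix is at least determinant over trace.
After clearing the denominator the difference is `(a v + b w)² + (b v + c w)²`. -/
lemma det_mul_sq_le {a b c : ℝ} (ha : 0 < a) (hdet : 0 < a * c - b ^ 2) (v w : ℝ) :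
    (a * c - b ^ 2) / (a + c) * (v ^ 2 + w ^ 2) ≤ a * v ^ 2 + 2 * b * (v * w) + c * w ^ 2 := by
  have hc : 0 < c := by
    by_contra h
    nlinarith [sq_nonneg b]
  rw [div_mul_eq_mul_div, div_le_iff₀ (by positivity)]
  nlinarith [sq_nonneg (a * v + b * w), sq_nonneg (b * v + c * w)]

/-- The diagonal perturbations cost at most `l / 4`, and so does the off-diagonal one since `2 |v w|
≤ v² + w²`; half of `l` remains. -/
lemma quadratic_lower_bound_of_near {a b c a' b' c' l : ℝ} (hl : 0 < l)
    (h : ∀ v w : ℝ, l * (v ^ 2 + w ^ 2) ≤ a * v ^ 2 + 2 * b * (v * w) + c * w ^ 2)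
    (ha : |a' - a| < l / 4) (hb : |b' - b| < l / 4) (hc : |c' - c| < l / 4) (v w : ℝ) :
    l / 2 * (v ^ 2 + w ^ 2) ≤ a' * v ^ 2 + 2 * b' * (v * w) + c' * w ^ 2 := by
  have h1 := h v w
  rw [abs_lt] at ha hb hc
  have h2 : (b - b') * (2 * (v * w)) ≤ l / 4 * (v ^ 2 + w ^ 2) := by
    have e1 : |2 * (v * w)| ≤ v ^ 2 + w ^ 2 := by
      rw [abs_le]; constructor <;> nlinarith [sq_nonneg (v + w), sq_nonneg (v - w)]
    have e2 : |b - b'| ≤ l / 4 := by rw [abs_le]; constructor <;> linarith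
    calc _ ≤ |b - b'| * |2 * (v * w)| := by rw [← abs_mul]; exact le_abs_self _
      _ ≤ _ := by gcongr
  nlinarith [mul_nonneg (by linarith : 0 ≤ l / 4 + (a' - a)) (sq_nonneg v),
    mul_nonneg (by linarith : 0 ≤ l / 4 + (c' - c)) (sq_nonneg w)]

variable {Ω : Type*} [MeasurableSpace Ω] {P : Measure Ω}
  {e : ℝ → ℝ} {A X R : ℕ → Ω → ℝ} {γ : ℝ × ℝ} {d : ℕ → Ω → ℝ × ℝ}

lemma LpOrder.indicator_union {a : ℕ} {B C : ℕ → Set Ω}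
    (hB : LpOrder P a fun m => (B m).indicator 1)
    (hC : LpOrder P a fun m => (C m).indicator 1) (hBm : ∀ m, MeasurableSet (B m))
    (hCm : ∀ m, MeasurableSet (C m)) : LpOrder P a fun m => (B m ∪ C m).indicator 1 := by
  refine (hB.add hC).of_le (fun m => measurable_one.indicator ((hBm m).union (hCm m))) fun m ω => ?_
  by_cases h1 : ω ∈ B m <;> by_cases h2 : ω ∈ C m <;> simp [h1, h2]

variable [IsProbabilityMeasure P]

namespace PropensitySample

/-- Weighted second moment matrices of `(1, X)` are positive definite. -/
lemma weighted_moments_det_pos (S : PropensitySample P e A X R) {w : ℝ → ℝ}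
    (hw0 : ∀ x, 0 < w x) (hwm : AllMoments P fun ω => w (X 0 ω)) :
    0 < ∫ ω, w (X 0 ω) ∂P ∧
    0 < (∫ ω, w (X 0 ω) ∂P) * (∫ ω, w (X 0 ω) * X 0 ω ^ 2 ∂P)
      - (∫ ω, w (X 0 ω) * X 0 ω ∂P) ^ 2 := by
  have mX := S.measurable_X 0
  have MX := S.moments_X
  -- The quadratic form is the expectation of `w(X) * (v + u * X) ^ 2`, which vanishes only if `X`
  -- is almost surely constant.
  have hpos : ∀ v u : ℝ, (v ≠ 0 ∨ u ≠ 0) →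
      0 < v ^ 2 * (∫ ω, w (X 0 ω) ∂P) + 2 * v * u * (∫ ω, w (X 0 ω) * X 0 ω ∂P)
        + u ^ 2 * ∫ ω, w (X 0 ω) * X 0 ω ^ 2 ∂P := by
    intro v u hvu
    have M : AllMoments P fun ω => w (X 0 ω) * (v + u * X 0 ω) ^ 2 :=
      hwm.mul (((allMoments_const v).add (MX.const_mul u)).pow 2)
    have hint : ∫ ω, w (X 0 ω) * (v + u * X 0 ω) ^ 2 ∂P
        = v ^ 2 * (∫ ω, w (X 0 ω) ∂P) + 2 * v * u * (∫ ω, w (X 0 ω) * X 0 ω ∂P)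
        + u ^ 2 * ∫ ω, w (X 0 ω) * X 0 ω ^ 2 ∂P := by
      have i1 := (hwm.const_mul (v ^ 2)).integrable
      have i2 := ((hwm.mul MX).const_mul (2 * v * u)).integrable
      have i3 := ((hwm.mul (MX.pow 2)).const_mul (u ^ 2)).integrable
      have h1 := integral_add (i1.add i2) i3
      have h2 := integral_add i1 i2
      simp only [Pi.add_apply, integral_const_mul] at h1 h2
      rw [← h2, ← h1]
      congr 1
      ext ω
      ring
    rw [← hint]
    have hnn : ∀ ω, 0 ≤ w (X 0 ω) * (v + u * X 0 ω) ^ 2 := fun ω =>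
      mul_nonneg (hw0 _).le (sq_nonneg _)
    refine (integral_nonneg hnn).lt_of_ne fun h => ?_
    have hae := (integral_eq_zero_iff_of_nonneg hnn M.integrable).1 h.symm
    have hfalse : ∀ᵐ ω ∂P, False := by
      filter_upwards [hae, S.X_ne (-v / u)] with ω h1 h2
      have h3 : v + u * X 0 ω = 0 := by
        simpa [(hw0 (X 0 ω)).ne'] using h1
      by_cases hu : u = 0
      · rw [hu, zero_mul, add_zero] at h3
        exact hvu.elim (fun h => h h3) fun h => h hu
      · apply h2
        field_simp
        linarith
    simp at hfalse
    exact NeZero.ne P hfalse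
  have h1 := hpos 1 0 (Or.inl one_ne_zero)
  norm_num at h1
  refine ⟨h1, ?_⟩
  -- At the vector `(-b, a)` the form takes the value `a * (a * c - b ^ 2)`.
  have h2 := hpos (-∫ ω, w (X 0 ω) * X 0 ω ∂P) (∫ ω, w (X 0 ω) ∂P) (Or.inr h1.ne')
  set a := ∫ ω, w (X 0 ω) ∂P
  set b := ∫ ω, w (X 0 ω) * X 0 ω ∂P
  set c := ∫ ω, w (X 0 ω) * X 0 ω ^ 2 ∂P
  have h3 : 0 < a * (a * c - b ^ 2) := by
    convert h2 using 1
    ring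
  exact (mul_pos_iff_of_pos_left h1).1 h3

/-- The maximum likelihood estimator of the logistic regression coefficients, modified on events
with probability of every order, and centered at the true value. -/
lemma exists_mle_deviation (S : PropensitySample P e A X R) (he : IsLogisticWith e γ)
    {g : (m : ℕ) → (Fin m → ℝ) → (Fin m → ℝ) → ℝ × ℝ} (hg : IsLogisticMLE g) :
    ∃ (d : ℕ → Ω → ℝ × ℝ) (B : ℕ → Set Ω), (∀ m, Measurable (d m)) ∧
      (LpOrder P 1 fun m ω => ‖d m ω‖) ∧ (∀ m ω, ‖d m ω‖ ≤ 1) ∧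
      (∀ a, LpOrder P a fun m => (B m).indicator 1) ∧ (∀ m, ∀ ω ∈ B m, d m ω = 0) ∧
      ∀ m, ∀ ω ∉ B m, g m (fun i => A i ω) (fun i => X i ω) = γ + d m ω ∧
        (∑ i ∈ Finset.range m,
          (A i ω - Real.sigmoid ((γ + d m ω).1 + (γ + d m ω).2 * X i ω)) = 0) ∧
        ∑ i ∈ Finset.range m,
          (A i ω - Real.sigmoid ((γ + d m ω).1 + (γ + d m ω).2 * X i ω)) * X i ω = 0 := by
  have me := he.measurable
  have mX := S.measurable_X
  have mA := S.measurable_A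
  have MX := S.moments_X
  have Me : AllMoments P fun ω => e (X 0 ω) := AllMoments.of_bound (me.comp (mX 0)) 1 fun ω => by
    rw [abs_of_pos (he.pos_and_lt_one _).1]; exact (he.pos_and_lt_one _).2.le
  set k : ℝ → ℝ := fun x => e x * (1 - e x) / (2 * (1 + |x|)) with hk
  have hkm : Measurable k := by fun_prop
  have hk0 : ∀ x, 0 < k x := fun x => by
    have h1 := (he.pos_and_lt_one x).1
    have h2 : 0 < 1 - e x := by linarith [(he.pos_and_lt_one x).2]
    positivity
  have Mk : AllMoments P fun ω => k (X 0 ω) := AllMoments.of_bound (hkm.comp (mX 0)) 1 fun ω => by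
    rw [abs_of_pos (hk0 _), hk]
    have h1 := (he.pos_and_lt_one (X 0 ω)).1
    have h2 := (he.pos_and_lt_one (X 0 ω)).2
    simp only
    rw [div_le_one (by positivity)]
    nlinarith [abs_nonneg (X 0 ω)]
  obtain ⟨ha, hdet⟩ := S.weighted_moments_det_pos hk0 Mk
  have O0 := S.lpOrder_avg_sub (fun y => k y.2.1) (by fun_prop) Mk
  have O1 := S.lpOrder_avg_sub (fun y => k y.2.1 * y.2.1) (by fun_prop) (Mk.mul MX)
  have O2 := S.lpOrder_avg_sub (fun y => k y.2.1 * y.2.1 ^ 2) (by fun_prop) (Mk.mul (MX.pow 2))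
  have OS₁ := S.lpOrder_avg_sub (fun y => y.1 - e y.2.1) (by fun_prop) (S.moments_A.sub Me)
  have OS₂ := S.lpOrder_avg_sub (fun y => (y.1 - e y.2.1) * y.2.1) (by fun_prop)
    ((S.moments_A.sub Me).mul MX)
  have IS₁ : ∫ ω, (A 0 ω - e (X 0 ω)) ∂P = 0 := by
    have := S.propensity (fun _ => 1) measurable_const (allMoments_const 1)
    simp only [mul_one] at this
    rw [integral_sub S.moments_A.integrable Me.integrable, this, sub_self]
  have IS₂ : ∫ ω, (A 0 ω - e (X 0 ω)) * X 0 ω ∂P = 0 := by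
    have := S.propensity (fun x => x) measurable_id MX
    simp only [sub_mul]
    rw [integral_sub (S.moments_A.mul MX).integrable (Me.mul MX).integrable, this, sub_self]
  simp only [IS₁, IS₂, sub_zero] at O0 O1 O2 OS₁ OS₂
  set K₀ := ∫ ω, k (X 0 ω) ∂P
  set K₁ := ∫ ω, k (X 0 ω) * X 0 ω ∂P
  set K₂ := ∫ ω, k (X 0 ω) * X 0 ω ^ 2 ∂P
  set l := (K₀ * K₂ - K₁ ^ 2) / (K₀ + K₂) with hl
  have hquad := det_mul_sq_le ha hdet
  rw [← hl] at hquad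
  have hl0 : 0 < l := by
    have hK₂ : 0 < K₂ := by
      by_contra h
      nlinarith [sq_nonneg K₁]
    positivity
  -- This puts `m = 0` into the exceptional event: an empty mean misses `K₀` by more than `l / 4`.
  have hlK : l ≤ K₀ := by simpa using hquad 1 0
  set k₀ := avg fun i ω => k (X i ω) with hk₀
  set k₁ := avg fun i ω => k (X i ω) * X i ω with hk₁
  set k₂ := avg fun i ω => k (X i ω) * X i ω ^ 2 with hk₂
  set s₁ := avg fun i ω => A i ω - e (X i ω) with hs₁
  set s₂ := avg fun i ω => (A i ω - e (X i ω)) * X i ω with hs₂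
  have big : ∀ {f : ℕ → Ω → ℝ} {δ : ℝ}, LpOrder P 1 f → 0 < δ →
      (∀ a, LpOrder P a fun m => {ω | δ ≤ |f m ω|}.indicator 1) ∧
        ∀ m, MeasurableSet {ω | δ ≤ |f m ω|} := fun {f δ} hf hδ => by
    have hm : ∀ m, MeasurableSet {ω | δ ≤ |f m ω|} := fun m =>
      measurableSet_le measurable_const (hf.measurable m).norm
    exact ⟨hf.indicator hδ hm fun m ω h => h, hm⟩
  obtain ⟨b0, m0⟩ := big O0 (show 0 < l / 4 by positivity)
  obtain ⟨b1, m1⟩ := big O1 (show 0 < l / 4 by positivity)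
  obtain ⟨b2, m2⟩ := big O2 (show 0 < l / 4 by positivity)
  obtain ⟨b3, m3⟩ := big OS₁ (show 0 < l / 8 by positivity)
  obtain ⟨b4, m4⟩ := big OS₂ (show 0 < l / 8 by positivity)
  -- Off `B` the empirical curvature keeps at least `l / 2` per unit, so `logistic_mle_near` applies
  -- with `κ = m * l / 2`. The bounds `l / 8` put the total score below `m * l / 4 = κ / 2`, and the
  -- error bound has constant `2 / (l / 2) = 4 / l`.
  set B : ℕ → Set Ω := fun m => {ω | l / 4 ≤ |k₀ m ω - K₀|} ∪ {ω | l / 4 ≤ |k₁ m ω - K₁|}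
    ∪ {ω | l / 4 ≤ |k₂ m ω - K₂|} ∪ {ω | l / 8 ≤ |s₁ m ω|} ∪ {ω | l / 8 ≤ |s₂ m ω|} with hB
  have hBm : ∀ m, MeasurableSet (B m) := fun m =>
    ((((m0 m).union (m1 m)).union (m2 m)).union (m3 m)).union (m4 m)
  have hBO : ∀ a, LpOrder P a fun m => (B m).indicator 1 := fun a =>
    ((((b0 a).indicator_union (b1 a) m0 m1).indicator_union (b2 a)
      (fun m => (m0 m).union (m1 m)) m2).indicator_union (b3 a)
      (fun m => ((m0 m).union (m1 m)).union (m2 m)) m3).indicator_union (b4 a)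
      (fun m => (((m0 m).union (m1 m)).union (m2 m)).union (m3 m)) m4
  have hgood : ∀ m, ∀ ω ∉ B m,
      IsMaxOn (logisticLogLik (fun i : Fin m => A i ω) (fun i => X i ω)) Set.univ
        (g m (fun i => A i ω) (fun i => X i ω)) ∧
      ‖g m (fun i => A i ω) (fun i => X i ω) - γ‖ ≤ 1 ∧
      ‖g m (fun i => A i ω) (fun i => X i ω) - γ‖ ≤ 4 / l * (|s₁ m ω| + |s₂ m ω|) := by
    intro m ω hω
    simp only [hB, Set.mem_union, Set.mem_ofPred_eq, not_or, not_le] at hω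
    obtain ⟨⟨⟨⟨g0, g1⟩, g2⟩, g3⟩, g4⟩ := hω
    have hm : (0 : ℝ) < m := by
      rcases Nat.eq_zero_or_pos m with rfl | hm
      · simp only [hk₀, avg, Finset.range_zero, Finset.sum_empty, CharP.cast_eq_zero, div_zero,
          zero_sub, abs_neg, abs_of_pos ha] at g0
        linarith
      · exact_mod_cast hm
    have hsc1 : (logisticScore (fun i : Fin m => A i ω) (fun i => X i ω) γ).1 = m * s₁ m ω := by
      simp only [logisticScore, ← he _]
      rw [Fin.sum_univ_eq_sum_range (fun i => A i ω - e (X i ω)) m, hs₁, avg]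
      field_simp
    have hsc2 : (logisticScore (fun i : Fin m => A i ω) (fun i => X i ω) γ).2 = m * s₂ m ω := by
      simp only [logisticScore, ← he _]
      rw [Fin.sum_univ_eq_sum_range (fun i => (A i ω - e (X i ω)) * X i ω) m, hs₂, avg]
      field_simp
    have hcurv : ∀ v : ℝ × ℝ, (m * (l / 2)) * ‖v‖ ^ 2 ≤ ∑ i : Fin m,
        Real.sigmoid (γ.1 + γ.2 * X i ω) * (1 - Real.sigmoid (γ.1 + γ.2 * X i ω))
          / (2 * (1 + |X i ω|)) * (v.1 + v.2 * X i ω) ^ 2 := by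
      intro v
      have h1 := quadratic_lower_bound_of_near hl0 hquad g0 g1 g2 v.1 v.2
      have h2 : ‖v‖ ^ 2 ≤ v.1 ^ 2 + v.2 ^ 2 := by
        rw [Prod.norm_def, Real.norm_eq_abs, Real.norm_eq_abs]
        rcases max_cases |v.1| |v.2| with h | h <;> rw [h.1, sq_abs]
        · exact le_add_of_nonneg_right (sq_nonneg _)
        · exact le_add_of_nonneg_left (sq_nonneg _)
      have h3 : ∑ i : Fin m, Real.sigmoid (γ.1 + γ.2 * X i ω)
          * (1 - Real.sigmoid (γ.1 + γ.2 * X i ω)) / (2 * (1 + |X i ω|)) * (v.1 + v.2 * X i ω) ^ 2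
          = m * (k₀ m ω * v.1 ^ 2 + 2 * k₁ m ω * (v.1 * v.2) + k₂ m ω * v.2 ^ 2) := by
        rw [Fin.sum_univ_eq_sum_range (fun i => Real.sigmoid (γ.1 + γ.2 * X i ω)
          * (1 - Real.sigmoid (γ.1 + γ.2 * X i ω)) / (2 * (1 + |X i ω|))
          * (v.1 + v.2 * X i ω) ^ 2) m]
        have : ∀ i, Real.sigmoid (γ.1 + γ.2 * X i ω)
          * (1 - Real.sigmoid (γ.1 + γ.2 * X i ω)) / (2 * (1 + |X i ω|))
          * (v.1 + v.2 * X i ω) ^ 2 = v.1 ^ 2 * k (X i ω) + 2 * (v.1 * v.2) * (k (X i ω) * X i ω)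
            + v.2 ^ 2 * (k (X i ω) * X i ω ^ 2) := by
          intro i
          simp only [hk, ← he _]
          ring
        simp only [this, Finset.sum_add_distrib, ← Finset.mul_sum, hk₀, hk₁, hk₂, avg]
        field_simp
      rw [h3, mul_assoc]
      gcongr
      exact le_trans (by gcongr) h1
    obtain ⟨hex, hnear⟩ := logistic_mle_near (a := fun i : Fin m => A i ω) (x := fun i => X i ω)
      (fun i => S.binary i ω) γ hcurv (by
        rw [hsc1, hsc2, abs_mul, abs_mul, Nat.abs_cast, ← mul_add, mul_div_assoc]
        gcongr
        linarith)
    have hmax := (hg m).2 _ _ (fun i : Fin m => S.binary i ω) hex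
    obtain ⟨n1, n2⟩ := hnear _ hmax
    refine ⟨hmax, n1, ?_⟩
    rw [hsc1, hsc2, abs_mul, abs_mul, Nat.abs_cast, ← mul_add, mul_assoc, mul_left_comm 2] at n2
    have n3 := le_of_mul_le_mul_left n2 hm
    rw [div_mul_eq_mul_div, le_div_iff₀ hl0]
    linarith
  classical
  -- Setting the deviation to zero on `B` discards the samples where the fit may be arbitrary, and
  -- makes the norm at most `1` everywhere.
  set d : ℕ → Ω → ℝ × ℝ := fun m ω =>
    if ω ∈ B m then 0 else g m (fun i => A i ω) (fun i => X i ω) - γ with hd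
  have hdm : ∀ m, Measurable (d m) := fun m => by
    refine Measurable.ite (hBm m) measurable_const (Measurable.sub_const ?_ γ)
    have hAX : Measurable fun ω => ((fun i : Fin m => A i ω), fun i : Fin m => X i ω) :=
      (measurable_pi_lambda _ fun i : Fin m => mA i).prodMk
        (measurable_pi_lambda _ fun i : Fin m => mX i)
    exact (hg m).1.comp hAX
  have hdpos : ∀ m, ∀ ω ∈ B m, d m ω = 0 := fun m ω h => if_pos h
  have hdneg : ∀ m, ∀ ω ∉ B m, d m ω = g m (fun i => A i ω) (fun i => X i ω) - γ :=
    fun m ω h => if_neg h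
  refine ⟨d, B, hdm, ?_, fun m ω => ?_, hBO, hdpos, fun m ω hω => ?_⟩
  · refine ((OS₁.abs.add OS₂.abs).const_mul (4 / l)).of_le (fun m => (hdm m).norm) fun m ω => ?_
    rw [abs_norm]
    by_cases hω : ω ∈ B m
    · rw [hdpos m ω hω, norm_zero]
      positivity
    · rw [hdneg m ω hω]
      exact (hgood m ω hω).2.2
  · by_cases hω : ω ∈ B m
    · rw [hdpos m ω hω, norm_zero]
      exact zero_le_one
    · rw [hdneg m ω hω]
      exact (hgood m ω hω).2.1
  · have hsc := logisticScore_eq_zero_of_isMaxOn (hgood m ω hω).1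
    rw [hdneg m ω hω, add_sub_cancel]
    set G := g m (fun i => A i ω) (fun i => X i ω)
    refine ⟨rfl, ?_, ?_⟩
    · rw [← Fin.sum_univ_eq_sum_range (fun i => A i ω - Real.sigmoid (G.1 + G.2 * X i ω)) m]
      exact congrArg Prod.fst hsc
    · rw [← Fin.sum_univ_eq_sum_range
        (fun i => (A i ω - Real.sigmoid (G.1 + G.2 * X i ω)) * X i ω) m]
      exact congrArg Prod.snd hsc

end PropensitySample

end LogisticEstimator

/-! ### Asymptotic linearity with a logistic fit. -/

section LogisticLinearization

variable {Ω : Type*} [MeasurableSpace Ω] {P : Measure Ω} [IsProbabilityMeasure P]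
  {e : ℝ → ℝ} {A X R : ℕ → Ω → ℝ} {γ : ℝ × ℝ}

/-- The estimator with a propensity score fitted by logistic regression. -/
theorem PropensitySample.asymptoticallyLinear_logistic (S : PropensitySample P e A X R)
    (he : IsLogisticWith e γ) {g : (m : ℕ) → (Fin m → ℝ) → (Fin m → ℝ) → ℝ × ℝ}
    (hg : IsLogisticMLE g) {Y : ℕ → Ω → ℝ} {b τ : ℝ}
    (hY : ∀ i ω, Y i ω = b + τ * A i ω + R i ω)
    (hT : ∀ m, Measurable (ipwEstimator
      (fun m a x t => Real.sigmoid ((g m a x).1 + (g m a x).2 * t)) A X Y m)) :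
    AsymptoticallyLinear P (ipwEstimator
      (fun m a x t => Real.sigmoid ((g m a x).1 + (g m a x).2 * t)) A X Y) τ := by
  have me := he.measurable
  have he0 := he.pos_and_lt_one
  have mX := S.measurable_X
  have MA := S.moments_A
  have MX := S.moments_X
  have F := S.flip me he0
  have he0' : ∀ x, 0 < 1 - e x ∧ 1 - e x < 1 := fun x =>
    ⟨by linarith [(he0 x).2], by linarith [(he0 x).1]⟩
  have M1 := S.moments_inv he
  have M0 := F.moments_inv he.flip
  have Me : AllMoments P fun ω => e (X 0 ω) := AllMoments.of_bound (me.comp (mX 0)) 1 fun ω => by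
    rw [abs_of_pos (he0 _).1]; exact (he0 _).2.le
  have Mw : AllMoments P fun ω => e (X 0 ω) * (1 - e (X 0 ω)) :=
    Me.mul ((allMoments_const 1).sub Me)
  have MAe := MA.sub Me
  obtain ⟨d, B, hd, hdO, hd1, hBO, hdB, hgood⟩ := S.exists_mle_deviation he hg
  -- The untreated arm is the treated arm of the flipped sample, whose logistic parameter is `-γ`
  -- with deviation `-d`.
  have hd' : ∀ m, Measurable fun ω => -d m ω := fun m => (hd m).neg
  have hdO' : LpOrder P 1 fun m ω => ‖-d m ω‖ := by simpa only [norm_neg] using hdO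
  have hd1' : ∀ m ω, ‖-d m ω‖ ≤ 1 := fun m ω => by simpa only [norm_neg] using hd1 m ω
  have Od1 := LpOrder.fst_of_norm hd hdO
  have Od2 := LpOrder.snd_of_norm hd hdO
  have XN1 := S.lpOrder_weighted_expansion he hd hdO hd1 (fun z => z.1 * z.2.2) (by fun_prop)
    (MA.mul S.moments_R)
  have XD1 := S.lpOrder_weighted_expansion he hd hdO hd1 (fun z => z.1) (by fun_prop) MA
  have XN0 := F.lpOrder_weighted_expansion he.flip hd' hdO' hd1' (fun z => z.1 * z.2.2)
    (by fun_prop) (F.moments_A.mul S.moments_R)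
  have XD0 := F.lpOrder_weighted_expansion he.flip hd' hdO' hd1' (fun z => z.1) (by fun_prop)
    F.moments_A
  have AN1 := S.lpOrder_avg_sub (fun z => z.1 * z.2.2 * (e z.2.1)⁻¹) (by fun_prop)
    ((MA.mul S.moments_R).mul M1)
  have AN0 := F.lpOrder_avg_sub (fun z => z.1 * z.2.2 * (1 - e z.2.1)⁻¹) (by fun_prop)
    ((F.moments_A.mul S.moments_R).mul M0)
  have AD1 := S.lpOrder_avg_sub (fun z => z.1 * (e z.2.1)⁻¹) (by fun_prop) (MA.mul M1)
  have AD0 := F.lpOrder_avg_sub (fun z => z.1 * (1 - e z.2.1)⁻¹) (by fun_prop)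
    (F.moments_A.mul M0)
  have I1 : ∫ ω, A 0 ω * R 0 ω * (e (X 0 ω))⁻¹ ∂P = 0 := by
    rw [← S.integral_treated_residual me he0 M1]
    congr 1; ext ω; ring
  have I0 : ∫ ω, (1 - A 0 ω) * R 0 ω * (1 - e (X 0 ω))⁻¹ ∂P = 0 := by
    rw [← F.integral_treated_residual (me.const_sub 1) he0' M0]
    congr 1; ext ω; ring
  have J1 := S.integral_treated me he0 M1
  have J0 := F.integral_treated (me.const_sub 1) he0' M0
  have hneg : ∀ m ω x, Real.sigmoid ((-γ + -d m ω).1 + (-γ + -d m ω).2 * x)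
      = 1 - Real.sigmoid ((γ + d m ω).1 + (γ + d m ω).2 * x) := fun m ω x => by
    rw [← Real.sigmoid_neg, ← neg_add]
    congr 1
    simp only [Prod.fst_neg, Prod.snd_neg]
    ring
  simp only [I1, I0, J1, J0, sub_zero, hneg, Prod.fst_neg, Prod.snd_neg]
    at XN1 XD1 XN0 XD0 AN1 AN0 AD1 AD0
  set eHat : ℕ → Ω → ℝ → ℝ := fun m ω x =>
    Real.sigmoid ((γ + d m ω).1 + (γ + d m ω).2 * x) with heHat
  set a₁ := avg fun i ω => A i ω * R i ω * (e (X i ω))⁻¹ with ha₁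
  set a₀ := avg fun i ω => (1 - A i ω) * R i ω * (1 - e (X i ω))⁻¹ with ha₀
  set N₁ : ℕ → Ω → ℝ := fun m ω =>
    (∑ i ∈ Finset.range m, A i ω * R i ω / eHat m ω (X i ω)) / m with hN₁
  set N₀ : ℕ → Ω → ℝ := fun m ω =>
    (∑ i ∈ Finset.range m, (1 - A i ω) * R i ω / (1 - eHat m ω (X i ω))) / m with hN₀
  obtain ⟨E₁, E₂, XN1⟩ : ∃ E₁ E₂ : ℝ, LpOrder P 2 fun m ω =>
      N₁ m ω - a₁ m ω + (E₁ * (d m ω).1 + E₂ * (d m ω).2) := ⟨_, _, XN1⟩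
  obtain ⟨F₁, F₂, XN0⟩ : ∃ F₁ F₂ : ℝ, LpOrder P 2 fun m ω =>
      N₀ m ω - a₀ m ω + (F₁ * -(d m ω).1 + F₂ * -(d m ω).2) := ⟨_, _, XN0⟩
  obtain ⟨G₁, G₂, XD1⟩ : ∃ G₁ G₂ : ℝ, LpOrder P 2 fun m ω =>
      (∑ i ∈ Finset.range m, A i ω / eHat m ω (X i ω)) / m
        - avg (fun i ω => A i ω * (e (X i ω))⁻¹) m ω + (G₁ * (d m ω).1 + G₂ * (d m ω).2) :=
    ⟨_, _, XD1⟩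
  obtain ⟨K₁, K₂, XD0⟩ : ∃ K₁ K₂ : ℝ, LpOrder P 2 fun m ω =>
      (∑ i ∈ Finset.range m, (1 - A i ω) / (1 - eHat m ω (X i ω))) / m
        - avg (fun i ω => (1 - A i ω) * (1 - e (X i ω))⁻¹) m ω
        + (K₁ * -(d m ω).1 + K₂ * -(d m ω).2) := ⟨_, _, XD0⟩
  have ON1 : LpOrder P 1 N₁ := by
    convert ((XN1.mono (b := 1) (by norm_num)).add AN1).sub
      ((Od1.const_mul E₁).add (Od2.const_mul E₂)) using 3 with m ω
    ring
  have ON0 : LpOrder P 1 N₀ := by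
    convert ((XN0.mono (b := 1) (by norm_num)).add AN0).sub
      ((Od1.neg.const_mul F₁).add (Od2.neg.const_mul F₂)) using 3 with m ω
    ring
  have OD1 : LpOrder P 1 fun m ω => (∑ i ∈ Finset.range m, A i ω / eHat m ω (X i ω)) / m - 1 := by
    convert ((XD1.mono (b := 1) (by norm_num)).add AD1).sub
      ((Od1.const_mul G₁).add (Od2.const_mul G₂)) using 3 with m ω
    ring
  have OD0 : LpOrder P 1 fun m ω =>
      (∑ i ∈ Finset.range m, (1 - A i ω) / (1 - eHat m ω (X i ω))) / m - 1 := by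
    convert ((XD0.mono (b := 1) (by norm_num)).add AD0).sub
      ((Od1.neg.const_mul K₁).add (Od2.neg.const_mul K₂)) using 3 with m ω
    ring
  have hYO : LpOrder P 0 (avg fun i ω => |Y i ω|) := by
    have := S.lpOrder_avg (fun z => |b + τ * z.1 + z.2.2|) (by fun_prop)
      (((allMoments_const b).add (MA.const_mul τ)).add S.moments_R).abs
    simpa only [← hY] using this
  have key := lpOrder_ipwEstimator_sub (eHat := eHat) (B := B) hT S.binary hY hYO
    (fun _ _ x => ⟨(Real.sigmoid_pos _).le, (Real.sigmoid_lt_one _).le⟩) hBO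
    (fun m ω hω => by
      have := (hgood m ω hω).1
      ext x
      simp only [this, heHat])
    (fun _ _ => rfl) (fun _ _ => rfl) (fun _ _ => rfl) (fun _ _ => rfl) ON1 ON0 OD1 OD0
  have XS1 := S.lpOrder_score_expansion he hd hdO (hBO 2) hdB (z := fun _ => 1) measurable_const
    (fun x => by simp) fun m ω hω => by simpa using (hgood m ω hω).2.1
  have XS2 := S.lpOrder_score_expansion he hd hdO (hBO 2) hdB (z := fun x => x) measurable_id
    (fun x => by simp) fun m ω hω => (hgood m ω hω).2.2
  obtain ⟨hH₀, hdet⟩ := S.weighted_moments_det_pos (w := fun x => e x * (1 - e x))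
    (fun x => mul_pos (he0 x).1 (he0' x).1) Mw
  have hsq : ∀ ω, e (X 0 ω) * (1 - e (X 0 ω)) * X 0 ω * X 0 ω
      = e (X 0 ω) * (1 - e (X 0 ω)) * X 0 ω ^ 2 := fun ω => by ring
  simp only [mul_one, hsq] at XS1 XS2
  set H₀ := ∫ ω, e (X 0 ω) * (1 - e (X 0 ω)) ∂P
  set H₁ := ∫ ω, e (X 0 ω) * (1 - e (X 0 ω)) * X 0 ω ∂P
  set H₂ := ∫ ω, e (X 0 ω) * (1 - e (X 0 ω)) * X 0 ω ^ 2 ∂P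
  -- Cramer's rule for `H c = -(E + F)`, with `H` the Fisher information. The numerators contribute
  -- `-(E + F) · d = c · H d`, and `H d` is the mean score up to order `2`; this is the source of
  -- the term `(A - e(X)) * (c₁ + c₂ * X)` in the influence function.
  set c₁ := (-(E₁ + F₁) * H₂ + (E₂ + F₂) * H₁) / (H₀ * H₂ - H₁ ^ 2) with hc₁
  set c₂ := (-(E₂ + F₂) * H₀ + (E₁ + F₁) * H₁) / (H₀ * H₂ - H₁ ^ 2) with hc₂
  have hcE : c₁ * H₀ + c₂ * H₁ = -(E₁ + F₁) := by
    rw [hc₁, hc₂, div_mul_eq_mul_div, div_mul_eq_mul_div, ← add_div, div_eq_iff hdet.ne']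
    ring
  have hcF : c₁ * H₁ + c₂ * H₂ = -(E₂ + F₂) := by
    rw [hc₁, hc₂, div_mul_eq_mul_div, div_mul_eq_mul_div, ← add_div, div_eq_iff hdet.ne']
    ring
  have Mψ₁ : AllMoments P fun ω => A 0 ω * R 0 ω * (e (X 0 ω))⁻¹ := (MA.mul S.moments_R).mul M1
  have Mψ₀ : AllMoments P fun ω => (1 - A 0 ω) * R 0 ω * (1 - e (X 0 ω))⁻¹ :=
    (F.moments_A.mul S.moments_R).mul M0
  have Mc : AllMoments P fun ω => c₁ + c₂ * X 0 ω := (allMoments_const c₁).add (MX.const_mul c₂)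
  have Mψc : AllMoments P fun ω => (A 0 ω - e (X 0 ω)) * (c₁ + c₂ * X 0 ω) := MAe.mul Mc
  refine S.asymptoticallyLinear (w := fun z => z.1 * (e z.2)⁻¹ - (1 - z.1) * (1 - e z.2)⁻¹)
    (v := fun z => (z.1 - e z.2) * (c₁ + c₂ * z.2)) (by fun_prop) (by fun_prop) ?_ ?_ ?_ ?_
  · intro ω
    rcases S.binary 0 ω with h | h
    · simpa [h] using (he0' _).1.ne'
    · simpa [h] using (he0 _).1.ne'
  · convert (Mψ₁.sub Mψ₀).add Mψc using 2 with ω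
    ring
  · calc _ = ∫ ω, ((A 0 ω * R 0 ω * (e (X 0 ω))⁻¹ - (1 - A 0 ω) * R 0 ω * (1 - e (X 0 ω))⁻¹)
          + (A 0 ω - e (X 0 ω)) * (c₁ + c₂ * X 0 ω)) ∂P := by congr 1; ext ω; ring
      _ = 0 := by
        rw [integral_add (Mψ₁.sub Mψ₀).integrable Mψc.integrable,
          integral_sub Mψ₁.integrable Mψ₀.integrable, I1, I0]
        simp only [sub_mul]
        rw [integral_sub (MA.mul Mc).integrable (Me.mul Mc).integrable,
          S.propensity (fun x => c₁ + c₂ * x) (by fun_prop) Mc]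
        ring
  · have hψ : ∀ m ω, avg (fun i ω => (A i ω * (e (X i ω))⁻¹
          - (1 - A i ω) * (1 - e (X i ω))⁻¹) * R i ω
          + (A i ω - e (X i ω)) * (c₁ + c₂ * X i ω)) m ω
        = a₁ m ω - a₀ m ω + (c₁ * avg (fun i ω => A i ω - e (X i ω)) m ω
          + c₂ * avg (fun i ω => (A i ω - e (X i ω)) * X i ω) m ω) := fun m ω => by
      rw [ha₁, ha₀, ← avg_sub, ← avg_const_mul, ← avg_const_mul, ← avg_add, ← avg_add]
      refine congrArg (fun f => avg f m ω) ?_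
      ext i ω
      ring
    convert ((key.add XN1).sub XN0).sub ((XS1.const_mul c₁).add (XS2.const_mul c₂)) using 3 with m ω
    rw [hψ]
    linear_combination (-(d m ω).1) * hcE - (d m ω).2 * hcF

end LogisticLinearization

/-- The estimator with the sample proportion as propensity score is the one with any constant
propensity score, since the weights are normalized. -/
lemma ipwEstimator_proportion {Ω : Type*} {A X Y : ℕ → Ω → ℝ}
    (hA : ∀ i ω, A i ω = 0 ∨ A i ω = 1) {p : ℝ} (hp : 0 < p) (hp' : p < 1) :
    ipwEstimator (fun m a _ _ => (∑ i, a i) / (m : ℝ)) A X Y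
      = ipwEstimator (fun _ _ _ _ => p) A X Y := by
  have key : ∀ (m : ℕ) (a y : Fin m → ℝ), (∀ i, 0 ≤ a i) → ∀ q q' : ℝ, q = (∑ i, a i) / m →
      q' ≠ 0 → (∑ i, a i * y i / q) / (∑ i, a i / q)
        = (∑ i, a i * y i / q') / (∑ i, a i / q') := by
    intro m a y ha q q' hq hq'
    simp only [← Finset.sum_div]
    -- In an empty arm the fitted weight may divide by zero, but both ratios have denominator `0`
    -- and hence value `0`.
    rcases eq_or_ne (∑ i, a i) 0 with h | h
    · simp [h]
    · have hm : (m : ℝ) ≠ 0 := by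
        rintro hm
        obtain rfl : m = 0 := by exact_mod_cast hm
        simp at h
      have hq0 : q ≠ 0 := by rw [hq]; exact div_ne_zero h hm
      rw [div_div_div_cancel_right₀ hq0, div_div_div_cancel_right₀ hq']
  ext m ω
  rcases Nat.eq_zero_or_pos m with rfl | hm
  · simp [ipwEstimator, ipw]
  have hm' : (m : ℝ) ≠ 0 := by positivity
  unfold ipwEstimator ipw
  rw [key m (fun i => A i ω) (fun i => Y i ω)
      (fun i => by rcases hA i ω with h | h <;> simp [h]) _ p rfl hp.ne',
    key m (fun i => 1 - A i ω) (fun i => Y i ω)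
      (fun i => by rcases hA i ω with h | h <;> simp [h]) _ (1 - p) ?_ (sub_pos.2 hp').ne']
  simp [Finset.sum_sub_distrib, sub_div, div_self hm']

/-! ### All admissible propensity rules together. -/

section Rules

variable {Ω : Type*} [MeasurableSpace Ω] {P : Measure Ω} {e : ℝ → ℝ} {r : PropensityRule}

lemma IsPropensityRule.measurable (hr : IsPropensityRule e r) (he : Measurable e) (m : ℕ) :
    Measurable fun d : (Fin m → ℝ) × (Fin m → ℝ) × ℝ => r m d.1 d.2.1 d.2.2 := by
  cases hr with
  | known => exact he.comp (measurable_snd.comp measurable_snd)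
  | proportion p hp => fun_prop
  | logistic γ hγ g hg =>
    have h : Measurable fun d : (Fin m → ℝ) × (Fin m → ℝ) × ℝ => g m d.1 d.2.1 :=
      (hg m).1.comp (measurable_fst.prodMk (measurable_fst.comp measurable_snd))
    exact continuous_sigmoid.measurable.comp
      (h.fst.add (h.snd.mul (measurable_snd.comp measurable_snd)))

lemma measurable_ipwEstimator
    (hr : ∀ m, Measurable fun d : (Fin m → ℝ) × (Fin m → ℝ) × ℝ => r m d.1 d.2.1 d.2.2)
    {A X Y : ℕ → Ω → ℝ} (hA : ∀ i, Measurable (A i)) (hX : ∀ i, Measurable (X i))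
    (hY : ∀ i, Measurable (Y i)) (m : ℕ) : Measurable (ipwEstimator r A X Y m) := by
  have h : ∀ i : Fin m, Measurable fun ω =>
      r m (fun i => A i ω) (fun i => X i ω) (X i ω) := fun i =>
    (hr m).comp ((measurable_pi_lambda _ fun i : Fin m => hA i).prodMk
      ((measurable_pi_lambda _ fun i : Fin m => hX i).prodMk (hX i)))
  unfold ipwEstimator ipw
  fun_prop

lemma HasOverlap.pos_and_lt_one (he : HasOverlap e) (x : ℝ) : 0 < e x ∧ e x < 1 := by
  rcases he with ⟨c, hc, h⟩ | ⟨γ, h⟩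
  · exact ⟨hc.trans_le (h x).1, by linarith [(h x).2]⟩
  · exact h.pos_and_lt_one x

lemma HasOverlap.flip (he : HasOverlap e) : HasOverlap fun x => 1 - e x := by
  rcases he with ⟨c, hc, h⟩ | ⟨γ, h⟩
  · exact .inl ⟨c, hc, fun x => ⟨by linarith [(h x).2], by linarith [(h x).1]⟩⟩
  · exact .inr ⟨_, h.flip⟩

lemma hasOverlap_const {p : ℝ} (hp : 0 < p) (hp' : p < 1) : HasOverlap fun _ => p :=
  .inl ⟨min p (1 - p), lt_min hp (by linarith), fun _ =>
    ⟨min_le_left _ _, by linarith [min_le_right p (1 - p)]⟩⟩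

variable [IsProbabilityMeasure P] {A X R : ℕ → Ω → ℝ}

lemma PropensitySample.moments_inv_of_hasOverlap (S : PropensitySample P e A X R)
    (he : Measurable e) (ho : HasOverlap e) : AllMoments P fun ω => (e (X 0 ω))⁻¹ := by
  rcases ho with ⟨c, hc, h⟩ | ⟨γ, h⟩
  · refine AllMoments.of_bound (he.comp (S.measurable_X 0)).inv c⁻¹ fun ω => ?_
    rw [abs_of_pos (inv_pos.2 (hc.trans_le (h _).1))]
    exact inv_anti₀ hc (h _).1
  · exact S.moments_inv h

/-- The inverse probability weighted estimator is asymptotically linear. -/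
theorem PropensitySample.asymptoticallyLinear_ipwEstimator (S : PropensitySample P e A X R)
    (he : Measurable e) (ho : HasOverlap e) (hr : IsPropensityRule e r) {Y : ℕ → Ω → ℝ} {b τ : ℝ}
    (hY : ∀ i ω, Y i ω = b + τ * A i ω + R i ω) :
    AsymptoticallyLinear P (ipwEstimator r A X Y) τ := by
  have he0 := ho.pos_and_lt_one
  have hYm : ∀ i, Measurable (Y i) := fun i => by
    have h := S.measurable_A i
    have h' := S.measurable_R i
    rw [funext (hY i)]
    fun_prop
  have known : AsymptoticallyLinear P (ipwEstimator (fun _ _ _ => e) A X Y) τ :=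
    S.asymptoticallyLinear_known he he0 (S.moments_inv_of_hasOverlap he ho)
      ((S.flip he he0).moments_inv_of_hasOverlap (he.const_sub 1) ho.flip) hY
      (measurable_ipwEstimator (IsPropensityRule.known.measurable he)
        S.measurable_A S.measurable_X hYm)
  have hT := measurable_ipwEstimator (hr.measurable he) S.measurable_A S.measurable_X hYm
  cases hr with
  | known => exact known
  | proportion p hp =>
    obtain rfl : e = fun _ => p := funext hp
    rw [ipwEstimator_proportion S.binary (he0 0).1 (he0 0).2]
    exact known
  | logistic γ hγ g hg => exact S.asymptoticallyLinear_logistic hγ hg hY hT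

variable {T : ℕ → Ω → ℝ} {τ : ℝ}

lemma AsymptoticallyLinear.memLp (h : AsymptoticallyLinear P T τ) (m : ℕ) : MemLp (T m) 2 P := by
  obtain ⟨ψ, Δ, hψ, hm, hid, -, -, -, hΔ, hT⟩ := h
  have := (((lpOrder_const τ).add (lpOrder_avg hψ hm hid)).add
    (hΔ.mono (b := 0) (by norm_num))).allMoments m
  rw [funext (hT m)]
  simpa using this.memLp 2

lemma AsymptoticallyLinear.exists_variance (h : AsymptoticallyLinear P T τ) :
    ∃ V : ℝ≥0, 0 < V ∧
      TendstoInDistribution (fun (m : ℕ) ω => √(m : ℝ) * (T m ω - τ)) atTop (id : ℝ → ℝ)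
        (fun _ => P) (gaussianReal 0 V) ∧
      Tendsto (fun m : ℕ => (m : ℝ) * Var[T m; P]) atTop (𝓝 (V : ℝ)) := by
  obtain ⟨ψ, Δ, hψ, hm, hid, hindep, h0, hV, hΔ, hT⟩ := h
  obtain ⟨h1, h2⟩ := asymptotics_of_linearization hψ hm hid hindep h0 hΔ hT
  refine ⟨Var[ψ 0; P].toNNReal, Real.toNNReal_pos.2 hV, h1, ?_⟩
  rwa [Real.coe_toNNReal _ hV.le]

end Rules

/-! ### Gaussian moments and construction of abstract samples. -/

section Samples

variable {Ω : Type*} [MeasurableSpace Ω] {P : Measure Ω}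

lemma allMoments_of_hasLaw_gaussianReal {X : Ω → ℝ} {μ : ℝ} {v : ℝ≥0} (mX : Measurable X)
    (h : HasLaw X (gaussianReal μ v) P) : AllMoments P X :=
  AllMoments.identDistrib (P := gaussianReal μ v) (f := id)
    ⟨measurable_id, fun k => (memLp_id_gaussianReal' k (by simp)).2⟩ mX
    (h.identDistrib HasLaw.id)

lemma allMoments_exp_of_hasLaw_gaussianReal {X : Ω → ℝ} {μ : ℝ} {v : ℝ≥0} (mX : Measurable X)
    (h : HasLaw X (gaussianReal μ v) P) (t : ℝ) :
    AllMoments P fun ω => Real.exp (t * X ω) := by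
  have key : ∀ t : ℝ, Integrable (fun ω => Real.exp (t * X ω)) P := fun t =>
    ((h.identDistrib HasLaw.id).comp (u := fun x => Real.exp (t * x))
      (by fun_prop)).integrable_iff.2 (integrable_exp_mul_gaussianReal t)
  refine ⟨by fun_prop, fun k => ?_⟩
  rcases Nat.eq_zero_or_pos k with rfl | hk
  · simp
  have hk' : (k : ENNReal) ≠ 0 := by exact_mod_cast hk.ne'
  refine MemLp.eLpNorm_lt_top ?_
  rw [← integrable_norm_rpow_iff (by fun_prop) hk' (by simp)]
  refine (key (k * t)).congr (ae_of_all _ fun ω => ?_)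
  simp only [ENNReal.toReal_natCast, Real.norm_eq_abs, Real.abs_exp, Real.rpow_natCast]
  rw [← Real.exp_nat_mul, mul_assoc]

/-- A centered random variable is orthogonal to any function of an independent one. -/
lemma integral_mul_eq_zero_of_indepFun {E : Type*} [MeasurableSpace E] {W : Ω → E} {Z : Ω → ℝ}
    (h : IndepFun W Z P) (mW : Measurable W) (mZ : Measurable Z) (hZ : ∫ ω, Z ω ∂P = 0)
    {φ : E → ℝ} (hφ : Measurable φ) : ∫ ω, φ (W ω) * Z ω ∂P = 0 := by
  have := (h.comp hφ measurable_id).integral_fun_mul_eq_mul_integral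
    (hφ.comp mW).aestronglyMeasurable mZ.aestronglyMeasurable
  simpa [hZ] using this

variable [IsProbabilityMeasure P]

/-- The joint law of a random variable and a binary random variable is determined by the marginal
law and the conditional mean. -/
lemma identDistrib_prodMk_of_binary {E : Type*} [MeasurableSpace E] {W W' : Ω → E} {A A' : Ω → ℝ}
    (mW : Measurable W) (mW' : Measurable W') (mA : Measurable A) (mA' : Measurable A')
    (hA : ∀ ω, A ω = 0 ∨ A ω = 1) (hA' : ∀ ω, A' ω = 0 ∨ A' ω = 1)
    (hW : IdentDistrib W W' P P)
    (h : ∀ g : E → ℝ, Measurable g → (∀ w, |g w| ≤ 1) →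
      ∫ ω, A ω * g (W ω) ∂P = ∫ ω, A' ω * g (W' ω) ∂P) :
    IdentDistrib (fun ω => (W ω, A ω)) (fun ω => (W' ω, A' ω)) P P := by
  -- For binary `A`, the indicator of `s` at `(W, A)` is affine in `A`, so the law only involves
  -- expectations of `g(W)` and `A * g(W)`.
  have key : ∀ (s : Set (E × ℝ)), MeasurableSet s → ∀ (W : Ω → E) (A : Ω → ℝ), Measurable W →
      Measurable A → (∀ ω, A ω = 0 ∨ A ω = 1) →
      (P.map fun ω => (W ω, A ω)).real s
        = ∫ ω, A ω * (s.indicator 1 (W ω, 1) - s.indicator 1 (W ω, 0)) ∂P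
          + ∫ ω, s.indicator (1 : E × ℝ → ℝ) (W ω, 0) ∂P := by
    intro s hs W A mW mA hA
    have m1 : ∀ c : ℝ, Measurable fun ω => s.indicator (1 : E × ℝ → ℝ) (W ω, c) := fun c =>
      (measurable_one.indicator hs).comp (mW.prodMk measurable_const)
    have b1 : ∀ z, |s.indicator (1 : E × ℝ → ℝ) z| ≤ 1 := fun z => by
      by_cases hz : z ∈ s <;> simp [hz]
    have i1 : ∀ c : ℝ, AllMoments P fun ω => s.indicator (1 : E × ℝ → ℝ) (W ω, c) := fun c =>
      AllMoments.of_bound (m1 c) 1 fun ω => b1 _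
    have iA : AllMoments P A := AllMoments.of_bound mA 1 fun ω => by
      rcases hA ω with h | h <;> simp [h]
    rw [← integral_add (iA.mul ((i1 1).sub (i1 0))).integrable (i1 0).integrable,
      ← integral_indicator_one hs, integral_map (mW.prodMk mA).aemeasurable
        (measurable_one.indicator hs).aestronglyMeasurable]
    refine integral_congr_ae (ae_of_all _ fun ω => ?_)
    rcases hA ω with h | h <;> simp [h]
  refine ⟨(mW.prodMk mA).aemeasurable, (mW'.prodMk mA').aemeasurable, ?_⟩
  have := Measure.isProbabilityMeasure_map (μ := P) (mW.prodMk mA).aemeasurable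
  have := Measure.isProbabilityMeasure_map (μ := P) (mW'.prodMk mA').aemeasurable
  refine Measure.ext fun s hs => (measureReal_eq_measureReal_iff).1 ?_
  rw [key s hs W A mW mA hA, key s hs W' A' mW' mA' hA']
  have mi : ∀ c : ℝ, Measurable fun w => s.indicator (1 : E × ℝ → ℝ) (w, c) := fun c =>
    (measurable_one.indicator hs).comp (measurable_id.prodMk measurable_const)
  congr 1
  · refine h (fun w => s.indicator 1 (w, 1) - s.indicator 1 (w, 0)) ((mi 1).sub (mi 0)) fun w => ?_
    by_cases h1 : (w, (1 : ℝ)) ∈ s <;> by_cases h0 : (w, (0 : ℝ)) ∈ s <;> simp [h1, h0]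
  · exact (hW.comp (mi 0)).integral_eq

variable {e : ℝ → ℝ} {A X S ε : ℕ → Ω → ℝ}

/-- A Gaussian covariate, a binary treatment, and a residual with an independent nondegenerate
Gaussian component. -/
lemma propensitySample_of_noise {μ : ℝ} {v w : ℝ≥0} (hv : v ≠ 0) (hw : w ≠ 0)
    (me : Measurable e) (he0 : ∀ x, 0 < e x ∧ e x < 1)
    (mA : ∀ i, Measurable (A i)) (mX : ∀ i, Measurable (X i)) (mS : ∀ i, Measurable (S i))
    (mε : ∀ i, Measurable (ε i)) (hA : ∀ i ω, A i ω = 0 ∨ A i ω = 1)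
    (hindep : iIndepFun (fun i ω => (A i ω, X i ω, S i ω + ε i ω)) P)
    (hid : ∀ i, IdentDistrib (fun ω => (A i ω, X i ω, S i ω))
      (fun ω => (A 0 ω, X 0 ω, S 0 ω)) P P)
    (hX : HasLaw (X 0) (gaussianReal μ v) P) (hε : ∀ i, HasLaw (ε i) (gaussianReal 0 w) P)
    (hεi : ∀ i, IndepFun (fun ω => (A i ω, X i ω, S i ω)) (ε i) P)
    (MS : AllMoments P (S 0)) (hS0 : ∫ ω, S 0 ω ∂P = 0)
    (hprop : ∀ g : ℝ → ℝ, Measurable g → AllMoments P (fun ω => g (X 0 ω)) →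
      ∫ ω, A 0 ω * g (X 0 ω) ∂P = ∫ ω, e (X 0 ω) * g (X 0 ω) ∂P)
    (hpropS : ∀ g : ℝ → ℝ, Measurable g → AllMoments P (fun ω => g (X 0 ω)) →
      ∫ ω, A 0 ω * (g (X 0 ω) * S 0 ω) ∂P = ∫ ω, e (X 0 ω) * (g (X 0 ω) * S 0 ω) ∂P) :
    PropensitySample P e A X fun i ω => S i ω + ε i ω := by
  have Mε := allMoments_of_hasLaw_gaussianReal (mε 0) (hε 0)
  have hε0 : ∫ ω, ε 0 ω ∂P = 0 := by rw [(hε 0).integral_eq]; exact integral_id_gaussianReal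
  have MA : AllMoments P (A 0) := AllMoments.of_bound (mA 0) 1 fun ω => by
    rcases hA 0 ω with h | h <;> simp [h]
  have Me : AllMoments P fun ω => e (X 0 ω) := AllMoments.of_bound (me.comp (mX 0)) 1 fun ω => by
    rw [abs_of_pos (he0 _).1]; exact (he0 _).2.le
  have orth : ∀ φ : ℝ × ℝ × ℝ → ℝ, Measurable φ →
      ∫ ω, φ (A 0 ω, X 0 ω, S 0 ω) * ε 0 ω ∂P = 0 := fun φ hφ =>
    integral_mul_eq_zero_of_indepFun (hεi 0) ((mA 0).prodMk ((mX 0).prodMk (mS 0))) (mε 0) hε0 hφ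
  refine ⟨mA, mX, fun i => (mS i).add (mε i), hA, hindep, fun i => ?_,
    allMoments_exp_of_hasLaw_gaussianReal (mX 0) hX, fun c => ?_, MS.add Mε, ?_, hprop,
    fun g mg Mg => ?_, fun f mf hf => ?_⟩
  · exact ((hid i).prodMk ((hε i).identDistrib (hε 0)) (hεi i) (hεi 0)).comp
      (u := fun z => (z.1.1, z.1.2.1, z.1.2.2 + z.2)) (by fun_prop)
  · have := nullSingletonClass_gaussianReal (μ := μ) hv
    rw [hX.ae_iff (p := fun x => x ≠ c) (by measurability)]
    exact Measure.ae_ne _ c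
  · rw [integral_add MS.integrable Mε.integrable, hS0, hε0, add_zero]
  · have h1 := orth (fun z => z.1 * g z.2.1) (by fun_prop)
    have h2 := orth (fun z => e z.2.1 * g z.2.1) (by fun_prop)
    simp only [mul_add]
    simp only [mul_assoc] at h1 h2
    rw [integral_add (MA.mul (Mg.mul MS)).integrable (MA.mul (Mg.mul Mε)).integrable,
      integral_add (Me.mul (Mg.mul MS)).integrable (Me.mul (Mg.mul Mε)).integrable,
      h1, h2, hpropS g mg Mg]
  -- If the residual were a function of `(A, X)`, then `ε` would be one of `(A, X, S)`, hence
  -- independent of itself, contradicting its positive variance.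
  · have h1 : IndepFun (ε 0) (ε 0) P := by
      refine ((hεi 0).comp (φ := fun z => f (z.1, z.2.1) - z.2.2) (by fun_prop)
        measurable_id).congr ?_ (ae_of_all _ fun _ => rfl)
      filter_upwards [hf] with ω hω
      simp [← hω]
    have h2 := h1.covariance_eq_zero (by simpa using Mε.memLp 2) (by simpa using Mε.memLp 2)
    rw [covariance_self (mε 0).aemeasurable, (hε 0).variance_eq, variance_id_gaussianReal] at h2
    exact hw (by exact_mod_cast h2)

end Samples

/-! ### The observational study as an abstract sample. -/

section ObservationalStudy

variable {Ω : Type*} [MeasurableSpace Ω] {P : Measure Ω} {θ : LinParams}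
  {e : ℝ → ℝ} {A X U Y ν ε : ℕ → Ω → ℝ}

namespace IsObsSample

/-- Eliminating `U` moves `βU * δA` into the coefficient of `A`: this is the confounding bias. The
mean of `X` goes into the intercept so that the residual is centered. -/
lemma outcome_eq (h : IsObsSample P θ e A X U Y ν ε) (i : ℕ) (ω : Ω) :
    Y i ω = θ.β₀ + θ.βU * θ.δ₀ + (θ.βX + θ.βU * θ.δX) * θ.μX + (θ.βA + θ.βU * θ.δA) * A i ω
      + ((θ.βX + θ.βU * θ.δX) * (X i ω - θ.μX) + θ.βU * ν i ω + ε i ω) := by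
  rw [h.Y_eq, h.U_eq]
  ring

variable [IsProbabilityMeasure P]

lemma integral_propensity (h : IsObsSample P θ e A X U Y ν ε) (i : ℕ) {g : ℝ → ℝ}
    (hg : Measurable g) (Mg : Integrable (fun ω => g (X i ω)) P) :
    ∫ ω, A i ω * g (X i ω) ∂P = ∫ ω, e (X i ω) * g (X i ω) ∂P := by
  have hm := (h.measurable_X i).comap_le
  have hA1 : ∀ ω, ‖A i ω‖ ≤ 1 := fun ω => by rcases h.binary i ω with h | h <;> simp [h]
  have iA : Integrable (A i) P :=
    Integrable.of_bound (h.measurable_A i).aestronglyMeasurable 1 (ae_of_all _ hA1)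
  have iAg : Integrable (fun ω => A i ω * g (X i ω)) P :=
    Mg.bdd_mul (h.measurable_A i).aestronglyMeasurable (ae_of_all _ hA1)
  have hgX : StronglyMeasurable[MeasurableSpace.comap (X i) inferInstance] fun ω => g (X i ω) :=
    (hg.comp (comap_measurable (X i))).stronglyMeasurable
  rw [← integral_condExp hm]
  refine integral_congr_ae ?_
  filter_upwards [condExp_mul_of_stronglyMeasurable_right hgX iAg iA, h.propensity i] with ω h1 h2
  exact h1.trans (congrArg (· * g (X i ω)) h2)

/-- Apart from `ε`, the residual is a function of `X` plus a multiple of `ν`, which is independent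
of `(X, A)`; hence it is uncorrelated with `A` given `X`. -/
lemma propensitySample (h : IsObsSample P θ e A X U Y ν ε) (hvarX : 0 < θ.varX)
    (hvarε : 0 < θ.varε) (me : Measurable e) (he0 : ∀ x, 0 < e x ∧ e x < 1) :
    PropensitySample P e A X fun i ω =>
      (θ.βX + θ.βU * θ.δX) * (X i ω - θ.μX) + θ.βU * ν i ω + ε i ω := by
  have mA := h.measurable_A
  have mX := h.measurable_X
  have mν := h.measurable_ν
  have MX := allMoments_of_hasLaw_gaussianReal (mX 0) (h.law_X 0)
  have Mν := allMoments_of_hasLaw_gaussianReal (mν 0) (h.law_ν 0)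
  have hν0 : ∫ ω, ν 0 ω ∂P = 0 := by
    rw [(h.law_ν 0).integral_eq]; exact integral_id_gaussianReal
  have hX0 : ∫ ω, X 0 ω ∂P = θ.μX := by
    rw [(h.law_X 0).integral_eq]; exact integral_id_gaussianReal
  have MA : AllMoments P (A 0) := AllMoments.of_bound (mA 0) 1 fun ω => by
    rcases h.binary 0 ω with h | h <;> simp [h]
  have Me : AllMoments P fun ω => e (X 0 ω) := AllMoments.of_bound (me.comp (mX 0)) 1 fun ω => by
    rw [abs_of_pos (he0 _).1]; exact (he0 _).2.le
  set κ := θ.βX + θ.βU * θ.δX with hκ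
  have M1 : AllMoments P fun ω => X 0 ω - θ.μX := MX.sub (allMoments_const _)
  have prop0 : ∀ g : ℝ → ℝ, Measurable g → AllMoments P (fun ω => g (X 0 ω)) →
      ∫ ω, A 0 ω * g (X 0 ω) ∂P = ∫ ω, e (X 0 ω) * g (X 0 ω) ∂P := fun g hg Mg =>
    h.integral_propensity 0 hg Mg.integrable
  -- Equality of the joint laws across units is not assumed; it follows from the common law of `X`
  -- and the common propensity.
  have hid : ∀ i, IdentDistrib (fun ω => (X i ω, A i ω)) (fun ω => (X 0 ω, A 0 ω)) P P :=
    fun i => by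
      have hX := (h.law_X i).identDistrib (h.law_X 0)
      refine identDistrib_prodMk_of_binary (mX i) (mX 0) (mA i) (mA 0) (h.binary i) (h.binary 0)
        hX fun g mg hg => ?_
      have int : ∀ i, Integrable (fun ω => g (X i ω)) P := fun i =>
        Integrable.of_bound (mg.comp (mX i)).aestronglyMeasurable 1 (ae_of_all _ fun ω => hg _)
      rw [h.integral_propensity i mg (int i), h.integral_propensity 0 mg (int 0)]
      exact (hX.comp (me.mul mg)).integral_eq
  refine propensitySample_of_noise hvarX.ne' hvarε.ne' me he0 mA mX (fun i => by fun_prop)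
    h.measurable_ε h.binary ?_ (fun i => ?_) (h.law_X 0) h.law_ε (fun i => ?_)
    ((M1.const_mul κ).add (Mν.const_mul θ.βU)) ?_ prop0 fun g mg Mg => ?_
  -- The residual is recovered from `(A, Y)` by subtracting the intercept and treatment effect, so
  -- it inherits independence across units.
  · convert h.indep_units.comp (fun _ z => (z.1, z.2.1, z.2.2.2 - (θ.β₀ + θ.βU * θ.δ₀ + κ * θ.μX)
      - (θ.βA + θ.βU * θ.δA) * z.1)) (fun _ => by fun_prop) using 3 with i ω
    simp only [Function.comp_apply, h.outcome_eq, ← hκ]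
    ring_nf
  · exact ((hid i).prodMk ((h.law_ν i).identDistrib (h.law_ν 0)) (h.indep_ν i) (h.indep_ν 0)).comp
      (u := fun z => (z.1.2, z.1.1, κ * (z.1.1 - θ.μX) + θ.βU * z.2)) (by fun_prop)
  · exact (h.indep_ε i).comp (φ := fun z => (z.2.1, z.1, κ * (z.1 - θ.μX) + θ.βU * z.2.2))
      (by fun_prop) measurable_id
  · rw [integral_add (M1.const_mul κ).integrable (Mν.const_mul θ.βU).integrable,
      integral_const_mul, integral_const_mul, hν0,
      integral_sub MX.integrable (allMoments_const _).integrable, hX0]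
    simp
  · have M2 := (M1.const_mul κ).mul Mg
    have M3 := Mg.mul (Mν.const_mul θ.βU)
    have h1 := prop0 (fun x => κ * (x - θ.μX) * g x) (by fun_prop) M2
    have mXA : Measurable fun ω => (X 0 ω, A 0 ω) := (mX 0).prodMk (mA 0)
    have h2 := integral_mul_eq_zero_of_indepFun (h.indep_ν 0) mXA (mν 0) hν0
      (φ := fun z => z.2 * (g z.1 * θ.βU)) (by fun_prop)
    have h3 := integral_mul_eq_zero_of_indepFun (h.indep_ν 0) mXA (mν 0) hν0
      (φ := fun z => e z.1 * (g z.1 * θ.βU)) (by fun_prop)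
    have h4 : ∀ B : Ω → ℝ, AllMoments P B →
        ∫ ω, B ω * (g (X 0 ω) * (κ * (X 0 ω - θ.μX) + θ.βU * ν 0 ω)) ∂P
          = ∫ ω, B ω * (κ * (X 0 ω - θ.μX) * g (X 0 ω)) ∂P
            + ∫ ω, B ω * (g (X 0 ω) * θ.βU) * ν 0 ω ∂P := fun B MB => by
      have i2 : Integrable (fun ω => B ω * (g (X 0 ω) * θ.βU) * ν 0 ω) P := by
        convert (MB.mul M3).integrable using 2
        ring
      rw [← integral_add (MB.mul M2).integrable i2]
      congr 1
      ext ω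
      ring
    rw [h4 _ MA, h4 _ Me, h1, h2, h3]

end IsObsSample

end ObservationalStudy

/-! ### The randomized trial as an abstract sample. -/

section RandomizedTrial

variable {Ω : Type*} [MeasurableSpace Ω] {P : Measure Ω} {θ : LinParams}
  {p : ℝ} {L : Measure (ℝ × ℝ)} {A X U Y ε : ℕ → Ω → ℝ}

namespace IsRCTSample

lemma integral_treatment_mul (h : IsRCTSample P θ p L A X U Y ε) (i : ℕ) {g : ℝ × ℝ → ℝ}
    (hg : Measurable g) :
    ∫ ω, A i ω * g (X i ω, U i ω) ∂P = ∫ ω, p * g (X i ω, U i ω) ∂P := by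
  have hA : ∫ ω, A i ω ∂P = p := by
    rw [← h.prob_A i, ← integral_indicator_one (measurableSet_eq_fun (h.measurable_A i)
      measurable_const)]
    congr 1
    ext ω
    rcases h.binary i ω with h | h <;> simp [Set.indicator, h]
  have := ((h.indep_A i).symm.comp measurable_id hg).integral_fun_mul_eq_mul_integral
    (h.measurable_A i).aestronglyMeasurable
    (hg.comp ((h.measurable_X i).prodMk (h.measurable_U i))).aestronglyMeasurable
  rw [integral_const_mul]
  simpa [hA] using this

/-- Since `U` is independent of `A` here, it remains in the residual and does not alter the
coefficient `βA`. The centerings `a` and `b` will be the means of `X` and `U`. -/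
lemma outcome_eq (h : IsRCTSample P θ p L A X U Y ε) (a b : ℝ) (i : ℕ) (ω : Ω) :
    Y i ω = θ.β₀ + θ.βX * a + θ.βU * b + θ.βA * A i ω
      + (θ.βX * (X i ω - a) + θ.βU * (U i ω - b) + ε i ω) := by
  rw [h.Y_eq]
  ring

variable [IsProbabilityMeasure P]

lemma propensitySample (h : IsRCTSample P θ p L A X U Y ε) (hvarε : 0 < θ.varε) (hp : 0 < p)
    (hp' : p < 1) {μ : ℝ} {v : ℝ≥0} (hv : v ≠ 0) (hX : HasLaw (X 0) (gaussianReal μ v) P)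
    (MU : AllMoments P (U 0)) :
    PropensitySample P (fun _ => p) A X fun i ω => θ.βX * (X i ω - ∫ ω, X 0 ω ∂P)
      + θ.βU * (U i ω - ∫ ω, U 0 ω ∂P) + ε i ω := by
  have mA := h.measurable_A
  have mX := h.measurable_X
  have mU := h.measurable_U
  have MX := allMoments_of_hasLaw_gaussianReal (mX 0) hX
  set a := ∫ ω, X 0 ω ∂P with ha
  set b := ∫ ω, U 0 ω ∂P with hb
  have M1 : AllMoments P fun ω => X 0 ω - a := MX.sub (allMoments_const _)
  have M2 : AllMoments P fun ω => U 0 ω - b := MU.sub (allMoments_const _)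
  have hid : ∀ i, IdentDistrib (fun ω => ((X i ω, U i ω), A i ω))
      (fun ω => ((X 0 ω, U 0 ω), A 0 ω)) P P := fun i => by
    have hW := (h.law_XU i).identDistrib (h.law_XU 0)
    refine identDistrib_prodMk_of_binary ((mX i).prodMk (mU i)) ((mX 0).prodMk (mU 0)) (mA i)
      (mA 0) (h.binary i) (h.binary 0) hW fun g mg _ => ?_
    rw [h.integral_treatment_mul i mg, h.integral_treatment_mul 0 mg]
    exact (hW.comp (mg.const_mul p)).integral_eq
  refine propensitySample_of_noise hv hvarε.ne' measurable_const (fun _ => ⟨hp, hp'⟩) mA mX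
    (fun i => by fun_prop) h.measurable_ε h.binary ?_ (fun i => ?_) hX h.law_ε (fun i => ?_)
    ((M1.const_mul _).add (M2.const_mul _)) ?_
    (fun g mg _ => h.integral_treatment_mul 0 (g := fun z => g z.1) (by fun_prop))
    fun g mg _ => h.integral_treatment_mul 0
      (g := fun z => g z.1 * (θ.βX * (z.1 - a) + θ.βU * (z.2 - b))) (by fun_prop)
  · convert h.indep_units.comp (fun _ z => (z.1, z.2.1,
      z.2.2.2 - (θ.β₀ + θ.βX * a + θ.βU * b) - θ.βA * z.1)) (fun _ => by fun_prop)
      using 3 with i ω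
    simp only [Function.comp_apply, h.outcome_eq a b]
    ring_nf
  · exact (hid i).comp (u := fun z => (z.2, z.1.1, θ.βX * (z.1.1 - a) + θ.βU * (z.1.2 - b)))
      (by fun_prop)
  · exact (h.indep_ε i).comp
      (φ := fun z => (z.2.2, z.1, θ.βX * (z.1 - a) + θ.βU * (z.2.1 - b)))
      (by fun_prop) measurable_id
  · rw [integral_add (M1.const_mul _).integrable (M2.const_mul _).integrable,
      integral_const_mul, integral_const_mul,
      integral_sub MX.integrable (allMoments_const _).integrable,
      integral_sub MU.integrable (allMoments_const _).integrable, ← ha, ← hb]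
    simp

end IsRCTSample

end RandomizedTrial

/-! ### The main theorem. -/

/-- Viewing the estimator as a function of the whole data sequence lets independence of the datasets
pass to the estimators. -/
lemma measurable_ipwEstimator_comap {r : PropensityRule}
    (hr : ∀ m, Measurable fun d : (Fin m → ℝ) × (Fin m → ℝ) × ℝ => r m d.1 d.2.1 d.2.2) (m : ℕ) :
    Measurable (ipwEstimator r (fun i (z : ℕ → ℝ × ℝ × ℝ) => (z i).1) (fun i z => (z i).2.1)
      (fun i z => (z i).2.2) m) :=
  measurable_ipwEstimator hr (fun i => by fun_prop) (fun i => by fun_prop) (fun i => by fun_prop) m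

theorem lemma1 {Ω : Type*} [MeasurableSpace Ω] (P : Measure Ω) [IsProbabilityMeasure P]
    (θ : LinParams) (hvarX : 0 < θ.varX) (hvarε : 0 < θ.varε)
    -- the observational study
    (e : ℝ → ℝ) (he : Measurable e) (hoverlap : HasOverlap e)
    (Ao Xo Uo Yo νo εo : ℕ → Ω → ℝ) (hobs : IsObsSample P θ e Ao Xo Uo Yo νo εo)
    -- the randomized trial, with the same joint law of `(X, U)`
    (p : ℝ) (hp : 0 < p) (hp' : p < 1)
    (Ar Xr Ur Yr εr : ℕ → Ω → ℝ)
    (hrct : IsRCTSample P θ p (P.map (fun ω => (Xo 0 ω, Uo 0 ω))) Ar Xr Ur Yr εr)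
    -- the two datasets are independent
    (hindep : IndepFun (fun ω (i : ℕ) => (Ao i ω, Xo i ω, Yo i ω))
      (fun ω (i : ℕ) => (Ar i ω, Xr i ω, Yr i ω)) P)
    -- the propensity functions used in the two IPW estimators
    (ro rr : PropensityRule) (hro : IsPropensityRule e ro)
    (hrr : IsPropensityRule (fun _ => p) rr) :
    ∃ Vo Vr : ℝ≥0, 0 < Vo ∧ 0 < Vr ∧
      -- observational study
      TendstoInDistribution
        (fun (m : ℕ) ω => √(m : ℝ) * (ipwEstimator ro Ao Xo Yo m ω - θ.βA - θ.βU * θ.δA))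
        atTop (id : ℝ → ℝ) (fun _ => P) (gaussianReal 0 Vo) ∧
      (∀ m, MemLp (ipwEstimator ro Ao Xo Yo m) 2 P) ∧
      Tendsto (fun m : ℕ => (m : ℝ) * Var[ipwEstimator ro Ao Xo Yo m; P]) atTop (𝓝 (Vo : ℝ)) ∧
      -- randomized trial
      TendstoInDistribution
        (fun (n : ℕ) ω => √(n : ℝ) * (ipwEstimator rr Ar Xr Yr n ω - θ.βA))
        atTop (id : ℝ → ℝ) (fun _ => P) (gaussianReal 0 Vr) ∧
      (∀ n, MemLp (ipwEstimator rr Ar Xr Yr n) 2 P) ∧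
      Tendsto (fun n : ℕ => (n : ℝ) * Var[ipwEstimator rr Ar Xr Yr n; P]) atTop (𝓝 (Vr : ℝ)) ∧
      -- the studentized difference under the null hypothesis
      (θ.omegaObs = θ.omegaRCT →
        TendstoInDistribution
          (fun (k : ℕ × ℕ) ω =>
            (ipwEstimator ro Ao Xo Yo k.1 ω - ipwEstimator rr Ar Xr Yr k.2 ω) /
              √((Vo : ℝ) / (k.1 : ℝ) + (Vr : ℝ) / (k.2 : ℝ)))
          (atTop ×ˢ atTop) (id : ℝ → ℝ) (fun _ => P) (gaussianReal 0 1) ∧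
        ∀ VoHat VrHat : ℕ → Ω → ℝ,
          (∀ m, AEMeasurable (VoHat m) P) → (∀ n, AEMeasurable (VrHat n) P) →
          TendstoInMeasure P VoHat atTop (fun _ => (Vo : ℝ)) →
          TendstoInMeasure P VrHat atTop (fun _ => (Vr : ℝ)) →
          TendstoInDistribution
            (fun (k : ℕ × ℕ) ω =>
              (ipwEstimator ro Ao Xo Yo k.1 ω - ipwEstimator rr Ar Xr Yr k.2 ω) /
                √(VoHat k.1 ω / (k.1 : ℝ) + VrHat k.2 ω / (k.2 : ℝ)))
            (atTop ×ˢ atTop) (id : ℝ → ℝ) (fun _ => P) (gaussianReal 0 1)) := by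
  have he0 := hoverlap.pos_and_lt_one
  have mAo := hobs.measurable_A
  have mXo := hobs.measurable_X
  have mνo := hobs.measurable_ν
  have mUo : Measurable (Uo 0) := by
    rw [funext (hobs.U_eq 0)]
    fun_prop
  have mYo : ∀ i, Measurable (Yo i) := fun i => by
    have := hobs.measurable_ε i
    rw [funext (hobs.outcome_eq i)]
    fun_prop
  have mYr : ∀ i, Measurable (Yr i) := fun i => by
    have h1 := hrct.measurable_A i
    have h2 := hrct.measurable_X i
    have h3 := hrct.measurable_U i
    have h4 := hrct.measurable_ε i
    rw [funext (hrct.Y_eq i)]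
    fun_prop
  have So := hobs.propensitySample hvarX hvarε he he0
  -- `U` need not be Gaussian, since it contains the binary treatment; its moments come from its
  -- summands and pass to the trial through the common law of `(X, U)`.
  have MUo : AllMoments P (Uo 0) := by
    rw [funext (hobs.U_eq 0)]
    exact (((allMoments_const _).add (So.moments_A.const_mul _)).add
      (So.moments_X.const_mul _)).add (allMoments_of_hasLaw_gaussianReal (mνo 0) (hobs.law_ν 0))
  have hXU : IdentDistrib (fun ω => (Xr 0 ω, Ur 0 ω)) (fun ω => (Xo 0 ω, Uo 0 ω)) P P :=
    ⟨(hrct.law_XU 0).aemeasurable, ((mXo 0).prodMk mUo).aemeasurable, (hrct.law_XU 0).map_eq⟩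
  have Sr := hrct.propensitySample hvarε hp hp' hvarX.ne'
    ((hXU.comp measurable_fst).symm.hasLaw (hobs.law_X 0))
    (MUo.identDistrib (hrct.measurable_U 0) (hXU.comp measurable_snd))
  have Lo := So.asymptoticallyLinear_ipwEstimator he hoverlap hro hobs.outcome_eq
  have Lr := Sr.asymptoticallyLinear_ipwEstimator measurable_const (hasOverlap_const hp hp') hrr
    (hrct.outcome_eq _ _)
  have hTom := measurable_ipwEstimator (hro.measurable he) mAo mXo mYo
  have hTrm := measurable_ipwEstimator (hrr.measurable measurable_const) hrct.measurable_A
    hrct.measurable_X mYr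
  obtain ⟨Vo, hVo, co, vo⟩ := Lo.exists_variance
  obtain ⟨Vr, hVr, cr, vr⟩ := Lr.exists_variance
  refine ⟨Vo, Vr, hVo, hVr, by simpa only [sub_sub] using co, Lo.memLp, vo, cr, Lr.memLp, vr,
    fun h0 => ?_⟩
  rw [show θ.βA + θ.βU * θ.δA = θ.βA from h0] at co
  have hST : ∀ m n, IndepFun (ipwEstimator ro Ao Xo Yo m) (ipwEstimator rr Ar Xr Yr n) P :=
    fun m n => hindep.comp (measurable_ipwEstimator_comap (hro.measurable he) m)
      (measurable_ipwEstimator_comap (hrr.measurable measurable_const) n)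
  have key := tendstoInDistribution_studentized_difference hVo hVr co cr hTom hTrm hST
  exact ⟨key, fun VoHat VrHat hVom hVrm hVol hVrl =>
    tendstoInDistribution_estimated_studentized_difference hVo hVr key hTom hTrm hVom hVrm
      hVol hVrl⟩
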